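/- **Setting.** Let $L$ be a first-order language, $T$ a model-complete $L$-theory, $K$ a field, and let $\Omega_{\mathbb V}(\underline x),\Omega_0(\underline x),\Omega_+(\underline x_1,\underline x_2,\underline y)$, $\Omega_q(\underline x,\underline y)$ ($q\in K$) be $L$-formulas that define an infinite $K$-vector space $\mathbb V=(\mathbb V,0,+,(q\cdot)_{q\in K})$ of $n$-tuples in every model of $T$. Let $L_\theta=L\cup\{\theta\}$, where $\theta$ is a symbol for a map on $n$-tuples (given by $n$ new $n$-ary function symbols; for $n=1$ one unary function symbol), and let $T_\theta$ be $T$ together with the axioms "$\theta|_{\mathbb V}$ is a $K$-linear endomorphism of $\mathbb V$" and "$\theta(x)=0$ for $x\notin\mathbb V$". For $\rho=\sum_i\rho_iX^i\in K[X]$ put $\rho[\theta](v)=\sum_i\rho_i\theta^i(v)$ for $v\in\mathbb V$; kernels and images of $\rho[\theta]$ are taken in $\mathbb V$. *Kernel configurations.* Let $K[X]_{\rm irr}$ be the set of monic irreducible polynomials over $K$. A kernel configuration $C$ consists of a function $f\mapsto C(f)$ from $K[X]_{\rm irr}$ to $\mathbb N\cup\{\infty\}$ and a degree $\deg C\in\mathbb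 N_{>0}\cup\{\infty\}$ such that $\deg C=\infty$ (transcendental) or $\deg C=\sum_f\deg(f)\,C(f)<\infty$ (algebraic); in the algebraic case $\mathrm{MiPo}(C)=\prod_f f^{C(f)}$. The theory $T_\theta^C$ is $T_\theta$ together with $\mathrm{MiPo}(C)[\theta]=0$ if $C$ is algebraic, and with $\mathrm{Ker}(f^{C(f)}[\theta])=\mathrm{Ker}(f^{C(f)+1}[\theta])$ for all $f$ with $C(f)<\infty$ if $C$ is transcendental. The map $\theta$ is *$C$-image-complete* if $\mathrm{Im}(f^{C(f)+1}[\theta])=\mathrm{Im}(f^{C(f)}[\theta])$ for all $f$ with $C(f)<\infty$. *$C$-sequence-systems.* A $C$-sequence-system is a conjunction $$S(\underline x;\underline y)=\bigwedge_{k=1}^{s}\Big(\xi_k[\theta](x_{{\rm ld},k})=\sum_{l=1}^m P_{k,l}[\theta](x_{{\rm li},l})+y_{{\rm ld},k}\Big)\wedge\bigwedge_{k=1}^r f_k^{q_k}[\theta](x_{{\rm ke},k})=y_{{\rm ke},k}$$ with $\xi_k,P_{k,l}\in K[X]$, in variables $\underline x=(\underline x_{\rm li},\underline x_{\rm ld},\underline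 x_{\rm ke})$ and parameters $\underline y=(\underline y_{\rm ld},\underline y_{\rm ke})$ ranging over $\mathbb V$, such that: $m=s=0$ if $C$ is algebraic; each $\xi_k$ is monic of positive degree and $C(f)=\infty$ for every $f\in K[X]_{\rm irr}$ dividing $\xi_k$; $f_k\in K[X]_{\rm irr}$, $0<q_k\le C(f_k)<\infty$; and $y_{{\rm ke},k}\in\mathrm{Ker}(f_k^{C(f_k)-q_k}[\theta])$. To every variable $x$ in $\underline x$ and $i\in\mathbb N$ belongs a placeholder variable $x^i$. An $L$-formula $\psi(\vec{x};\underline z)$ in finitely many placeholder variables, which range over $\mathbb V$, and further variables $\underline z$ is *bounded* by $S$ if $x_{{\rm ld},k}^i$ occurs only for $i<\deg\xi_k$ and $x_{{\rm ke},k}^i$ only for $i<\deg f_k^{q_k}$. Let $\psi_\theta(\underline x;\underline z)$ be the result of replacing every $x^i$ in $\psi$ by $\theta^i(x)$. Let $\delta_{\psi,S}(\underline y)$ be the formula $\bigwedge_k y_{{\rm ke},k}\in\mathrm{Ker}(f_k^{C(f_k)-q_k}[\theta])$ if $\psi$ is bounded by $S$, and $\bot$ otherwise. *Condition (H4).* For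 every $L$-formula $\psi(\underline x;\underline z)$, where $\underline x$ is a finite tuple of ($n$-tuples of) variables for elements of $\mathbb V$, there is an $L$-formula $\sigma_\psi(\underline z)$ such that for all $\mathcal M\models T$ and all $\underline d$ in $\mathcal M$: $\mathcal M\models\sigma_\psi(\underline d)$ if and only if there are an elementary extension $\mathcal M'\succ\mathcal M$ and a tuple $\underline w\in\mathbb V(\mathcal M')$ that is $K$-linearly independent over $\mathbb V(\mathcal M)$ with $\mathcal M'\models\psi(\underline w;\underline d)$. **Theorem 3.45 (Theorem C).** Suppose that $T$ satisfies (H4). Then for every kernel configuration $C$ the theory $T_\theta^C$ has a model companion. Moreover, for every choice of formulas $\sigma_\psi$ as in (H4), the model companion is axiomatized by $T_\theta^C$, "$\theta$ is $C$-image-complete", and the sentences $$\forall\underline z\;\forall\underline y\in\mathbb V\;\Big(\big(\sigma_\psi(\underline z)\wedge\delta_{\psi,S}(\underline y)\big)\to\exists\underline x\in\mathbb V\;\big(\psi_\theta(\underline x;\underline z)\wedge S(\underline x;\underline y)\big)\Big)$$ for all $\psi$ and $S$, and the models of these axioms are exactly the existentially closed models of $T_\theta^C$. -/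

import Mathlib

open FirstOrder Polynomial
open FirstOrder.Language

noncomputable section

namespace VecEndo

/-! ### Model completeness, existentially closed models, model companions

All models are non-empty and range over a fixed universe `w`. -/

/-- `T` is model complete: every embedding between models of `T` is elementary. -/
def IsModelComplete.{u, v, w} {L : FirstOrder.Language.{u, v}} (T : L.Theory) : Prop :=
  ∀ (M N : Type w) [L.Structure M] [L.Structure N] [Nonempty M] [Nonempty N],
    M ⊨ T → N ⊨ T → ∀ f : M ↪[L] N, ∃ g : M ↪ₑ[L] N, ∀ x, g x = f x

/-- `M` is an existentially closed model of `T`: it is a model of `T`, and every existential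
formula with parameters from `M` that holds in some model of `T` extending `M` holds in `M`. -/
def IsExistentiallyClosedModel.{u, v, w} {L : FirstOrder.Language.{u, v}} (T : L.Theory)
    (M : Type w) [L.Structure M] : Prop :=
  M ⊨ T ∧ ∀ (N : Type w) [L.Structure N] [Nonempty N], N ⊨ T → ∀ (f : M ↪[L] N) (r : ℕ)
    (φ : L.Formula (Fin r)), BoundedFormula.IsExistential φ →
      ∀ a : Fin r → M, φ.Realize (f ∘ a) → φ.Realize a

/-- `T'` is a model companion of `T`: each model of one of the two theories embeds into a model
of the other one, and `T'` is model complete. -/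
def IsModelCompanion.{u, v, w} {L : FirstOrder.Language.{u, v}} (T T' : L.Theory) : Prop :=
  (∀ (M : Type w) [L.Structure M] [Nonempty M], M ⊨ T →
    ∃ (N : Type w) (_ : L.Structure N), N ⊨ T' ∧ Nonempty (M ↪[L] N)) ∧
  (∀ (M : Type w) [L.Structure M] [Nonempty M], M ⊨ T' →
    ∃ (N : Type w) (_ : L.Structure N), N ⊨ T ∧ Nonempty (M ↪[L] N)) ∧
  IsModelComplete.{u, v, w} T'

/-! ### The definable vector space -/

universe u v k

/-- Parameter-free `L`-formulas that are meant to define a `K`-vector space whose underlying set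
is a set of `n`-tuples: its domain, its zero, the graph of its addition and, for every `q : K`,
the graph of the multiplication with `q`. -/
structure VecFormulas (L : FirstOrder.Language.{u, v}) (K : Type k) (n : ℕ) where
  dom : L.Formula (Fin n)
  zero : L.Formula (Fin n)
  add : L.Formula (Fin n ⊕ Fin n ⊕ Fin n)
  smul : K → L.Formula (Fin n ⊕ Fin n)

section Interpretation

variable {L : FirstOrder.Language.{u, v}} {K : Type k} [Field K] {n : ℕ}

/-- The set `V` defined in `M`. -/
def VecFormulas.carrier (Ω : VecFormulas L K n) (M : Type*) [L.Structure M] :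
    Set (Fin n → M) :=
  {x | Ω.dom.Realize x}

/-- A `K`-vector space structure on the set `V` defined in `M` whose zero, addition and scalar
multiplications are the ones defined by the given formulas. It is unique if it exists. -/
structure VecFormulas.Space (Ω : VecFormulas L K n) (M : Type*) [L.Structure M] where
  [group : AddCommGroup (Ω.carrier M)]
  [module : Module K (Ω.carrier M)]
  zero_iff : ∀ x : Ω.carrier M, Ω.zero.Realize x.1 ↔ x = 0
  add_iff : ∀ x y z : Ω.carrier M,
    Ω.add.Realize (Sum.elim x.1 (Sum.elim y.1 z.1)) ↔ x + y = z
  smul_iff : ∀ (q : K) (x y : Ω.carrier M),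
    (Ω.smul q).Realize (Sum.elim x.1 y.1) ↔ q • x = y

/-- The formulas define an infinite `K`-vector space in every model of `T`. -/
def VecFormulas.DefinesInfiniteSpace.{w} (Ω : VecFormulas L K n) (T : L.Theory) : Prop :=
  ∀ (M : Type w) [L.Structure M] [Nonempty M], M ⊨ T →
    Nonempty (Ω.Space M) ∧ (Ω.carrier M).Infinite

/-- For an elementary extension `f : M ↪ₑ[L] N`, the finite tuple `x` of elements of `V(N)` is
linearly independent over `V(M)`: no linear combination of `x` with coefficients that are not
all zero lies in `V(M)`. -/
def VecFormulas.LinIndepOver (Ω : VecFormulas L K n) {M N : Type*} [L.Structure M]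
    [L.Structure N] (f : M ↪ₑ[L] N) {p : ℕ} (x : Fin p → Ω.carrier N) : Prop :=
  ∃ I : Ω.Space N,
    letI := I.group
    letI := I.module
    ∀ a : Fin p → K,
      (∃ y ∈ Ω.carrier M, ((∑ j, a j • x j : Ω.carrier N) : Fin n → N) = f ∘ y) → a = 0

/-- The formula `σ(z)` expresses, in all models `M` of `T`, that in some elementary extension `N`
of `M` the formula `ψ(x; z)` has a realization `x` in `V(N)` that is linearly independent
over `V(M)`. Here `x` is a `p`-tuple of elements of `V`, hence a `p × n` array of variables. -/
def VecFormulas.ExpressesIndepRealization.{w} (Ω : VecFormulas L K n) (T : L.Theory) {p q : ℕ}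
    (ψ : L.Formula ((Fin p × Fin n) ⊕ Fin q)) (σ : L.Formula (Fin q)) : Prop :=
  ∀ (M : Type w) [L.Structure M] [Nonempty M], M ⊨ T → ∀ d : Fin q → M,
    σ.Realize d ↔ ∃ (N : Type w) (_ : L.Structure N) (f : M ↪ₑ[L] N) (x : Fin p → Ω.carrier N),
      Ω.LinIndepOver f x ∧ ψ.Realize (Sum.elim (fun j => (x j.1).1 j.2) (f ∘ d))

/-- Condition (H4): for every `L`-formula `ψ(x; z)` there is such a formula `σ(z)`. -/
def VecFormulas.H4.{w} (Ω : VecFormulas L K n) (T : L.Theory) : Prop :=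
  ∀ (p q : ℕ) (ψ : L.Formula ((Fin p × Fin n) ⊕ Fin q)), ∃ σ : L.Formula (Fin q),
    VecFormulas.ExpressesIndepRealization.{u, v, k, w} Ω T ψ σ

end Interpretation

/-! ### Kernel configurations -/

section Configurations

variable (K : Type k) [Field K]

/-- The irreducible monic polynomials over `K`. -/
abbrev IrrPoly : Type k := {f : K[X] // Irreducible f ∧ f.Monic}

/-- A kernel configuration over `K`. The supremum of the finite partial sums is the value of the
(possibly infinite) sum in `ℕ∞`. -/
structure KernelConfig where
  toFun : IrrPoly K → ℕ∞
  deg : ℕ∞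
  deg_ne_zero : deg ≠ 0
  deg_eq : deg = ⊤ ∨
    deg = ⨆ s : Finset (IrrPoly K), ∑ f ∈ s, (f.1.natDegree : ℕ∞) * toFun f

variable {K}

/-- The natural number `C(f)`, used only if `C(f) < ∞`. -/
def KernelConfig.exp (C : KernelConfig K) (f : IrrPoly K) : ℕ := (C.toFun f).toNat

/-- The minimal polynomial of an algebraic kernel configuration, i.e. of one with `deg < ∞`
(in that case only finitely many factors differ from `1`). -/
def KernelConfig.miPo (C : KernelConfig K) : K[X] := ∏ᶠ f : IrrPoly K, f.1 ^ C.exp f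

end Configurations

/-! ### The language with `θ` -/

/-- Function symbols `θ_0, …, θ_{n-1}` of arity `n`: the coordinates of a map on `n`-tuples. -/
inductive ThetaFunc (n : ℕ) : ℕ → Type
  | mk (c : Fin n) : ThetaFunc n n

/-- The language `L ∪ {θ}`. For `n = 1` this adds one unary function symbol. -/
abbrev withTheta (L : FirstOrder.Language.{u, v}) (n : ℕ) : FirstOrder.Language.{u, v} :=
  L.sum ⟨ThetaFunc n, fun _ => Empty⟩

section Formulas

variable {L : FirstOrder.Language.{u, v}} {K : Type k} {n : ℕ} {γ : Type}

/-- The inclusion of `L` into `L ∪ {θ}`. -/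
abbrev incl (L : FirstOrder.Language.{u, v}) (n : ℕ) : L →ᴸ withTheta L n := LHom.sumInl

/-- The tuple of terms `θ(t)`, for an `n`-tuple `t` of terms. -/
def thetaTerm (t : Fin n → (withTheta L n).Term γ) : Fin n → (withTheta L n).Term γ :=
  fun c => Term.func (Sum.inr (ThetaFunc.mk c)) t

/-- The tuple of terms `θ^i(x)`, for an `n`-tuple `x` of variables. -/
def thetaIter (x : Fin n → γ) (i : ℕ) : Fin n → (withTheta L n).Term γ :=
  thetaTerm^[i] (fun c => Term.var (x c))

/-- Terms in the language of `K`-vector spaces with an endomorphism `θ`. -/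
inductive VTerm (K : Type k) (β : Type) : Type k
  | var (x : β) : VTerm K β
  | zero : VTerm K β
  | add (s t : VTerm K β) : VTerm K β
  | smul (q : K) (t : VTerm K β) : VTerm K β
  | theta (t : VTerm K β) : VTerm K β

/-- The sum of a list of terms. -/
def VTerm.sum {β : Type} (l : List (VTerm K β)) : VTerm K β := l.foldr VTerm.add VTerm.zero

/-- The term `ρ[θ](t) = ∑ i, ρ_i • θ^i(t)`. -/
def VTerm.poly [Field K] {β : Type} (ρ : K[X]) (t : VTerm K β) : VTerm K β :=
  VTerm.sum ((List.range (ρ.natDegree + 1)).map fun i =>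
    VTerm.smul (ρ.coeff i) (VTerm.theta^[i] t))

variable (Ω : VecFormulas L K n)

/-- The formula `t ∈ V`, for an `n`-tuple of terms. -/
def memV (t : Fin n → (withTheta L n).Term γ) : (withTheta L n).Formula γ :=
  BoundedFormula.subst ((incl L n).onFormula Ω.dom) t

/-- The formula `t ∈ V ∧ t = 0`, for an `n`-tuple of terms. -/
def isZeroV (t : Fin n → (withTheta L n).Term γ) : (withTheta L n).Formula γ :=
  memV Ω t ⊓ BoundedFormula.subst ((incl L n).onFormula Ω.zero) t

/-- `∀ x ∈ V, φ`, where `x` is an `ι`-tuple of elements of `V`. -/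
def allV (ι : Type) [Finite ι] (φ : (withTheta L n).Formula (γ ⊕ (ι × Fin n))) :
    (withTheta L n).Formula γ :=
  Formula.iAlls (ι × Fin n)
    ((Formula.iInf fun i : ι => memV Ω fun c => Term.var (Sum.inr (i, c))).imp φ)

/-- `∃ x ∈ V, φ`, where `x` is an `ι`-tuple of elements of `V`. -/
def exV (ι : Type) [Finite ι] (φ : (withTheta L n).Formula (γ ⊕ (ι × Fin n))) :
    (withTheta L n).Formula γ :=
  Formula.iExs (ι × Fin n)
    ((Formula.iInf fun i : ι => memV Ω fun c => Term.var (Sum.inr (i, c))) ⊓ φ)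

/-- The formula `t = y ∧ y ∈ V`, where the variables of the term `t` are `n`-tuples of variables
and the `n`-tuple `y` is given by the right summand of the set of free variables. It is obtained
from the defining formulas of the vector space by recursion on `t`. -/
def graphV : VTerm K (Fin n → γ) → (withTheta L n).Formula (γ ⊕ Fin n)
  | .var x => memV Ω (fun c => Term.var (Sum.inr c)) ⊓
      Formula.iInf fun c : Fin n =>
        Term.equal (Term.var (Sum.inr c)) (Term.var (Sum.inl (x c)))
  | .zero => isZeroV Ω (fun c => Term.var (Sum.inr c))
  | .add s t => memV Ω (fun c => Term.var (Sum.inr c)) ⊓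
      exV Ω (Fin 2)
        ((graphV s).relabel (Sum.elim (Sum.inl ∘ Sum.inl) fun c => Sum.inr (0, c)) ⊓
          (graphV t).relabel (Sum.elim (Sum.inl ∘ Sum.inl) fun c => Sum.inr (1, c)) ⊓
          ((incl L n).onFormula Ω.add).relabel (Sum.elim (fun c => Sum.inr (0, c))
            (Sum.elim (fun c => Sum.inr (1, c)) fun c => Sum.inl (Sum.inr c))))
  | .smul q t => memV Ω (fun c => Term.var (Sum.inr c)) ⊓
      exV Ω (Fin 1)
        ((graphV t).relabel (Sum.elim (Sum.inl ∘ Sum.inl) fun c => Sum.inr (0, c)) ⊓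
          ((incl L n).onFormula (Ω.smul q)).relabel
            (Sum.elim (fun c => Sum.inr (0, c)) fun c => Sum.inl (Sum.inr c)))
  | .theta t => memV Ω (fun c => Term.var (Sum.inr c)) ⊓
      exV Ω (Fin 1)
        ((graphV t).relabel (Sum.elim (Sum.inl ∘ Sum.inl) fun c => Sum.inr (0, c)) ⊓
          Formula.iInf fun c : Fin n => Term.equal (Term.var (Sum.inl (Sum.inr c)))
            (thetaTerm (fun c' => Term.var (Sum.inr (0, c'))) c))

/-- The formula `s = t` for terms `s`, `t` with values in `V`. -/
def eqV (s t : VTerm K (Fin n → γ)) : (withTheta L n).Formula γ :=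
  Formula.iExs (Fin n) (graphV Ω s ⊓ graphV Ω t)

/-- The `i`-th element of the innermost quantified tuple of elements of `V`. -/
def bvar {ι : Type} (i : ι) : VTerm K (Fin n → γ ⊕ (ι × Fin n)) :=
  VTerm.var fun c => Sum.inr (i, c)

/-! ### The theories `T_θ` and `T_θ^C` -/

/-- `θ` maps `V` to `V`. -/
def thetaMapsSentence : (withTheta L n).Sentence :=
  allV Ω (Fin 1) (memV Ω (thetaTerm fun c => Term.var (Sum.inr (0, c))))

/-- `θ` is additive on `V`. -/
def thetaAddSentence : (withTheta L n).Sentence :=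
  allV Ω (Fin 2) (eqV Ω (.theta (.add (bvar 0) (bvar 1)))
    (.add (.theta (bvar 0)) (.theta (bvar 1))))

/-- `θ` commutes with the multiplication by `q` on `V`. -/
def thetaSMulSentence (q : K) : (withTheta L n).Sentence :=
  allV Ω (Fin 1) (eqV Ω (.theta (.smul q (bvar 0))) (.smul q (.theta (bvar 0))))

/-- `θ(x) = 0` for all `x` that are not in `V`. -/
def thetaOutsideSentence : (withTheta L n).Sentence :=
  Formula.iAlls (Fin n) ((memV Ω fun c => Term.var (Sum.inr c)).not.imp
    (isZeroV Ω (thetaTerm fun c => Term.var (Sum.inr c))))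

/-- The theory `T_θ`. -/
def thetaTheory (T : L.Theory) : (withTheta L n).Theory :=
  (incl L n).onTheory T ∪
    {thetaMapsSentence Ω, thetaAddSentence Ω, thetaOutsideSentence Ω} ∪
    Set.range (thetaSMulSentence Ω)

variable [Field K]

/-- `Ker(ρ[θ]) = V`. -/
def kerAllSentence (ρ : K[X]) : (withTheta L n).Sentence :=
  allV Ω (Fin 1) (eqV Ω (.poly ρ (bvar 0)) .zero)

/-- `Ker(ρ₁[θ]) = Ker(ρ₂[θ])`. -/
def kerEqSentence (ρ₁ ρ₂ : K[X]) : (withTheta L n).Sentence :=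
  allV Ω (Fin 1) ((eqV Ω (.poly ρ₁ (bvar 0)) .zero).iff (eqV Ω (.poly ρ₂ (bvar 0)) .zero))

/-- `Im(ρ₁[θ]) = Im(ρ₂[θ])`. -/
def imEqSentence (ρ₁ ρ₂ : K[X]) : (withTheta L n).Sentence :=
  allV Ω (Fin 1) (Formula.iff
    (exV Ω (Fin 1) (eqV Ω (.poly ρ₁ (bvar 0)) (.var fun c => Sum.inl (Sum.inr (0, c)))))
    (exV Ω (Fin 1) (eqV Ω (.poly ρ₂ (bvar 0)) (.var fun c => Sum.inl (Sum.inr (0, c))))))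

/-- The sentences expressing that `θ` is a `C`-endomorphism. -/
def configSentences (C : KernelConfig K) : (withTheta L n).Theory :=
  {φ | C.deg ≠ ⊤ ∧ φ = kerAllSentence Ω C.miPo} ∪
  {φ | C.deg = ⊤ ∧ ∃ f : IrrPoly K, C.toFun f ≠ ⊤ ∧
    φ = kerEqSentence Ω (f.1 ^ C.exp f) (f.1 ^ (C.exp f + 1))}

/-- The theory `T_θ^C`. -/
def configTheory (T : L.Theory) (C : KernelConfig K) : (withTheta L n).Theory :=
  thetaTheory Ω T ∪ configSentences Ω C

/-- The sentences expressing that `θ` is `C`-image-complete. -/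
def imageCompleteSentences (C : KernelConfig K) : (withTheta L n).Theory :=
  {φ | ∃ f : IrrPoly K, C.toFun f ≠ ⊤ ∧
    φ = imEqSentence Ω (f.1 ^ (C.exp f + 1)) (f.1 ^ C.exp f)}

end Formulas

/-! ### `C`-sequence-systems -/

/-- The data of a `C`-sequence-system
`⋀ k, ξ_k[θ](x_ld,k) = ∑ l, P_{k,l}[θ](x_li,l) + y_ld,k  ∧  ⋀ k, f_k^{q_k}[θ](x_ke,k) = y_ke,k`
apart from the elements `y_ld,k`, `y_ke,k` of `V`, which are variables here. -/
structure SeqSystem {K : Type k} [Field K] (C : KernelConfig K) where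
  numLi : ℕ
  numLd : ℕ
  numKe : ℕ
  ξ : Fin numLd → K[X]
  P : Fin numLd → Fin numLi → K[X]
  f : Fin numKe → IrrPoly K
  q : Fin numKe → ℕ
  alg_li : C.deg ≠ ⊤ → numLi = 0
  alg_ld : C.deg ≠ ⊤ → numLd = 0
  ξ_monic : ∀ i, (ξ i).Monic
  ξ_deg : ∀ i, 0 < (ξ i).natDegree
  ξ_fac : ∀ i (g : IrrPoly K), g.1 ∣ ξ i → C.toFun g = ⊤
  f_pos : ∀ i, 0 < C.toFun (f i)
  f_fin : ∀ i, C.toFun (f i) ≠ ⊤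
  q_pos : ∀ i, 0 < q i
  q_le : ∀ i, q i ≤ C.exp (f i)

namespace SeqSystem

variable {L : FirstOrder.Language.{u, v}} {K : Type k} [Field K] {C : KernelConfig K} {n : ℕ} {γ : Type}

/-- The names of the variables `x_li`, `x_ld`, `x_ke`. -/
inductive Var (S : SeqSystem C) : Type
  | li (i : Fin S.numLi) : Var S
  | ld (i : Fin S.numLd) : Var S
  | ke (i : Fin S.numKe) : Var S

/-- The names of the variables `y_ld`, `y_ke`. -/
inductive Par (S : SeqSystem C) : Type
  | ld (i : Fin S.numLd) : Par S
  | ke (i : Fin S.numKe) : Par S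

instance (S : SeqSystem C) : Finite S.Var :=
  Finite.of_surjective
    (Sum.elim Var.li (Sum.elim Var.ld Var.ke) :
      Fin S.numLi ⊕ Fin S.numLd ⊕ Fin S.numKe → S.Var)
    (by
      rintro (i | i | i)
      exacts [⟨Sum.inl i, rfl⟩, ⟨Sum.inr (Sum.inl i), rfl⟩, ⟨Sum.inr (Sum.inr i), rfl⟩])

instance (S : SeqSystem C) : Finite S.Par :=
  Finite.of_surjective
    (Sum.elim Par.ld Par.ke : Fin S.numLd ⊕ Fin S.numKe → S.Par)
    (by
      rintro (i | i)
      exacts [⟨Sum.inl i, rfl⟩, ⟨Sum.inr i, rfl⟩])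

/-- The formula `S(x; y)`, for given terms (or variables) `x` and `y`. -/
def formula (S : SeqSystem C) (Ω : VecFormulas L K n) (x : S.Var → VTerm K (Fin n → γ))
    (y : S.Par → VTerm K (Fin n → γ)) : (withTheta L n).Formula γ :=
  (Formula.iInf fun i : Fin S.numLd => eqV Ω (.poly (S.ξ i) (x (.ld i)))
    (.add (.sum (List.ofFn fun l => .poly (S.P i l) (x (.li l)))) (y (.ld i)))) ⊓
  (Formula.iInf fun i : Fin S.numKe =>
    eqV Ω (.poly ((S.f i).1 ^ S.q i) (x (.ke i))) (y (.ke i)))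

/-- The formula `δ(y)` expressing that `S(x; y)` is a `C`-sequence-system:
`y_ke,k ∈ Ker(f_k^{C(f_k) - q_k}[θ])` for all `k`. -/
def delta (S : SeqSystem C) (Ω : VecFormulas L K n) (y : S.Par → VTerm K (Fin n → γ)) :
    (withTheta L n).Formula γ :=
  Formula.iInf fun i : Fin S.numKe =>
    eqV Ω (.poly ((S.f i).1 ^ (C.exp (S.f i) - S.q i)) (y (.ke i))) .zero

/-- The placeholder variable `(x, i)`, which stands for `θ^i(x)`, is allowed by `S`. -/
def Allowed (S : SeqSystem C) : S.Var × ℕ → Prop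
  | (.li _, _) => True
  | (.ld k, i) => i < (S.ξ k).natDegree
  | (.ke k, i) => i < ((S.f k).1 ^ S.q k).natDegree

/-- Let `e` list the distinct placeholder variables of a formula `ψ(x; z)`, that is, the `j`-th
`V`-variable of `ψ` is the placeholder for `θ^i(x_k)` with `(x_k, i) = e j`. This is the sentence
`∀ z, ∀ y ∈ V, σ(z) ∧ δ(y) → ∃ x ∈ V, ψ_θ(x; z) ∧ S(x; y)`, where `ψ_θ` is obtained
from `ψ` by replacing every placeholder by the term that it stands for. -/
def companionSentence (S : SeqSystem C) (Ω : VecFormulas L K n) {p q : ℕ}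
    (e : Fin p → S.Var × ℕ) (ψ : L.Formula ((Fin p × Fin n) ⊕ Fin q)) (σ : L.Formula (Fin q)) :
    (withTheta L n).Sentence :=
  Formula.iAlls (Fin q) <| allV Ω S.Par <|
    (((incl L n).onFormula σ).relabel (fun i => Sum.inl (Sum.inr i)) ⊓ S.delta Ω bvar).imp <|
      exV Ω S.Var <|
        BoundedFormula.subst ((incl L n).onFormula ψ)
            (Sum.elim (fun j => thetaIter (fun c => Sum.inr ((e j.1).1, c)) (e j.1).2 j.2)
              (fun i => Term.var (Sum.inl (Sum.inl (Sum.inr i))))) ⊓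
          S.formula Ω bvar (fun i => .var fun c => Sum.inl (Sum.inr (i, c)))

end SeqSystem

/-- The axioms of the model companion: `T_θ^C`, "`θ` is `C`-image-complete", and the sentences
`∀ z, ∀ y ∈ V, σ_ψ(z) ∧ δ_{ψ,S}(y) → ∃ x ∈ V, ψ_θ(x; z) ∧ S(x; y)` for all `L`-formulas `ψ` and
all `C`-sequence-systems `S` that bound `ψ`. (If `S` does not bound `ψ`, then `δ_{ψ,S}` is false
and the sentence is vacuous.) -/
def companionTheory {L : FirstOrder.Language.{u, v}} {K : Type k} [Field K] {n : ℕ}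
    (Ω : VecFormulas L K n) (T : L.Theory) (C : KernelConfig K)
    (σ : ∀ {p q : ℕ}, L.Formula ((Fin p × Fin n) ⊕ Fin q) → L.Formula (Fin q)) :
    (withTheta L n).Theory :=
  configTheory Ω T C ∪ imageCompleteSentences Ω C ∪
    {φ | ∃ (p q : ℕ) (ψ : L.Formula ((Fin p × Fin n) ⊕ Fin q)) (S : SeqSystem C)
      (e : Fin p → S.Var × ℕ), Function.Injective e ∧ (∀ j, S.Allowed (e j)) ∧
      φ = S.companionSentence Ω e ψ (σ ψ)}

end VecEndo

end

open VecEndo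

universe u v k w

/-! A model of `T_θ` is a model `M` of `T` together with a `K[X]`-module structure on `V(M)`, where
`X` acts as `θ`; the axioms for `C` become the module condition `IsC`. By compactness, `M` is
existentially closed exactly when every extension to a model embeds over `M` into an elementary
extension of `M` (`isExistentiallyClosedModel_iff`). The core is that the proposed axioms single out
precisely these models. The rest is formal: `T_θ^C` is preserved under unions of chains because `T`
is model complete, so existentially closed models are cofinal, and Robinson's test gives model
completeness of the axioms.

Both directions rest on the module `SeqSystem.Generic`, generated over `V(M)` by a generic solution
of a sequence system `S`. Division with remainder shows that the monomials `X ^ i • x` allowed by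
`S` form a `K`-basis of it modulo `V(M)`, and admissibility of the parameters makes it satisfy `IsC`
(`SeqSystem.isC_generic`).

Existentially closed models satisfy the axioms: `σ_ψ` provides an elementary extension `N` of the
`L`-reduct and a tuple that realizes `ψ` and is independent over `V(M)`. This tuple is identified
with the allowed monomials of the generic module; independence on both sides makes the
identification consistent. In a sufficiently large elementary extension of `N` the whole generic
module fits into `V` with infinite codimension, and a complement is filled with copies of a cyclic
`C`-module (`exists_extension_of_module`). The result is a model of `T_θ^C` over `M` containing the
desired solution, which existential closedness brings down to `M`. Image-completeness is obtained in
the same way from `exists_image_extension`.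

Conversely, let `M` satisfy the axioms and let `N` be a model of `T_θ^C` over it. The structure
theorem, applied to a finitely generated submodule of `V(N)/V(M)`, presents any finite part of
`V(N)` by a solution of a sequence system with independent allowed monomials (`exists_seqSystem`).
Image-completeness is what permits correcting torsion generators by elements of `V(M)` so that they
solve kernel equations. The axioms then realize in `M` any finite fragment of the `L`-type of these
monomials together with the system. Compactness yields an elementary extension of `M` into which `N`
maps compatibly with `θ`, first on finite parts and then on all of `V(N)`
(`embedsOverElementary_of_isGeneric`). -/

noncomputable section

namespace VecEndo

/-! ### Compactness, existential closedness and Robinson's test. -/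

section

section ModelTheory

open Filter

variable {L : FirstOrder.Language.{u, v}}

/-- Compactness relative to a theory, for sets of formulas in arbitrarily many variables. -/
theorem exists_realize_of_finset (T : L.Theory) {α : Type (max u v w)} (Γ : Set (L.Formula α))
    (h : ∀ Δ : Finset (L.Formula α), (∀ φ ∈ Δ, φ ∈ Γ) →
      ∃ (N : Type (max u v w)) (_ : L.Structure N) (_ : Nonempty N) (s : α → N),
        N ⊨ T ∧ ∀ φ ∈ Δ, φ.Realize s) :
    ∃ (N : Type (max u v w)) (_ : L.Structure N) (_ : Nonempty N) (s : α → N),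
      N ⊨ T ∧ ∀ φ ∈ Γ, φ.Realize s := by
  classical
  have h' := fun Δ : Finset (L.Formula α) => h (Δ.filter (· ∈ Γ)) (by simp)
  choose N str ne s hT hs using h'
  -- For each `φ`, the set of all `Δ` containing `φ` belongs to this ultrafilter, so by Łoś's
  -- theorem the ultraproduct realizes every member of `Γ`.
  let U : Ultrafilter (Finset (L.Formula α)) := Ultrafilter.of atTop
  have hU : (U : Filter (Finset (L.Formula α))) ≤ atTop := Ultrafilter.of_le _
  refine ⟨(U : Filter (Finset (L.Formula α))).Product N, inferInstance, inferInstance,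
    fun a => ((fun Δ => s Δ a : ∀ Δ, N Δ) : (U : Filter _).Product N), ?_, fun φ hφ => ?_⟩
  · rw [Theory.model_iff]
    intro φ hφ
    rw [Ultraproduct.sentence_realize]
    exact Eventually.of_forall fun Δ => (Theory.model_iff T).1 (hT Δ) φ hφ
  · refine (Ultraproduct.realize_formula_cast φ fun a Δ => s Δ a).2
      (hU ((eventually_ge_atTop {φ}).mono fun Δ hΔ => ?_))
    exact hs Δ φ (Finset.mem_filter.2 ⟨hΔ (Finset.mem_singleton_self φ), hφ⟩)

/-- A set of formulas with parameters in `M` is realized in an elementary extension of `M` if all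
of its finite subsets are. -/
theorem exists_elementary_realize_of_finset {M : Type (max u v w)} [L.Structure M] [Nonempty M]
    {α : Type (max u v w)} (Γ : Set (L.Formula (M ⊕ α)))
    (h : ∀ Δ : Finset (L.Formula (M ⊕ α)), (∀ φ ∈ Δ, φ ∈ Γ) →
      ∃ (N : Type (max u v w)) (_ : L.Structure N) (g : M ↪ₑ[L] N) (s : α → N),
        ∀ φ ∈ Δ, φ.Realize (Sum.elim g s)) :
    ∃ (N : Type (max u v w)) (_ : L.Structure N) (g : M ↪ₑ[L] N) (s : α → N),
      ∀ φ ∈ Γ, φ.Realize (Sum.elim g s) := by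
  classical
  -- The elementary diagram of `M`. Being closed under negation, its realization is automatically an
  -- elementary embedding.
  let D : Set (L.Formula (M ⊕ α)) :=
    {χ | ∃ φ : L.Formula M, φ.Realize id ∧ χ = φ.relabel Sum.inl}
  obtain ⟨N, _, _, s, -, hs⟩ := exists_realize_of_finset.{u, v, w} (∅ : L.Theory) (Γ ∪ D) (by
    intro Δ hΔ
    obtain ⟨N, _, g, s, hs⟩ := h (Δ.filter (· ∈ Γ)) (by simp)
    refine ⟨N, inferInstance, Nonempty.map g inferInstance, Sum.elim g s, ?_, fun φ hφ => ?_⟩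
    · exact (Theory.model_iff _).2 fun φ hφ => hφ.elim
    · rcases hΔ φ hφ with h1 | ⟨χ, h1, rfl⟩
      · exact hs φ (Finset.mem_filter.2 ⟨hφ, h1⟩)
      · rw [Formula.realize_relabel, Sum.elim_comp_inl]
        exact (g.map_formula χ id).2 h1)
  have key : ∀ φ : L.Formula M, φ.Realize id → φ.Realize (s ∘ Sum.inl) := fun φ hφ => by
    have := hs (φ.relabel Sum.inl) (Or.inr ⟨φ, hφ, rfl⟩)
    rwa [Formula.realize_relabel] at this
  let g : M ↪ₑ[L] N := ⟨s ∘ Sum.inl, fun n φ x => by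
    refine ⟨fun h1 => ?_, fun h1 => ?_⟩
    · by_contra h2
      have := key (φ.relabel x).not (by
        rw [Formula.realize_not, Formula.realize_relabel]; exact h2)
      rw [Formula.realize_not, Formula.realize_relabel] at this
      exact this h1
    · have := key (φ.relabel x) (by rw [Formula.realize_relabel]; exact h1)
      rwa [Formula.realize_relabel] at this⟩
  refine ⟨N, inferInstance, g, s ∘ Sum.inr, fun φ hφ => ?_⟩
  have : Sum.elim g (s ∘ Sum.inr) = s := by
    ext (x | x) <;> rfl
  rw [this]
  exact hs φ (Or.inl hφ)

/-- A map that preserves quantifier-free formulas is an embedding. -/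
def embeddingOfQF {M N : Type*} [L.Structure M] [L.Structure N] (s : M → N)
    (h : ∀ φ : L.Formula M, BoundedFormula.IsQF φ → φ.Realize id → φ.Realize s) : M ↪[L] N where
  toFun := s
  inj' x y hxy := by
    by_contra hne
    have := h (Term.equal (Term.var x) (Term.var y)).not
      (BoundedFormula.IsQF.not (BoundedFormula.IsAtomic.equal _ _).isQF)
      (by simpa [Formula.realize_not] using hne)
    simp only [Formula.realize_not, Formula.realize_equal, Term.realize_var] at this
    exact this hxy
  map_fun' {k} f x := by
    have := h (Term.equal (Term.var (Structure.funMap f x)) (Term.func f fun i => Term.var (x i)))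
      (BoundedFormula.IsAtomic.equal _ _).isQF (by simp [Formula.realize_equal])
    simp only [Formula.realize_equal, Term.realize_var, Term.realize_func] at this
    exact this
  map_rel' {k} R x := by
    constructor
    · intro h1
      by_contra h2
      have := h (R.formula fun i => Term.var (x i)).not
        (BoundedFormula.IsQF.not (BoundedFormula.IsAtomic.rel _ _).isQF)
        (by simpa [Formula.realize_not, Formula.realize_rel] using h2)
      simp only [Formula.realize_not, Formula.realize_rel, Term.realize_var] at this
      exact this h1
    · intro h1
      have := h (R.formula fun i => Term.var (x i)) (BoundedFormula.IsAtomic.rel _ _).isQF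
        (by simpa [Formula.realize_rel] using h1)
      simp only [Formula.realize_rel, Term.realize_var] at this
      exact this

/-- The codomain of `f : M ↪[L] N` embeds over `M` into an elementary extension of `M`. -/
def EmbedsOverElementary {M N : Type w} [L.Structure M] [L.Structure N] (f : M ↪[L] N) : Prop :=
  ∃ (M' : Type w) (_ : L.Structure M') (g : M ↪ₑ[L] M') (h : N ↪[L] M'), ∀ x, h (f x) = g x

/-- Existential formulas go up along the embedding of `N` into `M'`, and elementarity of `M` in `M'`
brings them back. -/
theorem EmbedsOverElementary.realize {M N : Type w} [L.Structure M] [L.Structure N]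
    {f : M ↪[L] N} (hf : EmbedsOverElementary f) {α : Type*} {φ : L.Formula α}
    (hφ : BoundedFormula.IsExistential φ) (a : α → M) (h : φ.Realize (f ∘ a)) : φ.Realize a := by
  obtain ⟨M', _, g, j, hj⟩ := hf
  have h1 : φ.Realize (j ∘ f ∘ a) := by
    have := hφ.realize_embedding j h
    rw [Formula.Realize]
    convert this
  rw [← g.map_formula φ a]
  convert h1 using 2
  ext x
  exact (hj (a x)).symm

theorem BoundedFormula.IsExistential.exs {α : Type*} {n : ℕ} {φ : L.BoundedFormula α n}
    (h : φ.IsExistential) : BoundedFormula.IsExistential φ.exs := by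
  induction n with
  | zero => exact h
  | succ n ih => exact ih (h.ex)

theorem realize_congr_freeVar {α : Type*} [DecidableEq α] {N : Type*} [L.Structure N]
    (φ : L.Formula α) {s t : α → N} (h : ∀ a ∈ φ.freeVarFinset, s a = t a) :
    φ.Realize s ↔ φ.Realize t := by
  rw [Formula.Realize, Formula.Realize,
    ← BoundedFormula.realize_restrictFreeVar (f := id) (v := fun a => s a) s (fun _ => rfl),
    ← BoundedFormula.realize_restrictFreeVar (f := id) (v := fun a => t a) t (fun _ => rfl)]
  have : (fun a : φ.freeVarFinset => s a) = fun a : φ.freeVarFinset => t a := by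
    ext a; exact h a a.2
  rw [this]

theorem Formula.realize_boundedRelabel {α β M : Type*} [L.Structure M] {n : ℕ} (φ : L.Formula α)
    (g : α → β ⊕ Fin n) (v : β → M) (xs : Fin n → M) :
    BoundedFormula.Realize (BoundedFormula.relabel g φ : L.BoundedFormula β n) v xs ↔
      φ.Realize (Sum.elim v xs ∘ g) := by
  rw [Formula.Realize]
  refine BoundedFormula.realize_relabel.trans ?_
  exact Iff.of_eq (congrArg (BoundedFormula.Realize φ _) (Subsingleton.elim _ _))

/-- Existential formulas descend from `N` to `M` along `f`. -/
theorem embedsOverElementary_of_existential {M N : Type (max u v w)} [L.Structure M]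
    [L.Structure N] [Nonempty M] (f : M ↪[L] N)
    (hf : ∀ (r : ℕ) (φ : L.Formula (Fin r)), BoundedFormula.IsExistential φ →
      ∀ a : Fin r → M, φ.Realize (f ∘ a) → φ.Realize a) : EmbedsOverElementary f := by
  classical
  -- The quantifier-free diagram of `N`, with the constants for `f m` identified with those for `m`.
  -- A realization over an elementary extension of `M` is the embedding sought.
  let Γ : Set (L.Formula (M ⊕ N)) :=
    {χ | (∃ m : M, χ = Term.equal (Term.var (Sum.inl m)) (Term.var (Sum.inr (f m)))) ∨
      ∃ φ : L.Formula N, BoundedFormula.IsQF φ ∧ φ.Realize id ∧ χ = φ.relabel Sum.inr}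
  have hqf : ∀ χ ∈ Γ, BoundedFormula.IsQF χ := by
    rintro χ (⟨m, rfl⟩ | ⟨φ, hφ, -, rfl⟩)
    · exact (BoundedFormula.IsAtomic.equal _ _).isQF
    · exact hφ.relabel _
  have hreal : ∀ χ ∈ Γ, χ.Realize (Sum.elim f id) := by
    rintro χ (⟨m, rfl⟩ | ⟨φ, hφ, h1, rfl⟩)
    · simp [Formula.realize_equal]
    · rw [Formula.realize_relabel, Sum.elim_comp_inr]; exact h1
  obtain ⟨M', _, g, s, hs⟩ := exists_elementary_realize_of_finset.{u, v, w} (M := M) Γ (by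
    intro Δ hΔ
    refine ⟨M, inferInstance, ElementaryEmbedding.refl L M, ?_⟩
    let m0 : M := Classical.arbitrary M
    let F : Finset (M ⊕ N) := Δ.biUnion fun φ => φ.freeVarFinset
    let A : Finset M := insert m0 (F.biUnion fun x => Sum.elim (fun m => {m}) (fun _ => ∅) x)
    let B : Finset N := F.biUnion fun x => Sum.elim (fun _ => ∅) (fun b => {b}) x
    let a : Fin A.card → M := fun i => (A.equivFin.symm i : M)
    let b : Fin B.card → N := fun i => (B.equivFin.symm i : N)
    let i0 : Fin A.card := A.equivFin ⟨m0, Finset.mem_insert_self _ _⟩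
    -- Constants from `M` become free variables, those from `N` become variables to be quantified.
    -- Constants that do not occur in `Δ` are sent to the dummy index `i0`, which exists because
    -- `m0` was put into `A`.
    let gl : M ⊕ N → Fin A.card ⊕ Fin B.card := Sum.elim
      (fun m => if hm : m ∈ A then Sum.inl (A.equivFin ⟨m, hm⟩) else Sum.inl i0)
      (fun c => if hc : c ∈ B then Sum.inr (B.equivFin ⟨c, hc⟩) else Sum.inl i0)
    have hgl : ∀ (P : Type (max u v w)) (k : M → P) (s : N → P), ∀ x ∈ F,
        Sum.elim (k ∘ a) (s ∘ b) (gl x) = Sum.elim k s x := by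
      rintro P k s (x | x) hx
      · have : x ∈ A := Finset.mem_insert_of_mem (Finset.mem_biUnion.2 ⟨_, hx, by simp⟩)
        simp [gl, this, a]
      · have : x ∈ B := Finset.mem_biUnion.2 ⟨_, hx, by simp⟩
        simp [gl, this, b]
    let ψ : L.BoundedFormula (Fin A.card) B.card :=
      BoundedFormula.iInf fun φ : Δ =>
        (BoundedFormula.relabel gl φ.1 : L.BoundedFormula (Fin A.card) B.card)
    have hiInf : ∀ (l : List (L.BoundedFormula (Fin A.card) B.card)),
        (∀ χ ∈ l, χ.IsQF) → (l.foldr (· ⊓ ·) ⊤ : L.BoundedFormula _ _).IsQF := by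
      intro l
      induction l with
      | nil => intro _; exact BoundedFormula.IsQF.top
      | cons x l ih =>
        intro h1
        exact (h1 x (by simp)).inf (ih fun χ hχ => h1 χ (by simp [hχ]))
    have hψ : ψ.IsQF := by
      refine hiInf _ ?_
      intro χ hχ
      simp only [List.mem_map, Finset.mem_toList, Finset.mem_univ, true_and] at hχ
      obtain ⟨φ, rfl⟩ := hχ
      exact (hqf φ.1 (hΔ _ φ.2)).relabel gl
    have h1 : ψ.exs.Realize (f ∘ a) := by
      rw [BoundedFormula.realize_exs]
      refine ⟨b, ?_⟩
      rw [BoundedFormula.realize_iInf]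
      intro φ
      rw [Formula.realize_boundedRelabel]
      refine (realize_congr_freeVar φ.1 (t := Sum.elim f id) ?_).2 (hreal φ.1 (hΔ _ φ.2))
      intro x hx
      exact hgl N f id x (Finset.mem_biUnion.2 ⟨φ.1, φ.2, hx⟩)
    -- The existential closure holds in `N`, so it descends; its witnesses in `M` show that `M`
    -- itself realizes `Δ`, with the identity as elementary embedding.
    have h2 := hf _ ψ.exs (BoundedFormula.IsExistential.exs hψ.isExistential) a h1
    obtain ⟨c, hc⟩ := (BoundedFormula.realize_exs).1 h2
    rw [BoundedFormula.realize_iInf] at hc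
    let s : N → M := fun y => if hy : y ∈ B then c (B.equivFin ⟨y, hy⟩) else m0
    have hsb : s ∘ b = c := by
      ext i
      simp [s, b]
    refine ⟨s, fun φ hφ => ?_⟩
    have h3 := hc ⟨φ, hφ⟩
    rw [Formula.realize_boundedRelabel] at h3
    refine (realize_congr_freeVar φ (t := Sum.elim a c ∘ gl) ?_).2 h3
    intro x hx
    have := hgl M id s x (Finset.mem_biUnion.2 ⟨φ, hφ, hx⟩)
    rw [hsb] at this
    exact this.symm)
  refine ⟨M', inferInstance, g, embeddingOfQF s fun φ hφ h1 => ?_, fun x => ?_⟩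
  · have := hs (φ.relabel Sum.inr) (Or.inr ⟨φ, hφ, h1, rfl⟩)
    rwa [Formula.realize_relabel, Sum.elim_comp_inr] at this
  · have := hs _ (Or.inl ⟨x, rfl⟩)
    simp only [Formula.realize_equal, Term.realize_var, Sum.elim_inl, Sum.elim_inr] at this
    exact this.symm

/-- A model is existentially closed if and only if each of its extensions to a model embeds over it
into an elementary extension. -/
theorem isExistentiallyClosedModel_iff (T : L.Theory) (M : Type (max u v w)) [L.Structure M]
    [Nonempty M] : IsExistentiallyClosedModel.{u, v, max u v w} T M ↔
      M ⊨ T ∧ ∀ (N : Type (max u v w)) [L.Structure N] [Nonempty N], N ⊨ T →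
        ∀ f : M ↪[L] N, EmbedsOverElementary f := by
  refine and_congr_right fun _ => ⟨fun h N _ _ hN f => ?_, fun h N _ _ hN f r φ hφ a => ?_⟩
  · exact embedsOverElementary_of_existential.{u, v, w} f (h N hN f)
  · exact (h N hN f).realize hφ a

/-- Robinson's test for model completeness. -/
theorem isModelComplete_of_embedsOverElementary (T : L.Theory)
    (h : ∀ (M N : Type w) [L.Structure M] [L.Structure N] [Nonempty M] [Nonempty N],
      M ⊨ T → N ⊨ T → ∀ f : M ↪[L] N, EmbedsOverElementary f) :
    IsModelComplete.{u, v, w} T := by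
  have key : ∀ {n : ℕ} (φ : L.BoundedFormula Empty n) (M N : Type w) [L.Structure M]
      [L.Structure N] [Nonempty M] [Nonempty N], M ⊨ T → N ⊨ T → ∀ (f : M ↪[L] N) (a : Fin n → M),
      φ.Realize default (f ∘ a) ↔ φ.Realize default a := by
    intro n φ
    induction φ with
    | falsum => intros; rfl
    | equal s t =>
      intro M N _ _ _ _ _ _ f a
      have := (BoundedFormula.IsAtomic.equal s t).isQF.realize_embedding f (v := default) (xs := a)
      rwa [Subsingleton.elim (f ∘ default) default] at this
    | rel R ts =>
      intro M N _ _ _ _ _ _ f a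
      have := (BoundedFormula.IsAtomic.rel R ts).isQF.realize_embedding f (v := default) (xs := a)
      rwa [Subsingleton.elim (f ∘ default) default] at this
    | imp φ ψ h1 h2 =>
      intro M N _ _ _ _ hM hN f a
      rw [BoundedFormula.realize_imp, BoundedFormula.realize_imp, h1 M N hM hN f a,
        h2 M N hM hN f a]
    | all φ ih =>
      intro M N _ _ _ _ hM hN f a
      rw [BoundedFormula.realize_all, BoundedFormula.realize_all]
      constructor
      · intro h1 x
        rw [← ih M N hM hN f, Fin.comp_snoc]
        exact h1 (f x)
      · intro h1 y
        -- The element `y` of `N` is moved to `M'`, where the universal statement holds because `M'`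
        -- is elementary over `M`. The induction hypothesis is applied to `j : N → M'`, which is why
        -- it must quantify over all pairs of models.
        obtain ⟨M', _, g, j, hj⟩ := h M N hM hN f
        have hM' : M' ⊨ T := (g.theory_model_iff T).1 hM
        have : Nonempty M' := Nonempty.map g inferInstance
        rw [← ih N M' hN hM' j, Fin.comp_snoc]
        have h2 := g.map_boundedFormula φ.all default a
        rw [BoundedFormula.realize_all, BoundedFormula.realize_all,
          Subsingleton.elim (g ∘ default) default] at h2
        have h3 : j ∘ f ∘ a = g ∘ a := by ext i; exact hj (a i)
        rw [h3]
        exact h2.2 h1 (j y)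
  intro M N _ _ _ _ hM hN f
  refine ⟨⟨f, fun n φ x => ?_⟩, fun _ => rfl⟩
  have := key (BoundedFormula.relabel (Sum.inr : Fin n → Empty ⊕ Fin n) φ) M N hM hN f x
  rw [BoundedFormula.realize_relabel, BoundedFormula.realize_relabel] at this
  convert this using 1
  · rw [Formula.Realize]
    congr!
  · rw [Formula.Realize]
    congr!

end ModelTheory

end

/-! ### Unions of chains and the existence of existentially closed models. -/

section

section Chains

open Filter

variable {L : FirstOrder.Language.{u, v}}

/-- `N` is the union of the chain of structures `G` with inclusions `f`. -/
structure IsChainUnion (L : FirstOrder.Language.{u, v}) {G : ℕ → Type w} [∀ i, L.Structure (G i)]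
    (f : ∀ i, G i ↪[L] G (i + 1)) {N : Type w} [L.Structure N] (h : ∀ i, G i ↪[L] N) : Prop where
  compat : ∀ i x, h (i + 1) (f i x) = h i x
  surj : ∀ y, ∃ i x, h i x = y

namespace IsChainUnion

variable {G : ℕ → Type w} [∀ i, L.Structure (G i)] {f : ∀ i, G i ↪[L] G (i + 1)} {N : Type w}
  [L.Structure N] {h : ∀ i, G i ↪[L] N}

theorem exists_embedding (H : IsChainUnion L f h) {i j : ℕ} (hij : i ≤ j) :
    ∃ g : G i ↪[L] G j, ∀ x, h j (g x) = h i x := by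
  induction j, hij using Nat.le_induction with
  | base => exact ⟨Embedding.refl L _, fun _ => rfl⟩
  | succ j _ ih =>
    obtain ⟨g, hg⟩ := ih
    exact ⟨(f j).comp g, fun x => by rw [Embedding.comp_apply, H.compat, hg]⟩

theorem exists_lift (H : IsChainUnion L f h) {ι : Type*} [Finite ι] (a : ι → N) (k : ℕ) :
    ∃ i, k ≤ i ∧ ∃ a' : ι → G i, ∀ j, h i (a' j) = a j := by
  choose i x hx using fun j => H.surj (a j)
  obtain ⟨b, hb⟩ := (Set.finite_range i).bddAbove
  refine ⟨max b k, le_max_right _ _, ?_⟩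
  choose g hg using fun j =>
    H.exists_embedding ((hb (Set.mem_range_self j)).trans (le_max_left b k))
  exact ⟨fun j => g j (x j), fun j => by rw [hg, hx]⟩

/-- A chain of models of a model complete theory is elementary in its union. -/
theorem elementary [∀ i, Nonempty (G i)] (H : IsChainUnion L f h) {T : L.Theory}
    (hT : IsModelComplete.{u, v, w} T) (hG : ∀ i, G i ⊨ T) (i : ℕ) :
    ∃ g : G i ↪ₑ[L] N, ∀ x, g x = h i x := by
  have key : ∀ {n : ℕ} (φ : L.BoundedFormula Empty n) (i : ℕ) (a : Fin n → G i),
      φ.Realize default (h i ∘ a) ↔ φ.Realize default a := by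
    intro n φ
    induction φ with
    | falsum => intros; rfl
    | equal s t =>
      intro i a
      have := (BoundedFormula.IsAtomic.equal s t).isQF.realize_embedding (h i) (v := default)
        (xs := a)
      rwa [Subsingleton.elim (h i ∘ default) default] at this
    | rel R ts =>
      intro i a
      have := (BoundedFormula.IsAtomic.rel R ts).isQF.realize_embedding (h i) (v := default)
        (xs := a)
      rwa [Subsingleton.elim (h i ∘ default) default] at this
    | imp φ ψ h1 h2 =>
      intro i a
      rw [BoundedFormula.realize_imp, BoundedFormula.realize_imp, h1, h2]
    | all φ ih =>
      intro i a
      rw [BoundedFormula.realize_all, BoundedFormula.realize_all]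
      constructor
      · intro h1 x
        rw [← ih, Fin.comp_snoc]
        exact h1 (h i x)
      · intro h1 y
        -- A possible counterexample already lies in a later member of the chain, and the inclusion
        -- into that member is elementary by model completeness.
        obtain ⟨j, hij, y', hy'⟩ := H.exists_lift (fun _ : Unit => y) i
        obtain ⟨g, hg⟩ := H.exists_embedding hij
        obtain ⟨g', hg'⟩ := hT _ _ (hG i) (hG j) g
        have h2 := g'.map_boundedFormula φ.all default a
        rw [BoundedFormula.realize_all, BoundedFormula.realize_all,
          Subsingleton.elim (g' ∘ default) default] at h2
        have h3 := (ih j _).2 (h2.2 h1 (y' ()))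
        rw [Fin.comp_snoc, hy'] at h3
        convert h3 using 2
        ext k
        simp [hg', hg]
  refine ⟨⟨h i, fun n φ x => ?_⟩, fun _ => rfl⟩
  have := key (BoundedFormula.relabel (Sum.inr : Fin n → Empty ⊕ Fin n) φ) i x
  rw [Formula.realize_boundedRelabel, Formula.realize_boundedRelabel] at this
  simpa only [Sum.elim_comp_inr] using this

end IsChainUnion

theorem exists_isChainUnion {G : ℕ → Type w} [∀ i, L.Structure (G i)]
    (f : ∀ i, G i ↪[L] G (i + 1)) :
    ∃ (N : Type w) (_ : L.Structure N) (h : ∀ i, G i ↪[L] N), IsChainUnion L f h := by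
  refine ⟨Language.DirectLimit G fun i j h => DirectedSystem.natLERec f i j h, inferInstance,
    fun i => Language.DirectLimit.of L ℕ G _ i, ?_, ?_⟩
  · intro i x
    have : f i x = DirectedSystem.natLERec f i (i + 1) i.le_succ x := by
      simp only [DirectedSystem.coe_natLERec]
      exact (Nat.leRecOn_succ' (C := G) (next := fun {k} => f k) x).symm
    rw [this, Language.DirectLimit.of_f]
  · exact fun y => Language.DirectLimit.exists_of y

theorem Formula.realize_of_isExistential {M N : Type*} [L.Structure M] [L.Structure N] {α : Type*}
    {φ : L.Formula α} (hφ : BoundedFormula.IsExistential φ) (f : M ↪[L] N) (a : α → M)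
    (h : φ.Realize a) : φ.Realize (f ∘ a) :=
  (Iff.of_eq (congrArg (BoundedFormula.Realize φ _) (Subsingleton.elim _ _))).1
    (hφ.realize_embedding f h)

/-- A model can be extended so that all existential formulas with parameters in the model that
hold in some further extension hold already. -/
theorem exists_extension_step (T : L.Theory) (M : Type (max u v w)) [L.Structure M] [Nonempty M]
    (hM : M ⊨ T) :
    ∃ (N : Type (max u v w)) (_ : L.Structure N) (_ : Nonempty N) (_ : N ⊨ T) (f : M ↪[L] N),
      ∀ (P : Type (max u v w)) [L.Structure P] [Nonempty P], P ⊨ T → ∀ (g : N ↪[L] P) (r : ℕ)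
        (φ : L.Formula (Fin r)), BoundedFormula.IsExistential φ → ∀ a : Fin r → M,
          φ.Realize (g ∘ f ∘ a) → φ.Realize (f ∘ a) := by
  classical
  -- Instead of a transfinite construction, Zorn's lemma is applied to sets of existential formulas
  -- with parameters in `M` that hold simultaneously in one extension.
  let E := Σ r : ℕ, L.Formula (Fin r) × (Fin r → M)
  let Good : Set E → Prop := fun S =>
    ∃ (N : Type (max u v w)) (_ : L.Structure N) (_ : Nonempty N) (_ : N ⊨ T) (f : M ↪[L] N),
      ∀ x ∈ S, BoundedFormula.IsExistential x.2.1 ∧ x.2.1.Realize (f ∘ x.2.2)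
  have hch : ∀ c ⊆ {S | Good S}, IsChain (· ⊆ ·) c → c.Nonempty → Good (⋃₀ c) := by
    intro c hc hchain hne
    let Γ : Set (L.Formula M) :=
      {χ | (BoundedFormula.IsQF χ ∧ χ.Realize id) ∨ ∃ x ∈ ⋃₀ c, χ = x.2.1.relabel x.2.2}
    obtain ⟨N, _, _, s, hN, hs⟩ := exists_realize_of_finset.{u, v, w} T Γ (by
      intro Δ hΔ
      -- Only finitely many formulas are involved, so a single member of the chain of good sets
      -- accounts for all of them.
      have : ∃ S ∈ c, ∀ χ ∈ Δ, (BoundedFormula.IsQF χ ∧ χ.Realize id) ∨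
          ∃ x ∈ S, χ = x.2.1.relabel x.2.2 := by
        induction Δ using Finset.induction_on with
        | empty =>
          obtain ⟨S, hS⟩ := hne
          exact ⟨S, hS, by simp⟩
        | insert χ Δ _ ih =>
          obtain ⟨S, hS, h1⟩ := ih fun φ hφ => hΔ φ (Finset.mem_insert_of_mem hφ)
          have h2 : ∃ S' ∈ c, (BoundedFormula.IsQF χ ∧ χ.Realize id) ∨
              ∃ x ∈ S', χ = x.2.1.relabel x.2.2 := by
            rcases hΔ χ (Finset.mem_insert_self _ _) with h2 | ⟨x, ⟨S', hS', hx⟩, rfl⟩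
            · exact ⟨S, hS, Or.inl h2⟩
            · exact ⟨S', hS', Or.inr ⟨x, hx, rfl⟩⟩
          obtain ⟨S', hS', h2⟩ := h2
          obtain ⟨S'', hS'', h3, h4⟩ : ∃ S'' ∈ c, S ⊆ S'' ∧ S' ⊆ S'' := by
            rcases hchain.total hS hS' with h | h
            · exact ⟨S', hS', h, subset_rfl⟩
            · exact ⟨S, hS, subset_rfl, h⟩
          refine ⟨S'', hS'', fun φ hφ => ?_⟩
          rcases Finset.mem_insert.1 hφ with rfl | hφ
          · exact h2.imp_right fun ⟨x, hx, h⟩ => ⟨x, h4 hx, h⟩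
          · exact (h1 φ hφ).imp_right fun ⟨x, hx, h⟩ => ⟨x, h3 hx, h⟩
      obtain ⟨S, hS, h1⟩ := this
      obtain ⟨N, _, _, hN, f, hf⟩ := hc hS
      refine ⟨N, inferInstance, inferInstance, f, hN, fun φ hφ => ?_⟩
      rcases h1 φ hφ with ⟨h2, h3⟩ | ⟨x, hx, rfl⟩
      · exact Formula.realize_of_isExistential h2.isExistential f id h3
      · rw [Formula.realize_relabel]
        exact (hf x hx).2)
    refine ⟨N, inferInstance, inferInstance, hN,
      embeddingOfQF s fun φ hφ h => hs φ (Or.inl ⟨hφ, h⟩), fun x hx => ⟨?_, ?_⟩⟩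
    · obtain ⟨S, hS, hx⟩ := hx
      obtain ⟨_, _, _, _, _, hf⟩ := hc hS
      exact (hf x hx).1
    · have := hs _ (Or.inr ⟨x, hx, rfl⟩)
      rwa [Formula.realize_relabel] at this
  obtain ⟨S, -, hS⟩ := zorn_subset_nonempty {S | Good S}
    (fun c hc hchain hne => ⟨⋃₀ c, hch c hc hchain hne, fun s hs => Set.subset_sUnion_of_mem hs⟩)
    ∅ ⟨M, inferInstance, inferInstance, hM, Embedding.refl L M, by simp⟩
  obtain ⟨N, _, _, hN, f, hf⟩ := hS.prop
  refine ⟨N, inferInstance, inferInstance, hN, f, fun P _ _ hP g r φ hφ a h1 => ?_⟩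
  -- Everything in `S` persists in `P`, so `P` witnesses that the enlarged set is still good; by
  -- maximality the new formula was in `S` and holds in `N`.
  have h2 : Good (insert ⟨r, φ, a⟩ S) := by
    refine ⟨P, inferInstance, inferInstance, hP, g.comp f, fun x hx => ?_⟩
    rcases hx with rfl | hx
    · exact ⟨hφ, h1⟩
    · refine ⟨(hf x hx).1, ?_⟩
      exact Formula.realize_of_isExistential (hf x hx).1 g _ (hf x hx).2
  have h3 := hS.le_of_ge h2 (Set.subset_insert _ _) (Set.mem_insert _ _)
  exact (hf _ h3).2

/-- Every model of an inductive theory extends to an existentially closed one. -/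
theorem exists_isExistentiallyClosedModel (T : L.Theory)
    (hT : ∀ (G : ℕ → Type (max u v w)) [∀ i, L.Structure (G i)] [∀ i, Nonempty (G i)]
      (f : ∀ i, G i ↪[L] G (i + 1)) (N : Type (max u v w)) [L.Structure N] [Nonempty N]
      (h : ∀ i, G i ↪[L] N), IsChainUnion L f h → (∀ i, G i ⊨ T) → N ⊨ T)
    (M : Type (max u v w)) [L.Structure M] [Nonempty M] (hM : M ⊨ T) :
    ∃ (N : Type (max u v w)) (_ : L.Structure N) (_ : Nonempty N),
      IsExistentiallyClosedModel.{u, v, max u v w} T N ∧ Nonempty (M ↪[L] N) := by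
  have step (X : Theory.ModelType.{u, v, max u v w} T) :
      ∃ (Y : Theory.ModelType.{u, v, max u v w} T) (f : X ↪[L] Y),
      ∀ (P : Type (max u v w)) [L.Structure P] [Nonempty P], P ⊨ T → ∀ (g : Y ↪[L] P) (r : ℕ)
        (φ : L.Formula (Fin r)), BoundedFormula.IsExistential φ → ∀ a : Fin r → X,
          φ.Realize (g ∘ f ∘ a) → φ.Realize (f ∘ a) := by
    obtain ⟨N, _, _, hN, f, hf⟩ := exists_extension_step.{u, v, w} T X X.is_model
    exact ⟨Theory.ModelType.of T N, f, hf⟩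
  choose next F hF using step
  obtain ⟨seq, h0, hs⟩ : ∃ seq : ℕ → Theory.ModelType.{u, v, max u v w} T,
      seq 0 = Theory.ModelType.of T M ∧ ∀ i, seq (i + 1) = next (seq i) :=
    ⟨fun n => Nat.rec (Theory.ModelType.of T M) (fun _ X => next X) n, rfl, fun _ => rfl⟩
  have hstep : ∀ i, ∃ f : seq i ↪[L] seq (i + 1),
      ∀ (P : Type (max u v w)) [L.Structure P] [Nonempty P], P ⊨ T →
        ∀ (g : seq (i + 1) ↪[L] P) (r : ℕ) (φ : L.Formula (Fin r)),
          BoundedFormula.IsExistential φ → ∀ a : Fin r → seq i,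
            φ.Realize (g ∘ f ∘ a) → φ.Realize (f ∘ a) := by
    intro i
    rw [hs i]
    exact ⟨F _, hF _⟩
  choose f hf using hstep
  obtain ⟨e⟩ : Nonempty (M ↪[L] seq 0) := by
    rw [h0]
    exact ⟨Embedding.refl L M⟩
  obtain ⟨N, _, h, H⟩ := exists_isChainUnion (G := fun i => seq i) f
  have hne : Nonempty N := Nonempty.map (h 0) inferInstance
  have hN : N ⊨ T := hT (fun i => seq i) f N h H fun i => (seq i).is_model
  refine ⟨N, inferInstance, hne, ⟨hN, fun P _ _ hP g r φ hφ a h1 => ?_⟩, ⟨(h 0).comp e⟩⟩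
  -- The parameters appear at stage `i`, and stage `i + 1` was built to decide all existential
  -- formulas over stage `i`.
  obtain ⟨i, -, a', ha'⟩ := H.exists_lift a 0
  have hcomp : a = h (i + 1) ∘ f i ∘ a' := by
    ext j; simp [H.compat, ha']
  have h2 := hf i P hP (g.comp (h (i + 1))) r φ hφ a' (by
    convert h1 using 2
    rw [hcomp]; rfl)
  rw [hcomp]
  exact Formula.realize_of_isExistential hφ (h (i + 1)) _ h2

end Chains

end

/-! ### Modules over `K[X]` with a kernel configuration. -/

section

section Algebra

variable {K : Type*} [Field K]

theorem IrrPoly.isCoprime {f g : IrrPoly K} (h : f ≠ g) : IsCoprime f.1 g.1 := by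
  rw [f.2.1.coprime_iff_not_dvd]
  intro hd
  exact h (Subtype.ext (eq_of_monic_of_associated f.2.2 g.2.2 (f.2.1.associated_of_dvd g.2.1 hd)))

namespace KernelConfig

variable (C : KernelConfig K)

theorem sum_le_deg (h : C.deg ≠ ⊤) (s : Finset (IrrPoly K)) :
    ∑ f ∈ s, (f.1.natDegree : ℕ∞) * C.toFun f ≤ C.deg := by
  have := C.deg_eq.resolve_left h
  rw [this]
  exact le_iSup (fun s : Finset (IrrPoly K) => ∑ f ∈ s, (f.1.natDegree : ℕ∞) * C.toFun f) s

theorem toFun_ne_top (h : C.deg ≠ ⊤) (f : IrrPoly K) : C.toFun f ≠ ⊤ := by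
  intro hf
  have := C.sum_le_deg h {f}
  rw [Finset.sum_singleton, hf, ENat.mul_top (by simpa using f.2.1.natDegree_pos.ne')] at this
  exact h (top_le_iff.1 this)

theorem coe_exp {f : IrrPoly K} (h : C.toFun f ≠ ⊤) : (C.exp f : ℕ∞) = C.toFun f :=
  ENat.natCast_toNat h

/-- Each polynomial in the support contributes at least `1` to the degree sum, so the support cannot
have more than `deg C` elements. -/
theorem finite_support (h : C.deg ≠ ⊤) : {f | C.toFun f ≠ 0}.Finite := by
  by_contra hinf
  obtain ⟨s, hs, hcard⟩ := Set.Infinite.exists_subset_card_eq hinf (C.deg.toNat + 1)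
  have h1 := C.sum_le_deg h s
  have h2 : (s.card : ℕ∞) ≤ ∑ f ∈ s, (f.1.natDegree : ℕ∞) * C.toFun f := by
    rw [Finset.card_eq_sum_ones]
    push_cast
    refine Finset.sum_le_sum fun f hf => ?_
    rw [Order.one_le_iff_ne_zero]
    refine mul_ne_zero ?_ (hs hf)
    simpa using f.2.1.natDegree_pos.ne'
  have h3 := h2.trans h1
  rw [hcard, ← ENat.natCast_toNat h] at h3
  norm_cast at h3
  simp at h3

/-- Splits off the `f`-primary part. The cofactor is a product of powers of the other monic
irreducibles and hence coprime to `f`; the exponent of `f` itself is allowed to be zero. -/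
theorem miPo_eq_mul (h : C.deg ≠ ⊤) (f : IrrPoly K) :
    ∃ g, C.miPo = f.1 ^ C.exp f * g ∧ IsCoprime f.1 g := by
  classical
  have hfin := C.finite_support h
  let s := insert f hfin.toFinset
  have hs : Function.mulSupport (fun f : IrrPoly K => f.1 ^ C.exp f) ⊆ s := by
    intro g hg
    simp only [s, Finset.coe_insert, Set.Finite.coe_toFinset, Set.mem_insert_iff]
    right
    intro h0
    apply hg
    simp [exp, h0]
  refine ⟨∏ g ∈ s.erase f, g.1 ^ C.exp g, ?_, ?_⟩
  · rw [miPo, finprod_eq_prod_of_mulSupport_subset _ hs,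
      Finset.mul_prod_erase s (fun g : IrrPoly K => g.1 ^ C.exp g) (Finset.mem_insert_self _ _)]
  · exact IsCoprime.prod_right fun g hg =>
      (IrrPoly.isCoprime (Finset.ne_of_mem_erase hg).symm).pow_right

/-- Since `deg C` is nonzero, some exponent is positive. This keeps the quotient of `K[X]` by the
minimal polynomial from being zero. -/
theorem not_isUnit_miPo (h : C.deg ≠ ⊤) : ¬ IsUnit C.miPo := by
  have : ∃ f, C.toFun f ≠ 0 := by
    by_contra! h0
    refine C.deg_ne_zero ?_
    rw [C.deg_eq.resolve_left h]
    simp [h0]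
  obtain ⟨f, hf⟩ := this
  obtain ⟨g, hg, -⟩ := C.miPo_eq_mul h f
  intro hu
  rw [hg] at hu
  have h1 := isUnit_of_mul_isUnit_left hu
  have h2 : C.exp f ≠ 0 := by
    intro h0
    apply hf
    rw [← C.coe_exp (C.toFun_ne_top h f), h0]; rfl
  exact f.2.1.not_isUnit ((isUnit_pow_iff h2).1 h1)

theorem miPo_ne_zero (h : C.deg ≠ ⊤) : C.miPo ≠ 0 := by
  classical
  rw [miPo, finprod_eq_prod_of_mulSupport_subset (s := (C.finite_support h).toFinset)]
  · exact Finset.prod_ne_zero_iff.2 fun f _ => pow_ne_zero _ f.2.1.ne_zero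
  · intro g hg
    simp only [Set.Finite.coe_toFinset]
    intro h0
    apply hg
    simp [exp, h0]

end KernelConfig

/-- Multiplication with `X` is a `C`-endomorphism of the `K[X]`-module `V`. -/
def IsC (C : KernelConfig K) (V : Type*) [AddCommGroup V] [Module K[X] V] : Prop :=
  (C.deg ≠ ⊤ → ∀ v : V, C.miPo • v = 0) ∧
  (C.deg = ⊤ → ∀ f : IrrPoly K, C.toFun f ≠ ⊤ → ∀ v : V,
    f.1 ^ (C.exp f + 1) • v = 0 → f.1 ^ C.exp f • v = 0)

/-- Multiplication with `X` is `C`-image-complete. -/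
def IsImageComplete (C : KernelConfig K) (V : Type*) [AddCommGroup V] [Module K[X] V] : Prop :=
  ∀ f : IrrPoly K, C.toFun f ≠ ⊤ → ∀ v : V, ∃ v' : V, f.1 ^ (C.exp f + 1) • v' = f.1 ^ C.exp f • v

variable {C : KernelConfig K} {V W : Type*} [AddCommGroup V] [Module K[X] V]
  [AddCommGroup W] [Module K[X] W]

theorem smul_eq_zero_of_isCoprime {R M : Type*} [CommRing R] [AddCommGroup M] [Module R M]
    {a b : R} (h : IsCoprime a b) {v : M} (ha : a • v = 0) (hb : b • v = 0) : v = 0 := by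
  obtain ⟨s, t, hst⟩ := h
  rw [← one_smul R v, ← hst, add_smul, mul_smul, mul_smul, ha, hb, smul_zero, smul_zero, add_zero]

/-- Makes the kernel condition available for algebraic `C` as well: there `f ^ C(f) • v` is killed
by `f` and by the cofactor of `f ^ C(f)` in the minimal polynomial, and these are coprime. -/
theorem IsC.ker (h : IsC C V) {f : IrrPoly K} (hf : C.toFun f ≠ ⊤) {v : V}
    (hv : f.1 ^ (C.exp f + 1) • v = 0) : f.1 ^ C.exp f • v = 0 := by
  by_cases hd : C.deg = ⊤
  · exact h.2 hd f hf v hv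
  · obtain ⟨g, hg, hco⟩ := C.miPo_eq_mul hd f
    have h1 := h.1 hd v
    rw [hg, mul_comm, mul_smul] at h1
    rw [pow_succ', mul_smul] at hv
    exact smul_eq_zero_of_isCoprime hco hv h1

theorem IsC.ker_add (h : IsC C V) {f : IrrPoly K} (hf : C.toFun f ≠ ⊤) {v : V} (n : ℕ)
    (hv : f.1 ^ (C.exp f + n) • v = 0) : f.1 ^ C.exp f • v = 0 := by
  induction n generalizing v with
  | zero => exact hv
  | succ n ih =>
    have h1 : f.1 ^ (C.exp f + 1) • (f.1 ^ n • v) = 0 := by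
      rw [← mul_smul, ← pow_add, ← hv]; congr 2; ring
    have h2 := h.ker hf h1
    rw [← mul_smul, ← pow_add] at h2
    exact ih h2

theorem IsC.prod (hV : IsC C V) (hW : IsC C W) : IsC C (V × W) := by
  refine ⟨fun hd v => Prod.ext (hV.1 hd _) (hW.1 hd _), fun hd f hf v hv => ?_⟩
  rw [Prod.ext_iff] at hv ⊢
  exact ⟨hV.2 hd f hf _ hv.1, hW.2 hd f hf _ hv.2⟩

theorem IsC.finsupp {ι : Type*} (hV : IsC C V) : IsC C (ι →₀ V) := by
  refine ⟨fun hd v => Finsupp.ext fun i => hV.1 hd _, fun hd f hf v hv => Finsupp.ext fun i => ?_⟩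
  exact hV.2 hd f hf _ (DFunLike.congr_fun hv i)

theorem IsImageComplete.add (h : IsImageComplete C V) {f : IrrPoly K} (hf : C.toFun f ≠ ⊤) (n : ℕ)
    (v : V) : ∃ v', f.1 ^ (C.exp f + n) • v' = f.1 ^ C.exp f • v := by
  induction n with
  | zero => exact ⟨v, rfl⟩
  | succ n ih =>
    obtain ⟨v', hv'⟩ := ih
    obtain ⟨v'', hv''⟩ := h f hf v'
    refine ⟨v'', ?_⟩
    calc f.1 ^ (C.exp f + (n + 1)) • v'' = f.1 ^ n • f.1 ^ (C.exp f + 1) • v'' := by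
          rw [← mul_smul, ← pow_add]; congr 2; ring
      _ = f.1 ^ (C.exp f + n) • v' := by rw [hv'', ← mul_smul, ← pow_add, add_comm]
      _ = _ := hv'

/-- A module can be extended so that `f ^ C(f) • u` is divisible by `f ^ (C(f) + 1)`. -/
theorem exists_image_extension {V : Type u} [AddCommGroup V] [Module K[X] V] (hV : IsC C V)
    {f : IrrPoly K} (hf : C.toFun f ≠ ⊤) (u : V) :
    ∃ (W : Type u) (_ : AddCommGroup W) (_ : Module K[X] W) (i : V →ₗ[K[X]] W),
      Function.Injective i ∧ IsC C W ∧ ∃ w : W, f.1 ^ (C.exp f + 1) • w = i (f.1 ^ C.exp f • u) := by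
  let c := C.exp f
  -- The extension glues to `V` a second copy of `I = f ^ c V`, where an element `b` of `V` lying in
  -- `I` is identified with `f ^ (c + 1)` times its copy. Thus every element of `I` acquires a
  -- preimage under `f ^ (c + 1)`.
  let I : Submodule K[X] V := LinearMap.range (LinearMap.lsmul K[X] V (f.1 ^ c))
  let rel : I →ₗ[K[X]] V × I := I.subtype.prod (-(LinearMap.lsmul K[X] I (f.1 ^ (c + 1))))
  let W := (V × I) ⧸ LinearMap.range rel
  let i : V →ₗ[K[X]] W := (LinearMap.range rel).mkQ ∘ₗ LinearMap.inl _ _ _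
  -- No `f`-torsion survives in `I`, by the kernel condition on `V`. This makes `i` injective and
  -- handles the case `g = f` below.
  have hI : ∀ a : I, ∀ n, f.1 ^ n • a = 0 → a = 0 := by
    rintro ⟨_, a, rfl⟩ n h
    rw [Subtype.ext_iff] at h ⊢
    simp only [LinearMap.lsmul_apply, Submodule.coe_smul, Submodule.coe_zero] at h ⊢
    rw [← mul_smul, ← pow_add, add_comm] at h
    exact hV.ker_add hf n h
  have hmk : ∀ v a, (LinearMap.range rel).mkQ (v, a) = 0 ↔
      ∃ b : I, (b : V) = v ∧ -(f.1 ^ (c + 1) • b) = a := by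
    intro v a
    rw [Submodule.mkQ_apply, Submodule.Quotient.mk_eq_zero, LinearMap.mem_range]
    simp [rel, Prod.ext_iff]
  have hinj : Function.Injective i := by
    rw [injective_iff_map_eq_zero]
    intro v hv
    obtain ⟨b, hb, hb0⟩ := (hmk v 0).1 hv
    have := hI b (c + 1) (by simpa using hb0)
    rw [← hb, this]
    rfl
  have hsurj : Function.Surjective (LinearMap.range rel).mkQ := Submodule.mkQ_surjective _
  have hfI : ∀ v : V, f.1 ^ c • v ∈ I := fun v => ⟨v, rfl⟩
  have hW : ∀ w : W, ∃ v : V, f.1 ^ (c + 1) • w = i v := by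
    intro w
    obtain ⟨⟨v, a⟩, rfl⟩ := hsurj w
    refine ⟨f.1 ^ (c + 1) • v + a, ?_⟩
    rw [← sub_eq_zero, ← map_smul]
    change (LinearMap.range rel).mkQ _ - (LinearMap.range rel).mkQ (f.1 ^ (c + 1) • v + a, 0) = 0
    rw [← map_sub]
    refine (hmk _ _).2 ⟨-a, ?_, ?_⟩ <;> simp
  refine ⟨W, inferInstance, inferInstance, i, hinj, ⟨fun hd w => ?_, fun hd g hg w hw => ?_⟩,
    (LinearMap.range rel).mkQ (0, ⟨f.1 ^ c • u, hfI u⟩), ?_⟩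
  · obtain ⟨⟨v, a⟩, rfl⟩ := hsurj w
    rw [← map_smul, Prod.smul_mk, hV.1 hd]
    have : C.miPo • a = 0 := Subtype.ext (hV.1 hd a)
    rw [this]
    exact map_zero _
  · by_cases hfg : g = f
    · subst hfg
      obtain ⟨⟨v, a⟩, rfl⟩ := hsurj w
      rw [← map_smul] at hw ⊢
      obtain ⟨b, hb, hb'⟩ := (hmk _ _).1 hw
      have hab : a = -b := by
        rw [← sub_eq_zero]
        refine hI _ (c + 1) ?_
        rw [smul_sub, smul_neg, hb']
        exact sub_self _
      refine (hmk _ _).2 ⟨⟨g.1 ^ c • v, hfI v⟩, rfl, ?_⟩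
      subst hab
      ext
      simp only [Submodule.coe_neg, Submodule.coe_smul]
      change -(g.1 ^ (c + 1) • g.1 ^ c • v) = g.1 ^ c • -(b : V)
      rw [hb]
      change _ = g.1 ^ c • -(g.1 ^ (c + 1) • v)
      rw [smul_neg, smul_comm]
    -- For `g ≠ f`, multiplication by `f ^ (c + 1)` moves `w` into `V`, where the condition for `g`
    -- is known. Hence `g ^ C(g) • w` is killed both by `g` and by a power of `f`.
    · obtain ⟨v, hv⟩ := hW w
      have h1 : g.1 ^ C.exp g • v = 0 := by
        refine hV.2 hd g hg v (hinj ?_)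
        rw [map_smul, ← hv, smul_comm, hw, smul_zero, map_zero]
      have h2 : f.1 ^ (c + 1) • (g.1 ^ C.exp g • w) = 0 := by
        rw [smul_comm, hv, ← map_smul, h1, map_zero]
      refine smul_eq_zero_of_isCoprime (IrrPoly.isCoprime hfg).pow_right (a := g.1) ?_ h2
      rw [← mul_smul, ← pow_succ', hw]
  · rw [← sub_eq_zero, ← map_smul]
    change (LinearMap.range rel).mkQ _ - (LinearMap.range rel).mkQ (f.1 ^ c • u, 0) = 0
    rw [← map_sub]
    refine (hmk _ _).2 ⟨-⟨f.1 ^ c • u, hfI u⟩, ?_, ?_⟩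
    · simp
    · simp; rfl

end Algebra

end

/-! ### The module of a generic solution of a sequence system. -/

section

namespace SeqSystem

variable {K : Type*} [Field K] {C : KernelConfig K} (S : SeqSystem C)
  {V W : Type*} [AddCommGroup V] [Module K[X] V] [AddCommGroup W] [Module K[X] W]

/-- `x` solves `S(x; y)`, for parameters `y` in a module `V` over which `W` lies. -/
def IsSolution (i : V →ₗ[K[X]] W) (y : S.Par → V) (x : S.Var → W) : Prop :=
  (∀ k, S.ξ k • x (.ld k) = ∑ l, S.P k l • x (.li l) + i (y (.ld k))) ∧
  ∀ k, (S.f k).1 ^ S.q k • x (.ke k) = i (y (.ke k))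

/-- The parameters satisfy `δ`. -/
def IsAdmissible (y : S.Par → V) : Prop :=
  ∀ k, (S.f k).1 ^ (C.exp (S.f k) - S.q k) • y (.ke k) = 0

/-- All monomials that occur are allowed by `S`. -/
def IsReduced (p : S.Var → K[X]) : Prop :=
  ∀ x i, (p x).coeff i ≠ 0 → S.Allowed (x, i)

/-- The linear combination of `x` with coefficients `p`. -/
def combo (x : S.Var → W) : (S.Var → K[X]) →ₗ[K[X]] W where
  toFun p := ∑ l, p (.li l) • x (.li l) + ∑ k, p (.ld k) • x (.ld k) + ∑ k, p (.ke k) • x (.ke k)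
  map_add' p p' := by
    simp only [Pi.add_apply, add_smul, Finset.sum_add_distrib]
    abel
  map_smul' r p := by
    simp only [Pi.smul_apply, smul_eq_mul, mul_smul, Finset.smul_sum, smul_add, RingHom.id_apply]

theorem combo_apply (x : S.Var → W) (p : S.Var → K[X]) : S.combo x p =
    ∑ l, p (.li l) • x (.li l) + ∑ k, p (.ld k) • x (.ld k) + ∑ k, p (.ke k) • x (.ke k) := rfl

open Classical in
theorem combo_single (x : S.Var → W) (z : S.Var) (r : K[X]) :
    S.combo x (Pi.single z r) = r • x z := by
  rw [combo_apply]
  rcases z with l | k | k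
  · rw [Finset.sum_eq_single l, Finset.sum_eq_zero, Finset.sum_eq_zero]
    all_goals simp +contextual
  · rw [Finset.sum_eq_zero, Finset.sum_eq_single k, Finset.sum_eq_zero]
    all_goals simp +contextual
  · rw [Finset.sum_eq_zero, Finset.sum_eq_zero, Finset.sum_eq_single k]
    all_goals simp +contextual

/-- The relations of the module generated by a solution of `S(x; y)`, with coefficients `a`. -/
def relVar (a : S.Par → K[X]) : S.Var → K[X]
  | .li l => -∑ k, a (.ld k) * S.P k l
  | .ld k => a (.ld k) * S.ξ k
  | .ke k => a (.ke k) * (S.f k).1 ^ S.q k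

/-- The linear combination with coefficients `a` of the equations of `S`, all terms brought to one
side. The `V`-component collects the parameters, the other one the coefficients of the unknowns. -/
def relMap (y : S.Par → V) : (S.Par → K[X]) →ₗ[K[X]] V × (S.Var → K[X]) where
  toFun a := (-(∑ k, a (.ld k) • y (.ld k) + ∑ k, a (.ke k) • y (.ke k)), S.relVar a)
  map_add' a b := by
    refine Prod.ext ?_ (funext ?_)
    · simp only [Pi.add_apply, add_smul, Finset.sum_add_distrib, Prod.fst_add]
      abel
    · rintro (l | k | k)
      · simp only [relVar, Pi.add_apply, add_mul, Finset.sum_add_distrib, Prod.snd_add]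
        abel
      · simp [relVar, add_mul]
      · simp [relVar, add_mul]
  map_smul' r a := by
    refine Prod.ext ?_ (funext ?_)
    · simp only [Pi.smul_apply, smul_eq_mul, mul_smul, Finset.smul_sum, smul_add, smul_neg,
        RingHom.id_apply, Prod.smul_fst]
    · rintro (l | k | k)
      · simp [relVar, mul_assoc, Finset.mul_sum]
      · simp [relVar, mul_assoc]
      · simp [relVar, mul_assoc]

theorem relMap_apply (y : S.Par → V) (a : S.Par → K[X]) : S.relMap y a =
  (-(∑ k, a (.ld k) • y (.ld k) + ∑ k, a (.ke k) • y (.ke k)), S.relVar a) := rfl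

/-- The module generated over `V` by a generic solution of `S(x; y)`. -/
abbrev Generic (y : S.Par → V) : Type _ := (V × (S.Var → K[X])) ⧸ LinearMap.range (S.relMap y)

abbrev toGeneric (y : S.Par → V) : V × (S.Var → K[X]) →ₗ[K[X]] S.Generic y :=
  (LinearMap.range (S.relMap y)).mkQ

theorem toGeneric_surjective (y : S.Par → V) : Function.Surjective (S.toGeneric y) :=
  Submodule.mkQ_surjective _

theorem toGeneric_eq_zero (y : S.Par → V) (b) : S.toGeneric y b = 0 ↔ ∃ a, S.relMap y a = b := by
  rw [toGeneric, Submodule.mkQ_apply, Submodule.Quotient.mk_eq_zero, LinearMap.mem_range]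

/-- The inclusion of `V`. -/
def inl (y : S.Par → V) : V →ₗ[K[X]] S.Generic y := S.toGeneric y ∘ₗ LinearMap.inl _ _ _

open Classical in
/-- The generic solution. -/
def gen (y : S.Par → V) (x : S.Var) : S.Generic y := S.toGeneric y (0, Pi.single x 1)

theorem combo_gen (y : S.Par → V) (p : S.Var → K[X]) :
    S.combo (S.gen y) p = S.toGeneric y (0, p) := by
  classical
  have h : S.combo (S.gen y) = S.toGeneric y ∘ₗ LinearMap.inr K[X] V (S.Var → K[X]) := by
    refine LinearMap.pi_ext fun z r => ?_
    rw [combo_single, gen, ← map_smul]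
    simp only [LinearMap.comp_apply, LinearMap.inr_apply, Prod.smul_mk, smul_zero]
    congr 2
    rw [← Pi.single_smul, smul_eq_mul, mul_one]
  rw [h]; rfl

theorem inl_add_combo (y : S.Par → V) (v : V) (p : S.Var → K[X]) :
    S.inl y v + S.combo (S.gen y) p = S.toGeneric y (v, p) := by
  rw [combo_gen, inl, LinearMap.comp_apply, ← map_add]
  simp

open Classical in
theorem isSolution_gen (y : S.Par → V) : S.IsSolution (S.inl y) y (S.gen y) := by
  constructor
  · intro k
    have h : S.ξ k • S.gen y (.ld k) - ∑ l, S.P k l • S.gen y (.li l) =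
        S.combo (S.gen y) (S.relVar (Pi.single (.ld k) 1)) := by
      rw [combo_apply]
      simp only [relVar, Pi.single_apply]
      simp [ite_mul, ite_smul]
      abel
    rw [← sub_eq_iff_eq_add', h, combo_gen, inl, LinearMap.comp_apply, ← sub_eq_zero, ← map_sub,
      toGeneric_eq_zero]
    refine ⟨Pi.single (.ld k) 1, ?_⟩
    rw [relMap_apply]
    simp [Pi.single_apply]
  · intro k
    rw [gen, ← map_smul, inl, LinearMap.comp_apply, ← sub_eq_zero, ← map_sub, toGeneric_eq_zero]
    refine ⟨Pi.single (.ke k) 1, ?_⟩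
    rw [relMap_apply]
    refine Prod.ext (by simp [Pi.single_apply]) (funext ?_)
    rintro (l | j | j) <;> simp [relVar, Pi.single_apply]
    split_ifs with h
    · rw [h]
    · rfl

/-- The map from the generic module given by a solution. -/
theorem exists_lift {i : V →ₗ[K[X]] W} {y : S.Par → V} {x : S.Var → W}
    (h : S.IsSolution i y x) : ∃ g : S.Generic y →ₗ[K[X]] W,
      (∀ v, g (S.inl y v) = i v) ∧ ∀ z, g (S.gen y z) = x z := by
  classical
  refine ⟨(LinearMap.range (S.relMap y)).liftQ (i.coprod (S.combo x)) ?_, fun v => ?_, fun z => ?_⟩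
  · rintro _ ⟨a, rfl⟩
    rw [LinearMap.mem_ker, LinearMap.coprod_apply, relMap_apply, combo_apply]
    simp only [relVar, mul_smul, h.1, h.2, smul_add, Finset.sum_add_distrib, map_neg, map_add,
      map_sum, map_smul, neg_smul, Finset.sum_smul, Finset.sum_neg_distrib, Finset.smul_sum]
    rw [Finset.sum_comm]
    abel
  · simp [inl]
  · simp [gen, combo_single]

/-- A nonzero multiple of a monic `ξ_k` or `f_k ^ q_k` has at least the degree of that modulus,
whereas reduced entries stay below it. So no nonzero relation involves allowed monomials only. -/
theorem isReduced_eq_zero {p : S.Var → K[X]} (hp : S.IsReduced p) {a : S.Par → K[X]}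
    (h : S.relVar a = p) : a = 0 := by
  have key : ∀ (b r : K[X]) (n : ℕ), r.Monic → n = r.natDegree →
      (∀ i, (b * r).coeff i ≠ 0 → i < n) → b = 0 := by
    rintro b r _ hr rfl h1
    by_contra hb
    have h2 := h1 (b * r).natDegree (by
      rw [coeff_natDegree, leadingCoeff_ne_zero]
      exact mul_ne_zero hb hr.ne_zero)
    rw [natDegree_mul hb hr.ne_zero] at h2
    omega
  funext z
  rcases z with k | k
  · exact key _ _ _ (S.ξ_monic k) rfl fun i hi => hp (.ld k) i (by rw [← h]; exact hi)
  · exact key _ _ _ ((S.f k).2.2.pow _) rfl fun i hi => hp (.ke k) i (by rw [← h]; exact hi)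

theorem inl_injective (y : S.Par → V) : Function.Injective (S.inl y) := by
  rw [injective_iff_map_eq_zero]
  intro v hv
  obtain ⟨a, ha⟩ := (S.toGeneric_eq_zero y _).1 hv
  rw [relMap_apply, LinearMap.inl_apply, Prod.ext_iff] at ha
  have := S.isReduced_eq_zero (p := 0) (by intro x i h; simp at h) ha.2
  subst this
  simpa using ha.1.symm

/-- Provides the independence over `V` of the allowed monomials of the generic solution. -/
theorem combo_gen_mem_range {y : S.Par → V} {p : S.Var → K[X]} (hp : S.IsReduced p) {v : V}
    (h : S.combo (S.gen y) p = S.inl y v) : p = 0 := by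
  have h1 : S.toGeneric y (-v, p) = 0 := by
    rw [← inl_add_combo, h, map_neg, neg_add_cancel]
  obtain ⟨a, ha⟩ := (S.toGeneric_eq_zero y _).1 h1
  rw [relMap_apply, Prod.mk.injEq] at ha
  have := S.isReduced_eq_zero hp ha.2
  subst this
  rw [← ha.2]
  funext z
  rcases z with l | k | k <;> simp [relVar]

/-- Every element of the generic module is a linear combination of allowed monomials modulo `V`. -/
theorem exists_reduced (y : S.Par → V) (w : S.Generic y) :
    ∃ v p, S.IsReduced p ∧ w = S.inl y v + S.combo (S.gen y) p := by
  have key : ∀ (p r : K[X]) (i : ℕ), r.Monic → 0 < r.natDegree → (p %ₘ r).coeff i ≠ 0 →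
      i < r.natDegree := by
    intro p r i hr h0 hi
    by_contra hlt
    refine hi (coeff_eq_zero_of_natDegree_lt (lt_of_lt_of_le ?_ (not_lt.1 hlt)))
    exact natDegree_modByMonic_lt p hr (by rintro rfl; simp at h0)
  obtain ⟨⟨v, p⟩, rfl⟩ := S.toGeneric_surjective y w
  -- The quotients of the division with remainder. Subtracting this relation leaves remainders at
  -- the `ld` and `ke` entries; the `li` entries absorb the corrections coming from `P`, as their
  -- degrees are unrestricted.
  let a : S.Par → K[X] := fun z => match z with
    | .ld k => p (.ld k) /ₘ S.ξ k
    | .ke k => p (.ke k) /ₘ ((S.f k).1 ^ S.q k)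
  refine ⟨v - (S.relMap y a).1, p - (S.relMap y a).2, ?_, ?_⟩
  · rintro (l | k | k) i hi
    · trivial
    · refine key (p (.ld k)) _ i (S.ξ_monic k) (S.ξ_deg k) ?_
      rw [modByMonic_eq_sub_mul_div (p (.ld k)) (S.ξ k), mul_comm]
      exact hi
    · refine key (p (.ke k)) _ i ((S.f k).2.2.pow _) ?_ ?_
      · rw [natDegree_pow]
        exact Nat.mul_pos (S.q_pos k) (S.f k).2.1.natDegree_pos
      · rw [modByMonic_eq_sub_mul_div (p (.ke k)) ((S.f k).1 ^ S.q k), mul_comm]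
        exact hi
  · rw [inl_add_combo, ← sub_eq_zero, ← map_sub, toGeneric_eq_zero]
    exact ⟨a, by ext <;> simp⟩

/-- The generic module is a `C`-module. -/
theorem isC_generic (hV : IsC C V) {y : S.Par → V} (hy : S.IsAdmissible y) :
    IsC C (S.Generic y) := by
  refine ⟨fun hd w => ?_, fun hd g hg w hw => ?_⟩
  · obtain ⟨v, p, -, rfl⟩ := S.exists_reduced y w
    -- Multiplication by `f_k ^ q_k` turns the generator into `y_k`, which admissibility kills by
    -- `f_k ^ (C(f_k) - q_k)`; altogether `f_k ^ C(f_k)`, a factor of the minimal polynomial,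
    -- annihilates it. In the algebraic case there are no other generators over `V`.
    have hke : ∀ k, C.miPo • S.gen y (.ke k) = 0 := by
      intro k
      obtain ⟨g, hg, -⟩ := C.miPo_eq_mul hd (S.f k)
      rw [hg, mul_comm, ← Nat.sub_add_cancel (S.q_le k), pow_add, mul_smul, mul_smul,
        (S.isSolution_gen y).2 k, ← map_smul, hy k, map_zero, smul_zero]
    have h1 : IsEmpty (Fin S.numLi) := by rw [S.alg_li hd]; infer_instance
    have h2 : IsEmpty (Fin S.numLd) := by rw [S.alg_ld hd]; infer_instance
    rw [smul_add, ← map_smul, hV.1 hd, map_zero, zero_add, combo_apply, Fintype.sum_empty,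
      Fintype.sum_empty, zero_add, zero_add, Finset.smul_sum]
    exact Finset.sum_eq_zero fun k _ => by rw [smul_comm, hke, smul_zero]
  · obtain ⟨⟨v, p⟩, rfl⟩ := S.toGeneric_surjective y w
    rw [← map_smul] at hw ⊢
    -- So `g ^ (c + 1) • (v, p)` is the relation with coefficients `a`. The aim is to divide this
    -- relation by `g` and obtain one for `g ^ c • (v, p)`.
    obtain ⟨a, ha⟩ := (S.toGeneric_eq_zero y _).1 hw
    set c := C.exp g with hc
    rw [relMap_apply, Prod.smul_mk, Prod.mk.injEq] at ha
    obtain ⟨ha1, ha2⟩ := ha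
    have hg0 : g.1 ^ (c + 1) ≠ 0 := pow_ne_zero _ g.2.1.ne_zero
    -- coefficients of the relation divided by `g ^ (c + 1)`
    have hdvd : ∀ r t a : K[X], IsCoprime g.1 r → a * r = g.1 ^ (c + 1) * t →
        ∃ b, a = g.1 ^ (c + 1) * b := by
      intro r t a hco h
      exact (hco.pow_left (m := c + 1)).dvd_of_dvd_mul_right ⟨t, h⟩
    have hld : ∀ k, ∃ b, a (.ld k) = g.1 ^ (c + 1) * b := by
      intro k
      refine hdvd (S.ξ k) (p (.ld k)) _ ?_ (congrFun ha2 (.ld k))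
      rw [g.2.1.coprime_iff_not_dvd]
      exact fun h => hg (S.ξ_fac k g h)
    have hke : ∀ k, ∃ b, a (.ke k) = g.1 ^ (c + 1) * b ∨
        (S.f k = g ∧ a (.ke k) = g.1 ^ (c + 1 - S.q k) * p (.ke k)) := by
      intro k
      have h1 : a (.ke k) * (S.f k).1 ^ S.q k = g.1 ^ (c + 1) * p (.ke k) := congrFun ha2 (.ke k)
      by_cases hk : S.f k = g
      · refine ⟨0, Or.inr ⟨hk, ?_⟩⟩
        have h2 : S.q k ≤ c + 1 := by
          have := S.q_le k
          rw [hk] at this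
          omega
        rw [hk] at h1
        have h3 : g.1 ^ S.q k ≠ 0 := pow_ne_zero _ g.2.1.ne_zero
        apply mul_right_cancel₀ h3
        rw [h1, mul_right_comm, ← pow_add, Nat.sub_add_cancel h2]
      · obtain ⟨b, hb⟩ := hdvd _ _ _ (IrrPoly.isCoprime (Ne.symm hk)).pow_right h1
        exact ⟨b, Or.inl hb⟩
    choose bl hbl using hld
    choose bk hbk using hke
    classical
    -- The quotient of `a` by `g`. Entries whose modulus is coprime to `g` contain the full power `g
    -- ^ (c + 1)`; entries with `f_k = g` contain at least one factor `g` because `q_k ≤ c`.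
    let b : S.Par → K[X] := fun z => match z with
      | .ld k => g.1 ^ c * bl k
      | .ke k => if a (.ke k) = g.1 ^ (c + 1) * bk k then g.1 ^ c * bk k
          else g.1 ^ (c - S.q k) * p (.ke k)
    have hb : ∀ z, a z = g.1 * b z := by
      rintro (k | k)
      · rw [hbl]
        simp only [b]
        ring
      · simp only [b]
        split_ifs with h1
        · rw [h1]; ring
        · obtain ⟨h2, h3⟩ := (hbk k).resolve_left h1
          have h4 := S.q_le k
          rw [h2] at h4
          rw [h3, ← mul_assoc, ← pow_succ']
          congr 2
          omega
    -- In the second alternative of `hbk` the coefficient contains `g ^ (c - q_k)`, which kills the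
    -- admissible parameter `y_k`. The remaining terms of the `V`-component share the factor `g ^ (c
    -- + 1)`, so the kernel condition on `V` lowers the exponent by one.
    have hbv : g.1 ^ (c + 1) • (v + (∑ k, bl k • y (.ld k) + ∑ k,
        (if a (.ke k) = g.1 ^ (c + 1) * bk k then bk k else 0) • y (.ke k))) = 0 := by
      rw [smul_add, ← ha1]
      simp only [smul_add, Finset.smul_sum, ← mul_smul, ← hbl]
      rw [neg_add_eq_zero]
      congr 1
      refine Finset.sum_congr rfl fun k _ => ?_
      split_ifs with h1
      · rw [← h1]
      · obtain ⟨h2, h3⟩ := (hbk k).resolve_left h1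
        have h4 := hy k
        have h5 := S.q_le k
        rw [h2] at h4 h5
        rw [mul_zero, zero_smul, h3, mul_comm, show c + 1 - S.q k = (c - S.q k) + 1 by omega,
          pow_succ', mul_smul, mul_smul, h4, smul_zero, smul_zero]
    have hbv' := hV.2 hd g hg _ hbv
    refine (S.toGeneric_eq_zero y _).2 ⟨b, ?_⟩
    rw [relMap_apply, Prod.smul_mk]
    refine Prod.ext ?_ (funext ?_)
    · rw [smul_add, add_eq_zero_iff_eq_neg] at hbv'
      rw [hbv', neg_inj, smul_add, Finset.smul_sum, Finset.smul_sum]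
      simp only [← mul_smul]
      congr 1
      refine Finset.sum_congr rfl fun k _ => ?_
      simp only [b]
      split_ifs with h1
      · rfl
      · obtain ⟨h2, h3⟩ := (hbk k).resolve_left h1
        have h4 := hy k
        rw [h2] at h4
        rw [mul_zero, zero_smul, mul_comm, mul_smul, h4, smul_zero]
    · have hg1 : g.1 ≠ 0 := g.2.1.ne_zero
      intro z
      apply mul_left_cancel₀ hg1
      have h1 : g.1 * S.relVar b z = S.relVar a z := by
        have h2 : a = g.1 • b := funext fun z => hb z
        have h3 := (S.relMap y).map_smul g.1 b
        rw [← h2, relMap_apply, relMap_apply, Prod.smul_mk, Prod.ext_iff] at h3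
        exact (congrFun h3.2 z).symm
      change _ = g.1 * (g.1 ^ c • p) z
      rw [h1, ha2]
      simp only [Pi.smul_apply, smul_eq_mul]
      ring

end SeqSystem

end

/-! ### Presenting finite parts of an extension by sequence systems. -/

section

section Decomposition

variable {K : Type k} [Field K]

/-- The structure theorem for finitely generated `K[X]`-modules in terms of generators. -/
theorem exists_generators (Q : Type*) [AddCommGroup Q] [Module K[X] Q] [Module.Finite K[X] Q] :
    ∃ (m : ℕ) (τ : Type k) (_ : Fintype τ) (f : τ → IrrPoly K) (e : τ → ℕ) (g : Fin m → Q)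
      (h : τ → Q), (∀ j, 0 < e j) ∧ (∀ j, (f j).1 ^ e j • h j = 0) ∧
      (∀ (p : Fin m → K[X]) (r : τ → K[X]), ∑ l, p l • g l + ∑ j, r j • h j = 0 →
        (∀ l, p l = 0) ∧ ∀ j, (f j).1 ^ e j ∣ r j) ∧
      ∀ a, ∃ (p : Fin m → K[X]) (r : τ → K[X]), a = ∑ l, p l • g l + ∑ j, r j • h j := by
  classical
  obtain ⟨m, ι, _, p, hp, e, ⟨E⟩⟩ := Module.equiv_free_prod_directSum (R := K[X]) (M := Q)
  -- The structure theorem only provides irreducible polynomials; passing to monic associates does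
  -- not change the ideals.
  let f : ι → IrrPoly K := fun i => ⟨normalize (p i), (normalize_associated (p i)).irreducible_iff.2
    (hp i), monic_normalize (hp i).ne_zero⟩
  have hf : ∀ i, Associated ((f i).1 ^ e i) (p i ^ e i) := fun i =>
    (normalize_associated (p i)).pow_pow
  let g : Fin m → Q := fun l => E.symm (Finsupp.single l 1, 0)
  let h : ι → Q := fun i => E.symm (0, DirectSum.lof K[X] ι _ i (Submodule.Quotient.mk 1))
  let A : Fin m → Q →ₗ[K[X]] K[X] := fun l =>
    Finsupp.lapply l ∘ₗ LinearMap.fst _ _ _ ∘ₗ E.toLinearMap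
  let B : ∀ i, Q →ₗ[K[X]] K[X] ⧸ Submodule.span K[X] {p i ^ e i} := fun i =>
    DirectSum.component K[X] ι _ i ∘ₗ LinearMap.snd _ _ _ ∘ₗ E.toLinearMap
  have hAg : ∀ l l', A l (g l') = if l' = l then 1 else 0 := by
    intro l l'
    simp [A, g, Finsupp.single_apply]
  have hAh : ∀ l i, A l (h i) = 0 := by
    intro l i
    simp [A, h]
  have hBg : ∀ i l, B i (g l) = 0 := by
    intro i l
    simp [B, g]
  have hBh : ∀ i, B i (h i) = Submodule.Quotient.mk 1 := by
    intro i
    simp [B, h, DirectSum.component.lof_self]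
  have hBh' : ∀ i j, j ≠ i → B i (h j) = 0 := by
    intro i j hij
    simp only [B, h, LinearMap.comp_apply, LinearEquiv.coe_coe, LinearEquiv.apply_symm_apply,
      LinearMap.snd_apply, DirectSum.component.of]
    rw [dif_neg hij]
  have hh : ∀ i, (f i).1 ^ e i • h i = 0 := by
    intro i
    simp only [h]
    rw [← map_smul, Prod.smul_mk, smul_zero, ← map_smul]
    have : ((f i).1 ^ e i • (Submodule.Quotient.mk 1 : K[X] ⧸ Submodule.span K[X] {p i ^ e i}))
        = 0 := by
      rw [← Submodule.Quotient.mk_smul, Submodule.Quotient.mk_eq_zero, smul_eq_mul, mul_one,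
        Submodule.mem_span_singleton]
      obtain ⟨u, hu⟩ := (hf i).symm.dvd
      exact ⟨u, by rw [hu, smul_eq_mul, mul_comm]⟩
    rw [this, map_zero]
    exact map_zero _
  -- Summands with exponent `0` are trivial and are dropped, since a sequence system demands
  -- positive exponents.
  refine ⟨m, {i // 0 < e i}, inferInstance, fun i => f i, fun i => e i, g, fun i => h i,
    fun i => i.2, fun i => hh i, fun c r hcr => ⟨fun l => ?_, fun i => ?_⟩, fun a => ?_⟩
  · have := congrArg (A l) hcr
    simpa [hAg, hAh] using this
  · have := congrArg (B i) hcr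
    rw [map_add, map_sum, map_sum, Finset.sum_eq_zero (by intros; rw [map_smul, hBg, smul_zero]),
      zero_add, Finset.sum_eq_single i, map_smul, hBh, map_zero, ← Submodule.Quotient.mk_smul,
      Submodule.Quotient.mk_eq_zero, smul_eq_mul, mul_one, Submodule.mem_span_singleton] at this
    · obtain ⟨u, hu⟩ := this
      refine (hf i).dvd.trans ⟨u, ?_⟩
      rw [← hu, smul_eq_mul, mul_comm]
    · intro j _ hj
      rw [map_smul, hBh' _ _ (fun h => hj (Subtype.ext h)), smul_zero]
    · simp
  · choose r hr using fun i => Submodule.Quotient.mk_surjective _ ((E a).2 i)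
    refine ⟨fun l => (E a).1 l, fun i => r i, ?_⟩
    apply E.injective
    refine Prod.ext (Finsupp.ext fun l => ?_) (DFinsupp.ext fun i => ?_)
    · change A l a = A l _
      rw [map_add, map_sum, map_sum]
      simp [hAg, hAh]
      rfl
    · change B i a = B i _
      rw [map_add, map_sum, map_sum, Finset.sum_eq_zero (by intros; rw [map_smul, hBg, smul_zero]),
        zero_add]
      by_cases hi : 0 < e i
      · rw [Finset.sum_eq_single ⟨i, hi⟩, map_smul, hBh, ← Submodule.Quotient.mk_smul, smul_eq_mul,
          mul_one]
        · exact (hr i).symm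
        · intro j _ hj
          rw [map_smul, hBh' _ _ (fun h => hj (Subtype.ext h)), smul_zero]
        · simp
      · have : Subsingleton (K[X] ⧸ Submodule.span K[X] {p i ^ e i}) := by
          rw [Nat.eq_zero_of_not_pos hi, pow_zero, Submodule.Quotient.subsingleton_iff]
          exact Ideal.span_singleton_one
        exact Subsingleton.elim _ _

variable {C : KernelConfig K} {V W : Type*} [AddCommGroup V] [Module K[X] V]
  [AddCommGroup W] [Module K[X] W]

/-- If `f ^ e` is the order of `x` modulo `V` and `C(f)` is finite, then `x` can be modified by an
element of `V` so that it satisfies a kernel equation of a `C`-sequence-system. -/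
theorem exists_kernel_lift (hW : IsC C W) (hV : IsImageComplete C V) (i : V →ₗ[K[X]] W)
    (hi : Function.Injective i) {f : IrrPoly K} (hf : C.toFun f ≠ ⊤) {e : ℕ} {x : W} {v : V}
    (hx : f.1 ^ e • x = i v) (hord : ∀ (r : K[X]) (u : V), r • x = i u → f.1 ^ e ∣ r) :
    ∃ v' y : V, f.1 ^ e • (x - i v') = i y ∧ e ≤ C.exp f ∧ f.1 ^ (C.exp f - e) • y = 0 := by
  -- Image-completeness gives `f ^ (C(f) + e) • v' = f ^ C(f) • v`, so that `x - i v'` is killed by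
  -- a power of `f`, hence by `f ^ C(f)`.
  obtain ⟨v', hv'⟩ := hV.add hf e v
  have h1 : f.1 ^ (C.exp f + e) • (x - i v') = 0 := by
    rw [smul_sub, ← map_smul, hv', pow_add, mul_smul, hx, map_smul, sub_self]
  have h2 := hW.ker_add hf e h1
  -- Since `f ^ C(f)` carries `x` into `V`, it is a multiple of the order `f ^ e` of `x` modulo `V`.
  have h3 : e ≤ C.exp f := by
    have := hord (f.1 ^ C.exp f) (f.1 ^ C.exp f • v') (by
      rw [map_smul, ← sub_eq_zero, ← smul_sub, h2])
    exact (pow_dvd_pow_iff f.2.1.ne_zero f.2.1.not_isUnit).1 this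
  refine ⟨v', v - f.1 ^ e • v', by rw [smul_sub, hx, map_sub, map_smul], h3, hi ?_⟩
  rw [map_smul, map_sub, map_smul, ← hx, ← smul_sub, ← mul_smul, ← pow_add, Nat.sub_add_cancel h3,
    h2, map_zero]

theorem isReduced_dvd {S : SeqSystem C} {p : S.Var → K[X]} (hp : S.IsReduced p) :
    (∀ k, S.ξ k ∣ p (.ld k) → p (.ld k) = 0) ∧
      ∀ k, (S.f k).1 ^ S.q k ∣ p (.ke k) → p (.ke k) = 0 := by
  have key : ∀ (r s : K[X]), r ∣ s → (∀ i, s.coeff i ≠ 0 → i < r.natDegree) → s = 0 := by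
    intro r s hd h
    by_contra hs
    have h1 := h s.natDegree (by rwa [coeff_natDegree, leadingCoeff_ne_zero])
    exact absurd (natDegree_le_of_dvd hd hs) (not_le.2 h1)
  exact ⟨fun k hd => key _ _ hd fun i hi => hp (.ld k) i hi,
    fun k hd => key _ _ hd fun i hi => hp (.ke k) i hi⟩

/-- Finitely many elements of a `C`-module over an image-complete one are contained in the module
generated by a solution of a `C`-sequence-system whose allowed monomials are independent. -/
theorem exists_seqSystem (hW : IsC C W) (hV : IsImageComplete C V) (i : V →ₗ[K[X]] W)
    (hi : Function.Injective i) (B : Finset W) :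
    ∃ (S : SeqSystem C) (y : S.Par → V) (x : S.Var → W), S.IsSolution i y x ∧ S.IsAdmissible y ∧
      (∀ p v, S.IsReduced p → S.combo x p = i v → p = 0) ∧
      ∀ b ∈ B, ∃ v p, b = i v + S.combo x p := by
  classical
  let I := LinearMap.range i
  -- Working modulo `V` makes the relevant module finitely generated, so that the structure theorem
  -- applies.
  let Q : Submodule K[X] (W ⧸ I) := Submodule.span K[X] (I.mkQ '' B)
  have : Module.Finite K[X] Q :=
    Module.Finite.span_of_finite K[X] (B.finite_toSet.image I.mkQ)
  obtain ⟨m, τ, _, f, e, g, h, he, hfe, hind, hgen⟩ := exists_generators (K := K) Q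
  choose g' hg' using fun l => I.mkQ_surjective (g l)
  choose h' hh' using fun j => I.mkQ_surjective (h j)
  have hmk : ∀ w : W, I.mkQ w = 0 ↔ ∃ v, w = i v := by
    intro w
    rw [Submodule.mkQ_apply, Submodule.Quotient.mk_eq_zero, LinearMap.mem_range]
    simp [eq_comm]
  have hsum : ∀ (p : Fin m → K[X]) (r : τ → K[X]) (h'' : τ → W), (∀ j, I.mkQ (h'' j) = h j) →
      I.mkQ (∑ l, p l • g' l + ∑ j, r j • h'' j) =
        ((∑ l, p l • g l + ∑ j, r j • h j : Q) : W ⧸ I) := by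
    intro p r h'' hh''
    simp only [map_add, map_sum, map_smul, hg', hh'', Submodule.coe_add, Submodule.coe_sum,
      Submodule.coe_smul]
  have hind' : ∀ (p : Fin m → K[X]) (r : τ → K[X]) (h'' : τ → W), (∀ j, I.mkQ (h'' j) = h j) →
      ∀ v, ∑ l, p l • g' l + ∑ j, r j • h'' j = i v →
        (∀ l, p l = 0) ∧ ∀ j, (f j).1 ^ e j ∣ r j := by
    intro p r h'' hh'' v hv
    refine hind p r ?_
    rw [← ZeroMemClass.coe_eq_zero, ← hsum p r h'' hh'']
    exact (hmk _).2 ⟨v, hv⟩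
  have hord : ∀ j (r : K[X]) (u : V), r • h' j = i u → (f j).1 ^ e j ∣ r := by
    intro j r u hu
    have := (hind' 0 (Pi.single j r) h' hh' u (by
      rw [← hu]
      simp only [Pi.zero_apply, zero_smul, Finset.sum_const_zero, zero_add]
      rw [Finset.sum_eq_single j]
      · simp
      · intro b _ hb; simp [hb]
      · simp)).2 j
    simpa using this
  have hfv : ∀ j, ∃ v, (f j).1 ^ e j • h' j = i v := by
    intro j
    rw [← hmk, map_smul, hh', ← Submodule.coe_smul, hfe, Submodule.coe_zero]
  choose v hv using hfv
  -- An arbitrary lift is good enough when `C(f) = ∞`, where it will serve as an `ld` variable. When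
  -- `C(f)` is finite the lift is corrected by an element of `V` and becomes a `ke` variable.
  have hlift : ∀ j, ∃ x y, I.mkQ x = h j ∧ (f j).1 ^ e j • x = i y ∧ (C.toFun (f j) ≠ ⊤ →
      e j ≤ C.exp (f j) ∧ (f j).1 ^ (C.exp (f j) - e j) • y = 0) := by
    intro j
    by_cases hj : C.toFun (f j) = ⊤
    · exact ⟨h' j, v j, hh' j, hv j, fun h => absurd hj h⟩
    · obtain ⟨v', y, h1, h2, h3⟩ := exists_kernel_lift hW hV i hi hj (hv j) (hord j)
      refine ⟨h' j - i v', y, ?_, h1, fun _ => ⟨h2, h3⟩⟩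
      rw [map_sub, hh', (hmk (i v')).2 ⟨v', rfl⟩, sub_zero]
  choose x y hx hxy hC using hlift
  let eL := (Fintype.equivFin {j // C.toFun (f j) = ⊤}).symm
  let eK := (Fintype.equivFin {j // ¬ C.toFun (f j) = ⊤}).symm
  -- In the algebraic case the nonzero minimal polynomial annihilates `W`, which rules out free
  -- generators.
  have hm : C.deg ≠ ⊤ → m = 0 := by
    intro hd
    by_contra hm
    let l : Fin m := ⟨0, Nat.pos_of_ne_zero hm⟩
    have := (hind' (Pi.single l C.miPo) 0 h' hh' 0 (by
      simp only [Pi.zero_apply, zero_smul, Finset.sum_const_zero, add_zero, map_zero]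
      rw [Finset.sum_eq_single l]
      · simp [hW.1 hd]
      · intro b _ hb; simp [hb]
      · simp)).1 l
    rw [Pi.single_eq_same] at this
    exact C.miPo_ne_zero hd this
  let S : SeqSystem C :=
    { numLi := m
      numLd := Fintype.card {j // C.toFun (f j) = ⊤}
      numKe := Fintype.card {j // ¬ C.toFun (f j) = ⊤}
      ξ := fun k => (f (eL k)).1 ^ e (eL k)
      -- The generators come from a direct sum decomposition, so each torsion generator has an
      -- equation of its own, without `li` variables.
      P := 0
      f := fun k => f (eK k)
      q := fun k => e (eK k)
      alg_li := hm
      alg_ld := fun hd => Fintype.card_eq_zero_iff.2 ⟨fun j => C.toFun_ne_top hd _ j.2⟩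
      ξ_monic := fun k => (f (eL k)).2.2.pow _
      ξ_deg := fun k => by
        rw [natDegree_pow]
        exact Nat.mul_pos (he _) (f (eL k)).2.1.natDegree_pos
      ξ_fac := fun k g' hg' => by
        have h1 : g' = f (eL k) := by
          by_contra hne
          exact g'.2.1.not_isUnit
            (((IrrPoly.isCoprime hne).pow_right (n := e (eL k))).isUnit_of_dvd hg')
        rw [h1]
        exact (eL k).2
      f_pos := fun k => by
        rw [pos_iff_ne_zero, ← C.coe_exp (eK k).2]
        have h1 := (hC _ (eK k).2).1
        have h2 := he (eK k)
        norm_cast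
        omega
      f_fin := fun k => (eK k).2
      q_pos := fun k => he _
      q_le := fun k => (hC _ (eK k).2).1 }
  let X : S.Var → W := fun z => match z with
    | .li l => g' l
    | .ld k => x (eL k)
    | .ke k => x (eK k)
  let Y : S.Par → V := fun z => match z with
    | .ld k => y (eL k)
    | .ke k => y (eK k)
  have hcombo : ∀ (p : S.Var → K[X]) (r : τ → K[X]), (∀ k, r (eL k) = p (.ld k)) →
      (∀ k, r (eK k) = p (.ke k)) →
      S.combo X p = ∑ l, p (.li l) • g' l + ∑ j, r j • x j := by
    intro p r hl hk
    rw [S.combo_apply, add_assoc, ← Fintype.sum_subtype_add_sum_subtype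
      (fun j => C.toFun (f j) = ⊤) (fun j => r j • x j), ← eL.sum_comp, ← eK.sum_comp]
    simp only [hl, hk]
    rfl
  refine ⟨S, Y, X, ⟨fun k => ?_, fun k => hxy _⟩, fun k => (hC _ (eK k).2).2,
    fun p v hp hpv => ?_, fun b hb => ?_⟩
  · have : ∀ l, S.P k l • X (.li l) = 0 := fun l => by
      change (0 : K[X]) • X (.li l) = 0
      rw [zero_smul]
    rw [Finset.sum_eq_zero fun l _ => this l, zero_add]
    exact hxy _
  · let r : τ → K[X] := fun j => if hj : C.toFun (f j) = ⊤ then p (.ld (eL.symm ⟨j, hj⟩))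
      else p (.ke (eK.symm ⟨j, hj⟩))
    have hl : ∀ k, r (eL k) = p (.ld k) := by
      intro k
      simp only [r]
      rw [dif_pos (eL k).2]
      simp
    have hk : ∀ k, r (eK k) = p (.ke k) := by
      intro k
      simp only [r]
      rw [dif_neg (eK k).2]
      simp
    obtain ⟨h1, h2⟩ := hind' (fun l => p (.li l)) r x hx v (by rw [← hpv, hcombo p r hl hk])
    obtain ⟨h3, h4⟩ := isReduced_dvd hp
    funext z
    rcases z with l | k | k
    · exact h1 l
    · refine h3 k ?_
      rw [← hl]
      exact h2 _
    · refine h4 k ?_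
      rw [← hk]
      exact h2 _
  · obtain ⟨c, r, hcr⟩ := hgen ⟨I.mkQ b, Submodule.subset_span ⟨b, hb, rfl⟩⟩
    let p : S.Var → K[X] := fun z => match z with
      | .li l => c l
      | .ld k => r (eL k)
      | .ke k => r (eK k)
    have h1 : I.mkQ (b - S.combo X p) = 0 := by
      rw [map_sub, hcombo p r (fun _ => rfl) (fun _ => rfl), hsum _ r x hx, sub_eq_zero]
      exact congrArg Subtype.val hcr
    obtain ⟨v, hv⟩ := (hmk _).1 h1
    exact ⟨v, p, by rw [← hv, sub_add_cancel]⟩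

end Decomposition

end

/-! ### Extending `C`-endomorphisms to larger vector spaces. -/

section

section Extension

variable {K : Type k} [Field K] {C : KernelConfig K}

/-- There is a nonzero cyclic `C`-module. -/
theorem exists_cyclic_isC (C : KernelConfig K) :
    ∃ (P : Type k) (_ : AddCommGroup P) (_ : Module K[X] P) (_ : Module K P)
      (_ : IsScalarTower K K[X] P) (β : Type) (_ : Countable β) (_ : Nonempty β),
      IsC C P ∧ Nonempty (Module.Basis β K P) := by
  by_cases hd : C.deg = ⊤
  · refine ⟨K[X], inferInstance, inferInstance, inferInstance, inferInstance, ℕ, inferInstance,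
      inferInstance, ⟨fun h => absurd hd h, fun _ f _ v hv => ?_⟩, ⟨basisMonomials K⟩⟩
    rw [smul_eq_mul, mul_eq_zero] at hv
    rw [hv.resolve_left (pow_ne_zero _ f.2.1.ne_zero), smul_zero]
  · let b := (AdjoinRoot.powerBasis (C.miPo_ne_zero hd)).basis
    -- Nontriviality makes the index type of the power basis non-empty. In the transcendental case
    -- the torsion-free module `K[X]` itself was available.
    have hnt : Nontrivial (AdjoinRoot C.miPo) :=
      Ideal.Quotient.nontrivial_iff.2 fun h =>
        C.not_isUnit_miPo hd (Ideal.span_singleton_eq_top.1 h)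
    refine ⟨K[X] ⧸ Ideal.span {C.miPo}, inferInstance, inferInstance, inferInstance, inferInstance,
      _, inferInstance, b.index_nonempty, ⟨fun _ v => ?_, fun h => absurd h hd⟩, ⟨b⟩⟩
    obtain ⟨v, rfl⟩ := Ideal.Quotient.mk_surjective v
    rw [← Ideal.Quotient.mk_eq_mk, ← Submodule.Quotient.mk_smul, Ideal.Quotient.mk_eq_mk,
      Ideal.Quotient.eq_zero_iff_mem, smul_eq_mul]
    exact Ideal.mul_mem_right _ _ (Ideal.mem_span_singleton_self _)

/-- Serves to regroup an infinite basis into blocks, each indexed like a basis of the cyclic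
`C`-module. -/
theorem nonempty_equiv_prod_of_countable (ι : Type u) [Infinite ι] (β : Type) [Countable β]
    [Nonempty β] : Nonempty (ι ≃ ι × β) := by
  rw [← Cardinal.lift_mk_eq', Cardinal.mk_prod]
  simp only [Cardinal.lift_uzero, Cardinal.lift_id]
  refine (Cardinal.mul_eq_left (Cardinal.aleph0_le_mk ι) ?_ ?_).symm
  · exact (Cardinal.lift_le_aleph0.2 (Cardinal.mk_le_aleph0)).trans (Cardinal.aleph0_le_mk ι)
  · simp

variable {V : Type*} [AddCommGroup V] [Module K V]

theorem aeval_conj {W : Type*} [AddCommGroup W] [Module K W] [Module K[X] W]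
    [IsScalarTower K K[X] W] {φ : Module.End K V} {E : V →ₗ[K] W}
    (hφ : ∀ v, E (φ v) = (X : K[X]) • E v) (p : K[X]) (v : V) : E (aeval φ p v) = p • E v := by
  induction p using Polynomial.induction_on' with
  | add p q hp hq => rw [map_add, LinearMap.add_apply, map_add, hp, hq, add_smul]
  | monomial n a =>
    have h1 : ∀ n, E ((φ ^ n) v) = (X : K[X]) ^ n • E v := by
      intro n
      induction n with
      | zero => simp
      | succ n ih => rw [pow_succ', Module.End.mul_apply, hφ, ih, pow_succ', mul_smul]
    rw [aeval_monomial, ← C_mul_X_pow_eq_monomial, mul_smul, Module.End.mul_apply,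
      Module.algebraMap_end_apply, map_smul, h1, ← Polynomial.algebraMap_eq, algebraMap_smul]

/-- `IsC` is a universal condition, so it passes from `W` to any space embedded in `W` compatibly
with the action of `X`. -/
theorem isC_aeval_of_injective {W : Type*} [AddCommGroup W] [Module K W] [Module K[X] W]
    [IsScalarTower K K[X] W] (hW : IsC C W) {φ : Module.End K V} {E : V →ₗ[K] W}
    (hE : Function.Injective E) (hφ : ∀ v, E (φ v) = (X : K[X]) • E v) :
    IsC C (Module.AEval' φ) := by
  refine ⟨fun hd v => ?_, fun hd f hf v hv => ?_⟩
  · obtain ⟨v, rfl⟩ := (Module.AEval'.of φ).surjective v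
    rw [← Module.AEval.of_aeval_smul, LinearEquiv.map_eq_zero_iff]
    apply hE
    change E (aeval φ _ v) = _
    rw [aeval_conj hφ, hW.1 hd, map_zero]
  · obtain ⟨v, rfl⟩ := (Module.AEval'.of φ).surjective v
    rw [← Module.AEval.of_aeval_smul, LinearEquiv.map_eq_zero_iff] at hv ⊢
    have h1 := congrArg E hv
    change E (aeval φ _ v) = _ at h1
    rw [aeval_conj hφ, map_zero] at h1
    apply hE
    change E (aeval φ _ v) = _
    rw [aeval_conj hφ, hW.2 hd f hf _ h1, map_zero]

/-- A `C`-endomorphism of a subspace of infinite codimension can be extended. -/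
theorem exists_extend_endomorphism {W : Type*} [AddCommGroup W] [Module K W] [Module K[X] W]
    [IsScalarTower K K[X] W] (hW : IsC C W) (j : W →ₗ[K] V) (hj : Function.Injective j)
    (hinf : ¬ Module.Finite K (V ⧸ LinearMap.range j)) :
    ∃ φ : Module.End K V, IsC C (Module.AEval' φ) ∧ ∀ w, φ (j w) = j ((X : K[X]) • w) := by
  obtain ⟨U, hU⟩ := Submodule.exists_isCompl (LinearMap.range j)
  have hUinf : ¬ Module.Finite K U := fun h =>
    hinf (Module.Finite.equiv (Submodule.quotientEquivOfIsCompl _ U hU).symm)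
  obtain ⟨P, _, _, _, _, β, _, _, hP, ⟨b⟩⟩ := exists_cyclic_isC C
  let bU := Module.Basis.ofVectorSpace K U
  have : Infinite (Module.Basis.ofVectorSpaceIndex K U) := by
    by_contra h
    rw [not_infinite_iff_finite] at h
    exact hUinf (Module.Finite.of_basis bU)
  obtain ⟨e⟩ := nonempty_equiv_prod_of_countable (Module.Basis.ofVectorSpaceIndex K U) β
  let bP := (Finsupp.basis fun _ : Module.Basis.ofVectorSpaceIndex K U => b).reindex
    ((Equiv.sigmaEquivProd _ _).trans e.symm)
  let EU : U ≃ₗ[K] (Module.Basis.ofVectorSpaceIndex K U →₀ P) := bU.equiv bP (Equiv.refl _)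
  -- A complement of the image of `W` is infinite-dimensional, hence as a vector space a direct sum
  -- of copies of the cyclic module `P`. Multiplication by `X` on the right-hand side is then
  -- transported to `V`.
  let E : V ≃ₗ[K] W × (Module.Basis.ofVectorSpaceIndex K U →₀ P) :=
    (Submodule.prodEquivOfIsCompl _ U hU).symm.trans
      ((LinearEquiv.ofInjective j hj).symm.prodCongr EU)
  have hEj : ∀ w, E (j w) = (w, 0) := by
    intro w
    have h1 : (Submodule.prodEquivOfIsCompl _ U hU).symm (j w) = (⟨j w, w, rfl⟩, 0) := by
      rw [LinearEquiv.symm_apply_eq]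
      simp
    have h2 : (LinearEquiv.ofInjective j hj).symm ⟨j w, w, rfl⟩ = w := by
      rw [LinearEquiv.symm_apply_eq]
      rfl
    simp only [E, LinearEquiv.trans_apply, h1, LinearEquiv.prodCongr_apply, map_zero, h2]
  let φ : Module.End K V := E.symm.toLinearMap ∘ₗ
    (Module.toModuleEnd K (S := K[X]) _ X) ∘ₗ E.toLinearMap
  have hφ : ∀ v, E.toLinearMap (φ v) = (X : K[X]) • E.toLinearMap v := by
    intro v
    simp only [φ, LinearMap.comp_apply, LinearEquiv.coe_coe, LinearEquiv.apply_symm_apply]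
    rfl
  refine ⟨φ, isC_aeval_of_injective (hW.prod hP.finsupp) E.injective hφ, fun w => ?_⟩
  apply E.injective
  refine (hφ _).trans ?_
  change (X : K[X]) • E (j w) = _
  rw [hEj, hEj, Prod.smul_mk, smul_zero]

/-- Extension of a linear map to an injective one of infinite codimension, into a space that is
large enough. -/
theorem exists_extend_injective {W : Type*} [AddCommGroup W] [Module K W] (U : Submodule K W)
    (V₀ : Submodule K V) (j₀ : U →ₗ[K] V) (hj₀ : Function.Injective j₀) (hV₀ : ∀ a, j₀ a ∈ V₀)
    {J : Type u} [Infinite J] (b : J → V) (hb : LinearIndependent K (V₀.mkQ ∘ b))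
    (e : Nonempty (W ↪ J)) :
    ∃ j : W →ₗ[K] V, Function.Injective j ∧ (∀ a : U, j a = j₀ a) ∧
      ¬ Module.Finite K (V ⧸ LinearMap.range j) := by
  obtain ⟨U', hU'⟩ := Submodule.exists_isCompl U
  obtain ⟨e⟩ := e
  let A := Module.Basis.ofVectorSpaceIndex K U'
  let bA : Module.Basis A K U' := Module.Basis.ofVectorSpace K U'
  let eA : A ↪ J := ⟨fun a => e (a : U'), fun a a' h => Subtype.ext (Subtype.ext (e.injective h))⟩
  -- The independent family is split into two halves of full size: one receives a basis of a
  -- complement of `U`, the other stays independent modulo the image and witnesses infinite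
  -- codimension.
  obtain ⟨eJ⟩ : Nonempty (J ⊕ J ≃ J) := by
    rw [← Cardinal.eq, Cardinal.mk_sum, Cardinal.lift_id, Cardinal.add_eq_self]
    exact Cardinal.aleph0_le_mk J
  let e1 : A → J := fun a => eJ (Sum.inl (eA a))
  let e2 : J → J := fun a => eJ (Sum.inr a)
  let jA : U' →ₗ[K] V := bA.constr K (fun a => b (e1 a))
  let W' := Submodule.prodEquivOfIsCompl U U' hU'
  let j : W →ₗ[K] V := j₀.coprod jA ∘ₗ W'.symm.toLinearMap
  have hjA : ∀ v, jA v = Finsupp.linearCombination K (b ∘ e1) (bA.repr v) := by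
    intro v
    simp only [jA, Module.Basis.constr_apply, Finsupp.linearCombination_apply]
    rfl
  -- independence of the two families modulo `V₀`
  have hind : ∀ (c : A →₀ K) (d : J →₀ K), Finsupp.linearCombination K (b ∘ e1) c +
      Finsupp.linearCombination K (b ∘ e2) d ∈ V₀ → c = 0 ∧ d = 0 := by
    intro c d hcd
    have he : Function.Injective (Sum.elim e1 e2) := by
      rintro (x | x) (y | y) hxy
      · exact congrArg _ (eA.injective (Sum.inl_injective (eJ.injective hxy)))
      · exact absurd (eJ.injective hxy) Sum.inl_ne_inr
      · exact absurd (eJ.injective hxy) Sum.inr_ne_inl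
      · exact congrArg _ (Sum.inr_injective (eJ.injective hxy))
    have h1 := hb.comp _ he
    have h2 := linearIndependent_iff.1 h1 (Finsupp.sumFinsuppLEquivProdFinsupp K |>.symm (c, d)) (by
      have h3 : (V₀.mkQ ∘ b) ∘ Sum.elim e1 e2 = V₀.mkQ ∘ Sum.elim (b ∘ e1) (b ∘ e2) := by
        ext (x | x) <;> rfl
      rw [h3]
      have h4 := LinearMap.map_finsupp_linearCombination V₀.mkQ (g := Sum.elim (b ∘ e1) (b ∘ e2))
        ((Finsupp.sumFinsuppLEquivProdFinsupp K).symm (c, d))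
      rw [← h4, Submodule.mkQ_apply, Submodule.Quotient.mk_eq_zero]
      convert hcd using 1
      rw [Finsupp.linearCombination_apply, Finsupp.linearCombination_apply,
        Finsupp.linearCombination_apply]
      change (Finsupp.sumElim c d).sum _ = _
      rw [Finsupp.sum_sumElim]
      rfl)
    have h5 := (LinearEquiv.symm_apply_eq _).1 h2
    rw [map_zero] at h5
    exact Prod.mk.inj h5
  have hjW : ∀ a a', j (W' (a, a')) = j₀ a + jA a' := by
    intro a a'
    simp [j]
  refine ⟨j, ?_, fun a => ?_, fun hfin => ?_⟩
  · rw [injective_iff_map_eq_zero]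
    intro w hw
    obtain ⟨⟨a, a'⟩, rfl⟩ := W'.surjective w
    rw [hjW] at hw
    have h1 := hind (bA.repr a') 0 (by
      rw [map_zero, add_zero, ← hjA, ← neg_eq_of_add_eq_zero_right hw]
      exact V₀.neg_mem (hV₀ a))
    have h2 : a' = 0 := by simpa using h1.1
    subst h2
    rw [map_zero, add_zero] at hw
    have h3 : a = 0 := hj₀ (by rw [hw, map_zero])
    subst h3
    exact map_zero W'
  · have := hjW a 0
    rw [map_zero, add_zero] at this
    rw [← this]
    simp [W']
  · have hli : LinearIndependent K ((LinearMap.range j).mkQ ∘ b ∘ e2) := by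
      rw [linearIndependent_iff]
      intro d hd
      rw [← LinearMap.map_finsupp_linearCombination, Submodule.mkQ_apply,
        Submodule.Quotient.mk_eq_zero] at hd
      obtain ⟨w, hw⟩ := hd
      obtain ⟨⟨a, a'⟩, rfl⟩ := W'.surjective w
      rw [hjW, hjA] at hw
      refine (hind (-bA.repr a') d ?_).2
      rw [← hw, map_neg, add_comm (j₀ a), neg_add_cancel_left]
      exact hV₀ a
    have := hli.finite
    exact not_finite J

end Extension

end

/-! ### Definable vector spaces and elementary embeddings. -/

section

section Spaces

variable {L : FirstOrder.Language.{u, v}} {K : Type k} [Field K] {n : ℕ} {Ω : VecFormulas L K n}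
  {M N : Type*} [L.Structure M] [L.Structure N]

/-- The vector space `V(M)`, with the structure `I`. -/
def VecFormulas.Space.Vec (_I : Ω.Space M) : Type _ := Ω.carrier M

instance (I : Ω.Space M) : AddCommGroup I.Vec := I.group

instance (I : Ω.Space M) : Module K I.Vec := I.module

/-- An elementary embedding induces a linear map between the definable vector spaces. -/
def VecFormulas.Space.map (I : Ω.Space M) (J : Ω.Space N) (f : M ↪ₑ[L] N) :
    I.Vec →ₗ[K] J.Vec where
  toFun x := ⟨f ∘ x.1, (f.map_formula Ω.dom x.1).2 x.2⟩
  map_add' x y := by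
    symm
    refine (J.add_iff _ _ _).1 ?_
    have h := (I.add_iff x y (x + y : I.Vec)).2 rfl
    rw [← f.map_formula] at h
    convert h using 1
    simp only [Sum.comp_elim]
  map_smul' q x := by
    symm
    refine (J.smul_iff q _ _).1 ?_
    have h := (I.smul_iff q x (q • x : I.Vec)).2 rfl
    rw [← f.map_formula] at h
    convert h using 1
    simp only [Sum.comp_elim]

theorem VecFormulas.Space.map_coe (I : Ω.Space M) (J : Ω.Space N) (f : M ↪ₑ[L] N) (x : I.Vec) :
    (I.map J f x).1 = f ∘ x.1 := rfl

theorem VecFormulas.Space.map_injective (I : Ω.Space M) (J : Ω.Space N) (f : M ↪ₑ[L] N) :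
    Function.Injective (I.map J f) := by
  intro x y h
  have h1 := congrArg Subtype.val h
  exact Subtype.ext (funext fun c => f.injective (congrFun h1 c))

theorem VecFormulas.Space.linearIndependent_mkQ_iff (I : Ω.Space M) (J : Ω.Space N)
    (f : M ↪ₑ[L] N) {p : ℕ} (x : Fin p → J.Vec) :
    LinearIndependent K ((LinearMap.range (I.map J f)).mkQ ∘ x) ↔
      ∀ a : Fin p → K, (∃ y : I.Vec, I.map J f y = ∑ j, a j • x j) → a = 0 := by
  rw [Fintype.linearIndependent_iff]
  refine forall_congr' fun a => ?_
  have : ∑ j, a j • ((LinearMap.range (I.map J f)).mkQ ∘ x) j =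
      (LinearMap.range (I.map J f)).mkQ (∑ j, a j • x j) := by
    rw [map_sum]
    exact Finset.sum_congr rfl fun j _ => (map_smul _ _ _).symm
  rw [this, Submodule.mkQ_apply, Submodule.Quotient.mk_eq_zero, LinearMap.mem_range, funext_iff]
  rfl

/-- The definition of independence supplies its own vector space structure `J'`. It agrees with `J`
because the identity, as an elementary embedding, induces a linear map between the two. -/
theorem VecFormulas.LinIndepOver.of_space {f : M ↪ₑ[L] N} {p : ℕ} (I : Ω.Space M) (J : Ω.Space N)
    {x : Fin p → J.Vec} (h : Ω.LinIndepOver f x) :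
    LinearIndependent K ((LinearMap.range (I.map J f)).mkQ ∘ x) := by
  obtain ⟨J', hJ'⟩ := h
  rw [I.linearIndependent_mkQ_iff J f]
  rintro a ⟨y, hy⟩
  refine hJ' a ⟨y.1, y.2, ?_⟩
  let g := J.map J' (ElementaryEmbedding.refl L N)
  have h1 : g (∑ j, a j • x j) = ∑ j, a j • g (x j) := by
    rw [map_sum]
    exact Finset.sum_congr rfl fun j _ => map_smul _ _ _
  rw [← hy] at h1
  exact (congrArg Subtype.val h1).symm

theorem VecFormulas.LinIndepOver.of_linearIndependent {f : M ↪ₑ[L] N} {p : ℕ} (I : Ω.Space M)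
    (J : Ω.Space N) {x : Fin p → J.Vec}
    (h : LinearIndependent K ((LinearMap.range (I.map J f)).mkQ ∘ x)) :
    Ω.LinIndepOver f x := by
  rw [I.linearIndependent_mkQ_iff J f] at h
  exact ⟨J, fun a ⟨y, hy, hxy⟩ => h a ⟨⟨y, hy⟩, Subtype.ext hxy.symm⟩⟩

end Spaces

/-! ### Evaluation of the formulas for terms and their graphs. -/

section Formulas

variable {L : FirstOrder.Language.{u, v}} {K : Type k} {n : ℕ} {γ : Type}

/-- The map on `n`-tuples given by `θ`. -/
def thetaMap (L : FirstOrder.Language.{u, v}) {n : ℕ} {M : Type*} [(withTheta L n).Structure M]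
    (x : Fin n → M) : Fin n → M :=
  fun c => Structure.funMap (L := withTheta L n) (Sum.inr (ThetaFunc.mk c)) x

theorem realize_thetaTerm (t : Fin n → (withTheta L n).Term γ) {M : Type*}
    [(withTheta L n).Structure M] (v : γ → M) :
    (fun c => (thetaTerm t c).realize v) = thetaMap L (fun c => (t c).realize v) := rfl

theorem realize_thetaIter (x : Fin n → γ) (i : ℕ) {M : Type*}
    [(withTheta L n).Structure M] (v : γ → M) :
    (fun c => (thetaIter (L := L) x i c).realize v) = (thetaMap L)^[i] (v ∘ x) := by
  induction i with
  | zero => rfl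
  | succ i ih =>
    rw [Function.iterate_succ_apply', ← ih, ← realize_thetaTerm]
    simp only [thetaIter, Function.iterate_succ_apply']

variable {M : Type*} [L.Structure M] [(withTheta L n).Structure M] [(incl L n).IsExpansionOn M]

section

variable (Ω : VecFormulas L K n)

theorem realize_memV (t : Fin n → (withTheta L n).Term γ) (v : γ → M) :
    (memV Ω t).Realize v ↔ (fun c => (t c).realize v) ∈ Ω.carrier M := by
  refine BoundedFormula.realize_subst.trans ?_
  exact (incl L n).realize_onFormula Ω.dom

theorem realize_allV {ι : Type} [Finite ι] (φ : (withTheta L n).Formula (γ ⊕ (ι × Fin n)))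
    (v : γ → M) : (allV Ω ι φ).Realize v ↔
      ∀ x : ι → Ω.carrier M, φ.Realize (Sum.elim v fun p => (x p.1).1 p.2) := by
  rw [allV, Formula.realize_iAlls]
  simp only [Formula.realize_imp, Formula.realize_iInf, realize_memV, Term.realize_var,
    Sum.elim_inr]
  constructor
  · intro h x
    exact h (fun p => (x p.1).1 p.2) fun i => (x i).2
  · intro h x hx
    exact h fun i => ⟨fun c => x (i, c), hx i⟩

theorem realize_exV {ι : Type} [Finite ι] (φ : (withTheta L n).Formula (γ ⊕ (ι × Fin n)))
    (v : γ → M) : (exV Ω ι φ).Realize v ↔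
      ∃ x : ι → Ω.carrier M, φ.Realize (Sum.elim v fun p => (x p.1).1 p.2) := by
  rw [exV, Formula.realize_iExs]
  simp only [Formula.realize_inf, Formula.realize_iInf, realize_memV, Term.realize_var,
    Sum.elim_inr]
  constructor
  · rintro ⟨x, hx, h⟩
    exact ⟨fun i => ⟨fun c => x (i, c), hx i⟩, h⟩
  · rintro ⟨x, h⟩
    exact ⟨fun p => (x p.1).1 p.2, fun i => (x i).2, h⟩

end

namespace VTerm

variable {V : Type*} [AddCommGroup V] [SMul K V] {β : Type}

/-- The value of a term in a vector space with a map. -/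
def val (φ : V → V) (E : β → V) : VTerm K β → V
  | .var x => E x
  | .zero => 0
  | .add s t => s.val φ E + t.val φ E
  | .smul q t => q • t.val φ E
  | .theta t => φ (t.val φ E)

/-- All variables of the term have the property `P`. -/
def All (P : β → Prop) : VTerm K β → Prop
  | .var x => P x
  | .zero => True
  | .add s t => s.All P ∧ t.All P
  | .smul _ t => t.All P
  | .theta t => t.All P

theorem All.sum {P : β → Prop} {l : List (VTerm K β)} (h : ∀ t ∈ l, t.All P) :
    (VTerm.sum l).All P := by
  induction l with
  | nil => trivial
  | cons a l ih => exact ⟨h a (by simp), ih fun t ht => h t (by simp [ht])⟩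

theorem All.poly {K : Type k} [Field K] {P : β → Prop} (ρ : K[X]) {t : VTerm K β} (h : t.All P) :
    (VTerm.poly ρ t).All P := by
  refine All.sum fun s hs => ?_
  obtain ⟨i, -, rfl⟩ := List.mem_map.1 hs
  change (VTerm.theta^[i] t).All P
  exact Function.Iterate.rec (fun t : VTerm K β => t.All P) (f := VTerm.theta) h (fun _ h => h) i

theorem val_sum (φ : V → V) (E : β → V) (l : List (VTerm K β)) :
    (VTerm.sum l).val φ E = (l.map (val φ E)).sum := by
  induction l with
  | nil => rfl
  | cons a l ih =>
    rw [List.map_cons, List.sum_cons, ← ih]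
    rfl

theorem val_poly {K : Type k} [Field K] {V : Type*} [AddCommGroup V] [Module K V]
    (φ : Module.End K V) (E : β → V) (ρ : K[X]) (t : VTerm K β) :
    (VTerm.poly ρ t).val φ E = aeval φ ρ (t.val φ E) := by
  have h : ∀ i, (VTerm.theta^[i] t).val φ E = (φ ^ i) (t.val φ E) := by
    intro i
    induction i with
    | zero => rfl
    | succ i ih =>
      rw [Function.iterate_succ_apply', pow_succ', Module.End.mul_apply, ← ih]
      rfl
  rw [VTerm.poly, val_sum, List.map_map, aeval_eq_sum_range, LinearMap.sum_apply,
    ← List.sum_toFinset, List.toFinset_range]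
  · refine Finset.sum_congr rfl fun i _ => ?_
    rw [LinearMap.smul_apply, ← h]
    rfl
  · exact List.nodup_range

end VTerm

variable [Field K] {Ω : VecFormulas L K n}

/-- Induction on the term, the intermediate values being the quantified elements of `V`. Only a map
`φ` of sets that agrees with `θ` is assumed, so the lemma can be used to derive the linearity of `θ`
from the axioms. -/
theorem realize_graphV (I : Ω.Space M) {φ : I.Vec → I.Vec} (hφ : ∀ x, (φ x).1 = thetaMap L x.1)
    {v : γ → M} {E : (Fin n → γ) → I.Vec} {t : VTerm K (Fin n → γ)}
    (ht : t.All fun x => (E x).1 = v ∘ x) (y : Fin n → M) :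
    (graphV Ω t).Realize (Sum.elim v y) ↔ y = (t.val φ E).1 := by
  have key : ∀ (t : VTerm K (Fin n → γ)) {ι : Type} (i : ι) (x : ι → Ω.carrier M) (y : Fin n → M),
      ((graphV Ω t).relabel (Sum.elim (Sum.inl ∘ Sum.inl) fun c => Sum.inr (i, c)) :
        (withTheta L n).Formula ((γ ⊕ Fin n) ⊕ (ι × Fin n))).Realize
          (Sum.elim (Sum.elim v y) fun p => (x p.1).1 p.2) ↔
      (graphV Ω t).Realize (Sum.elim v (x i).1) := by
    intro t ι i x y
    rw [Formula.realize_relabel]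
    congr! 1
    ext (a | a) <;> rfl
  have hmem : ∀ y : Fin n → M, (memV Ω fun c : Fin n =>
      (Term.var (Sum.inr c) : (withTheta L n).Term (γ ⊕ Fin n))).Realize (Sum.elim v y) ↔
        y ∈ Ω.carrier M := by
    intro y
    rw [realize_memV]
    rfl
  have hcomm : ∀ (y : Fin n → M) (z : I.Vec), y ∈ Ω.carrier M ∧ (z.1 = y) ↔ y = z.1 :=
    fun y z => ⟨fun h => h.2.symm, fun h => ⟨h ▸ z.2, h.symm⟩⟩
  induction t generalizing y with
  | var x =>
    rw [graphV, Formula.realize_inf, hmem, Formula.realize_iInf]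
    simp only [Formula.realize_equal, Term.realize_var, Sum.elim_inr, Sum.elim_inl]
    have h1 : (E x).1 = v ∘ x := ht
    change _ ↔ y = (E x).1
    rw [← hcomm y (E x), h1]
    refine and_congr_right fun _ => ?_
    rw [funext_iff]
    exact forall_congr' fun c => eq_comm
  | zero =>
    rw [graphV, isZeroV, Formula.realize_inf, hmem]
    change _ ↔ y = (0 : I.Vec).1
    constructor
    · rintro ⟨h1, h2⟩
      have h3 : Ω.zero.Realize y := by
        have := BoundedFormula.realize_subst.1 h2
        exact ((incl L n).realize_onFormula Ω.zero).1 this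
      exact congrArg Subtype.val ((I.zero_iff ⟨y, h1⟩).1 h3)
    · rintro rfl
      refine ⟨(0 : I.Vec).2, BoundedFormula.realize_subst.2 ?_⟩
      exact ((incl L n).realize_onFormula Ω.zero).2 ((I.zero_iff _).2 rfl)
  | add s t hs ht' =>
    rw [graphV, Formula.realize_inf, hmem, realize_exV]
    simp only [Formula.realize_inf, key, Formula.realize_relabel]
    constructor
    · rintro ⟨hy, x, ⟨h1, h2⟩, h3⟩
      replace h1 := (hs ht.1 _).1 h1
      replace h2 := (ht' ht.2 _).1 h2
      rw [LHom.realize_onFormula] at h3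
      have h4 : Ω.add.Realize (Sum.elim (x 0).1 (Sum.elim (x 1).1 y)) := by
        convert h3 using 1
        ext (c | c | c) <;> rfl
      have h5 := (I.add_iff (x 0) (x 1) ⟨y, hy⟩).1 h4
      have h6 : x 0 = s.val φ E := Subtype.ext h1
      have h7 : x 1 = t.val φ E := Subtype.ext h2
      rw [h6, h7] at h5
      exact (congrArg Subtype.val h5).symm
    · rintro rfl
      refine ⟨(VTerm.val (V := I.Vec) φ E _).2, (![s.val φ E, t.val φ E] : Fin 2 → I.Vec),
        ⟨(hs ht.1 _).2 rfl, (ht' ht.2 _).2 rfl⟩,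
        ?_⟩
      rw [LHom.realize_onFormula]
      have := (I.add_iff (s.val (V := I.Vec) φ E) (t.val (V := I.Vec) φ E) _).2 rfl
      convert this using 1
      ext (c | c | c) <;> rfl
  | smul q t ih =>
    rw [graphV, Formula.realize_inf, hmem, realize_exV]
    simp only [Formula.realize_inf, key, Formula.realize_relabel]
    constructor
    · rintro ⟨hy, x, h1, h3⟩
      replace h1 := (ih ht _).1 h1
      rw [LHom.realize_onFormula] at h3
      have h4 : (Ω.smul q).Realize (Sum.elim (x 0).1 y) := by
        convert h3 using 1
        ext (c | c) <;> rfl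
      have h5 := (I.smul_iff q (x 0) ⟨y, hy⟩).1 h4
      have h6 : x 0 = t.val φ E := Subtype.ext h1
      rw [h6] at h5
      exact (congrArg Subtype.val h5).symm
    · rintro rfl
      refine ⟨(VTerm.val (V := I.Vec) φ E _).2, (![t.val φ E] : Fin 1 → I.Vec), (ih ht _).2 rfl, ?_⟩
      rw [LHom.realize_onFormula]
      have := (I.smul_iff q (t.val (V := I.Vec) φ E) _).2 rfl
      convert this using 1
      ext (c | c) <;> rfl
  | theta t ih =>
    rw [graphV, Formula.realize_inf, hmem, realize_exV]
    simp only [Formula.realize_inf, key, Formula.realize_iInf, Formula.realize_equal]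
    have hth : ∀ x : Fin 1 → Ω.carrier M, (∀ c : Fin n,
        Term.realize (Sum.elim (Sum.elim v y) fun p : Fin 1 × Fin n => (x p.1).1 p.2)
          (Term.var (Sum.inl (Sum.inr c)) : (withTheta L n).Term _) =
        Term.realize (Sum.elim (Sum.elim v y) fun p : Fin 1 × Fin n => (x p.1).1 p.2)
          (thetaTerm (fun c' => Term.var (Sum.inr (0, c'))) c : (withTheta L n).Term _)) ↔
        y = thetaMap L (x 0).1 := fun x => by
      rw [funext_iff]
      exact Iff.rfl
    simp only [hth]
    constructor
    · rintro ⟨hy, x, h1, h3⟩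
      replace h1 := (ih ht _).1 h1
      rw [h3, h1, ← hφ]
      rfl
    · rintro rfl
      exact ⟨(VTerm.val (V := I.Vec) φ E _).2, (![t.val φ E] : Fin 1 → I.Vec),
        (ih ht _).2 rfl, hφ _⟩

theorem realize_eqV (I : Ω.Space M) {φ : I.Vec → I.Vec} (hφ : ∀ x, (φ x).1 = thetaMap L x.1)
    {v : γ → M} {E : (Fin n → γ) → I.Vec} {s t : VTerm K (Fin n → γ)}
    (hs : s.All fun x => (E x).1 = v ∘ x) (ht : t.All fun x => (E x).1 = v ∘ x) :
    (eqV Ω s t).Realize v ↔ s.val φ E = t.val φ E := by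
  rw [eqV, Formula.realize_iExs]
  simp only [Formula.realize_inf, realize_graphV I hφ hs, realize_graphV I hφ ht]
  constructor
  · rintro ⟨y, h1, h2⟩
    exact Subtype.ext (h1.symm.trans h2)
  · intro h
    exact ⟨_, rfl, congrArg Subtype.val h⟩

end Formulas

end

/-! ### The axioms as statements about the module `V(M)`. -/

section

theorem all_bvar {L : FirstOrder.Language.{u, v}} {K : Type k} {n : ℕ} {Ω : VecFormulas L K n}
    {M : Type*} [L.Structure M] {γ ι : Type} (v : γ → M) (x : ι → Ω.carrier M) (i : ι) :
    (bvar (K := K) i : VTerm K (Fin n → γ ⊕ (ι × Fin n))).All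
      fun y => (Sum.elim v fun p => (x p.1).1 p.2) ∘ y ∈ Ω.carrier M := (x i).2

section Semantics

variable {L : FirstOrder.Language.{u, v}} {K : Type k} [Field K] {n : ℕ} {Ω : VecFormulas L K n}
  {M : Type*} [L.Structure M]

open Classical in
/-- The assignment of elements of `V` to `n`-tuples of variables given by an assignment of elements
of `M` to the variables. -/
def VecFormulas.Space.env (I : Ω.Space M) {γ : Type} (s : γ → M) (x : Fin n → γ) : I.Vec :=
  if h : s ∘ x ∈ Ω.carrier M then ⟨s ∘ x, h⟩ else 0

theorem VecFormulas.Space.env_eq (I : Ω.Space M) {γ : Type} {s : γ → M} {x : Fin n → γ} {y : I.Vec}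
    (h : s ∘ x = y.1) : I.env s x = y := by
  have : s ∘ x ∈ Ω.carrier M := h ▸ y.2
  exact (dif_pos this).trans (Subtype.ext h)

theorem VecFormulas.Space.env_coe (I : Ω.Space M) {γ : Type} {s : γ → M} {x : Fin n → γ}
    (h : s ∘ x ∈ Ω.carrier M) : (I.env s x).1 = s ∘ x :=
  congrArg Subtype.val (I.env_eq (y := ⟨s ∘ x, h⟩) rfl)

theorem VecFormulas.Space.val_bvar (I : Ω.Space M) {γ ι : Type} (φ : I.Vec → I.Vec) (s : γ → M)
    (x : ι → I.Vec) (i : ι) :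
    (bvar (K := K) (n := n) i).val φ (I.env (Sum.elim s fun p => (x p.1).1 p.2)) = x i :=
  I.env_eq rfl

variable [(withTheta L n).Structure M]

variable (Ω M) in
/-- The vector space `V(M)` with the endomorphism `θ`. -/
structure EndoSpace where
  space : Ω.Space M
  endo : Module.End K space.Vec
  endo_coe : ∀ x, (endo x).1 = thetaMap L x.1
  outside : ∀ x, x ∉ Ω.carrier M → thetaMap L x = (0 : space.Vec).1

namespace EndoSpace

/-- The `K[X]`-module `V(M)` on which `X` acts as `θ`. -/
abbrev Mod (E : EndoSpace Ω M) : Type _ := Module.AEval' E.endo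

def of (E : EndoSpace Ω M) : E.space.Vec ≃ₗ[K] E.Mod := Module.AEval'.of E.endo

/-- The underlying tuple of an element of `V(M)`. -/
def tup (E : EndoSpace Ω M) (x : E.Mod) : Fin n → M := (E.of.symm x).1

theorem tup_of (E : EndoSpace Ω M) (x : E.space.Vec) : E.tup (E.of x) = x.1 := by
  rw [tup, LinearEquiv.symm_apply_apply]

theorem tup_mem (E : EndoSpace Ω M) (x : E.Mod) : E.tup x ∈ Ω.carrier M := (E.of.symm x).2

theorem tup_injective (E : EndoSpace Ω M) : Function.Injective E.tup :=
  fun _ _ h => E.of.symm.injective (Subtype.ext h)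

theorem exists_tup (E : EndoSpace Ω M) {x : Fin n → M} (h : x ∈ Ω.carrier M) :
    ∃ y, E.tup y = x := ⟨E.of ⟨x, h⟩, E.tup_of _⟩

theorem smul_of (E : EndoSpace Ω M) (ρ : K[X]) (x : E.space.Vec) :
    ρ • E.of x = E.of (aeval E.endo ρ x) := (Module.AEval.of_aeval_smul ..).symm

theorem tup_X_smul (E : EndoSpace Ω M) (x : E.Mod) :
    E.tup ((X : K[X]) • x) = thetaMap L (E.tup x) := by
  obtain ⟨x, rfl⟩ := E.of.surjective x
  rw [E.smul_of, aeval_X, tup_of, tup_of, E.endo_coe]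

theorem tup_X_pow_smul (E : EndoSpace Ω M) (i : ℕ) (x : E.Mod) :
    E.tup ((X : K[X]) ^ i • x) = (thetaMap L)^[i] (E.tup x) := by
  induction i with
  | zero => simp
  | succ i ih => rw [pow_succ', mul_smul, tup_X_smul, ih, Function.iterate_succ_apply']

end EndoSpace

variable [(incl L n).IsExpansionOn M]

/-- The assignment `env` takes the value `0` at tuples outside `V`; the hypotheses on the variables
of `s` and `t` ensure that this default is never used. -/
theorem EndoSpace.realize_eqV (E : EndoSpace Ω M) {γ : Type} {v : γ → M}
    {s t : VTerm K (Fin n → γ)} (hs : s.All fun x => v ∘ x ∈ Ω.carrier M)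
    (ht : t.All fun x => v ∘ x ∈ Ω.carrier M) :
    (eqV Ω s t).Realize v ↔ s.val E.endo (E.space.env v) = t.val E.endo (E.space.env v) := by
  have key : ∀ t : VTerm K (Fin n → γ), (t.All fun x => v ∘ x ∈ Ω.carrier M) →
      t.All fun x => (E.space.env v x).1 = v ∘ x := by
    intro t
    induction t with
    | var x => exact fun h => E.space.env_coe h
    | zero => exact id
    | add s t hs ht => exact fun h => ⟨hs h.1, ht h.2⟩
    | smul q t h => exact h
    | theta t h => exact h
  exact VecEndo.realize_eqV E.space E.endo_coe (key s hs) (key t ht)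

/-- `θ` induces an endomorphism of `V(M)` if `M` is a model of `T_θ`. -/
theorem exists_endoSpace {T : L.Theory} (I : Ω.Space M) (h : M ⊨ thetaTheory Ω T) :
    ∃ E : EndoSpace Ω M, E.space = I := by
  rw [Theory.model_iff] at h
  have h1 : M ⊨ thetaMapsSentence Ω := h _ (Or.inl (Or.inr (by simp)))
  have h2 : M ⊨ thetaAddSentence Ω := h _ (Or.inl (Or.inr (by simp)))
  have h3 : M ⊨ thetaOutsideSentence Ω := h _ (Or.inl (Or.inr (by simp)))
  have h4 : ∀ q, M ⊨ thetaSMulSentence Ω q := fun q => h _ (Or.inr ⟨q, rfl⟩)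
  have h1' : ∀ x ∈ Ω.carrier M, thetaMap L x ∈ Ω.carrier M := by
    intro x hx
    have := (realize_memV Ω _ _).1 ((realize_allV Ω _ _).1 h1 fun _ => ⟨x, hx⟩)
    exact this
  -- So far only a map of sets. The additivity and scalar axioms are evaluated with this map and say
  -- that it is linear.
  let φ : I.Vec → I.Vec := fun x => ⟨thetaMap L x.1, h1' _ x.2⟩
  have hφ : ∀ x, (φ x).1 = thetaMap L x.1 := fun _ => rfl
  have hb : ∀ {ι : Type} (x : ι → I.Vec) (i : ι),
      (bvar i : VTerm K (Fin n → Empty ⊕ (ι × Fin n))).All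
        fun y => (I.env (Sum.elim default fun p => (x p.1).1 p.2) y).1 =
          (Sum.elim default fun p => (x p.1).1 p.2) ∘ y :=
    fun x i => I.env_coe (x i).2
  refine ⟨⟨I, ⟨⟨φ, fun x y => ?_⟩, fun q x => ?_⟩, hφ, fun x hx => ?_⟩, rfl⟩
  · have := (realize_eqV I hφ (E := I.env _)
      (by exact ⟨hb ![x, y] 0, hb ![x, y] 1⟩) (by exact ⟨hb ![x, y] 0, hb ![x, y] 1⟩)).1
      ((realize_allV Ω _ _).1 h2 (![x, y] : Fin 2 → I.Vec))
    simp only [VTerm.val, I.val_bvar φ _ (![x, y])] at this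
    exact this
  · have := (realize_eqV I hφ (E := I.env _) (by exact hb ![x] 0) (by exact hb ![x] 0)).1
      ((realize_allV Ω _ _).1 (h4 q) (![x] : Fin 1 → I.Vec))
    simp only [VTerm.val, I.val_bvar φ _ (![x])] at this
    exact this
  · have := (Formula.realize_iAlls.1 h3) x
    rw [Formula.realize_imp, Formula.realize_not, realize_memV] at this
    have h5 := this hx
    rw [isZeroV, Formula.realize_inf, realize_memV] at h5
    obtain ⟨h6, h7⟩ := h5
    have h8 := ((incl L n).realize_onFormula Ω.zero).1 (BoundedFormula.realize_subst.1 h7)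
    exact congrArg Subtype.val ((I.zero_iff ⟨_, h6⟩).1 h8)

theorem EndoSpace.models_thetaTheory {T : L.Theory} (E : EndoSpace Ω M) (hT : M ⊨ T) :
    M ⊨ thetaTheory Ω T := by
  rw [Theory.model_iff]
  rintro φ ((hφ | hφ) | ⟨q, rfl⟩)
  · exact (Theory.model_iff _).1 (((incl L n).onTheory_model T).2 hT) φ hφ
  · rcases hφ with rfl | rfl | rfl
    · refine (realize_allV Ω _ _).2 fun x => (realize_memV Ω _ _).2 ?_
      exact Set.mem_of_eq_of_mem (E.endo_coe (x 0 : E.space.Vec)).symm (E.endo (x 0)).2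
    · refine (realize_allV Ω _ _).2 fun x => (E.realize_eqV ?_ ?_).2 ?_
      · exact ⟨all_bvar _ x 0, all_bvar _ x 1⟩
      · exact ⟨all_bvar _ x 0, all_bvar _ x 1⟩
      · exact E.endo.map_add _ _
    · refine Formula.realize_iAlls.2 fun x => ?_
      rw [Formula.realize_imp, Formula.realize_not, realize_memV, isZeroV, Formula.realize_inf,
        realize_memV]
      intro hx
      have hx0 : thetaMap L x = (0 : E.space.Vec).1 := E.outside x hx
      have h1 : (fun c => (thetaTerm (fun c => Term.var (Sum.inr c) :
          Fin n → (withTheta L n).Term (Empty ⊕ Fin n)) c).realize (fun a => Sum.elim default x a))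
          = (0 : E.space.Vec).1 := hx0
      refine ⟨?_, BoundedFormula.realize_subst.2 ?_⟩
      · rw [h1]
        exact (0 : E.space.Vec).2
      · rw [h1]
        exact ((incl L n).realize_onFormula Ω.zero).2 ((E.space.zero_iff _).2 rfl)
  · refine (realize_allV Ω _ _).2 fun x => (E.realize_eqV ?_ ?_).2 ?_
    · exact all_bvar _ x 0
    · exact all_bvar _ x 0
    · exact E.endo.map_smul _ _

namespace EndoSpace

variable (E : EndoSpace Ω M)

theorem realize_poly_eq_zero {γ : Type} (v : γ → M) (ρ : K[X]) (x : Fin 1 → E.space.Vec) :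
    (eqV Ω (.poly ρ (bvar 0)) .zero : (withTheta L n).Formula (γ ⊕ (Fin 1 × Fin n))).Realize
      (Sum.elim v fun p => (x p.1).1 p.2) ↔ ρ • E.of (x 0) = 0 := by
  rw [E.realize_eqV (VTerm.All.poly _ (all_bvar v x 0)) (t := .zero) trivial, VTerm.val_poly,
    E.space.val_bvar, E.smul_of, LinearEquiv.map_eq_zero_iff]
  rfl

theorem realize_kerAll (ρ : K[X]) :
    M ⊨ (kerAllSentence Ω ρ : (withTheta L n).Sentence) ↔ ∀ x : E.Mod, ρ • x = 0 := by
  refine (realize_allV Ω _ _).trans ?_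
  rw [E.of.surjective.forall]
  constructor
  · intro h x
    exact (E.realize_poly_eq_zero _ ρ fun _ => x).1 (h fun _ => x)
  · intro h x
    exact (E.realize_poly_eq_zero _ ρ x).2 (h (x 0))

theorem realize_kerEq (ρ₁ ρ₂ : K[X]) :
    M ⊨ (kerEqSentence Ω ρ₁ ρ₂ : (withTheta L n).Sentence) ↔
      ∀ x : E.Mod, ρ₁ • x = 0 ↔ ρ₂ • x = 0 := by
  refine (realize_allV Ω _ _).trans ?_
  rw [E.of.surjective.forall]
  constructor
  · intro h x
    have := h fun _ => x
    rw [Formula.realize_iff, E.realize_poly_eq_zero _ ρ₁ fun _ => x,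
      E.realize_poly_eq_zero _ ρ₂ fun _ => x] at this
    exact this
  · intro h x
    rw [Formula.realize_iff, E.realize_poly_eq_zero _ ρ₁ x, E.realize_poly_eq_zero _ ρ₂ x]
    exact h (x 0)

theorem realize_imEq (ρ₁ ρ₂ : K[X]) :
    M ⊨ (imEqSentence Ω ρ₁ ρ₂ : (withTheta L n).Sentence) ↔
      ∀ x : E.Mod, (∃ y : E.Mod, ρ₁ • y = x) ↔ ∃ y : E.Mod, ρ₂ • y = x := by
  have key : ∀ (ρ : K[X]) (x : Fin 1 → E.space.Vec),
      (exV Ω (Fin 1) (eqV Ω (.poly ρ (bvar 0)) (.var fun c => Sum.inl (Sum.inr (0, c)))) :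
        (withTheta L n).Formula (Empty ⊕ (Fin 1 × Fin n))).Realize
          (Sum.elim default fun p => (x p.1).1 p.2) ↔ ∃ y : E.Mod, ρ • y = E.of (x 0) := by
    intro ρ x
    rw [realize_exV, E.of.surjective.exists]
    have h1 : ∀ y : Fin 1 → E.space.Vec, (eqV Ω (.poly ρ (bvar 0))
        (.var fun c => Sum.inl (Sum.inr (0, c))) : (withTheta L n).Formula
          ((Empty ⊕ (Fin 1 × Fin n)) ⊕ (Fin 1 × Fin n))).Realize
        (Sum.elim (Sum.elim default fun p => (x p.1).1 p.2) fun p => (y p.1).1 p.2) ↔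
        ρ • E.of (y 0) = E.of (x 0) := by
      intro y
      rw [E.realize_eqV (VTerm.All.poly _ (all_bvar _ y 0)) (by exact (x 0).2), VTerm.val_poly,
        E.space.val_bvar, E.smul_of, E.of.injective.eq_iff]
      exact Iff.of_eq (congrArg _ (E.space.env_eq rfl))
    constructor
    · rintro ⟨y, hy⟩
      exact ⟨y 0, (h1 y).1 hy⟩
    · rintro ⟨y, hy⟩
      exact ⟨fun _ => y, (h1 fun _ => y).2 hy⟩
  refine (realize_allV Ω _ _).trans ?_
  rw [E.of.surjective.forall]
  constructor
  · intro h x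
    have := h fun _ => x
    rw [Formula.realize_iff, key _ fun _ => x, key _ fun _ => x] at this
    exact this
  · intro h x
    rw [Formula.realize_iff, key _ x, key _ x]
    exact h (x 0)

/-- Of each equality of kernels only one inclusion has content, as `Ker f ^ C(f)` is always
contained in `Ker f ^ (C(f) + 1)`. The same happens with the reverse inclusion for images in the
next lemma. -/
theorem models_configTheory_iff {T : L.Theory} (C : KernelConfig K) (hT : M ⊨ T) :
    M ⊨ configTheory Ω T C ↔ IsC C E.Mod := by
  have hker : ∀ f : IrrPoly K, (M ⊨ (kerEqSentence Ω (f.1 ^ C.exp f) (f.1 ^ (C.exp f + 1)) :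
      (withTheta L n).Sentence)) ↔
      ∀ v : E.Mod, f.1 ^ (C.exp f + 1) • v = 0 → f.1 ^ C.exp f • v = 0 := by
    intro f
    rw [E.realize_kerEq]
    refine forall_congr' fun x => ⟨fun h => h.2, fun h => ⟨fun h1 => ?_, h⟩⟩
    rw [pow_succ', mul_smul, h1, smul_zero]
  constructor
  · intro h
    rw [Theory.model_iff] at h
    refine ⟨fun hd => ?_, fun hd f hf => ?_⟩
    · rw [← E.realize_kerAll]
      exact h _ (Or.inr (Or.inl ⟨hd, rfl⟩))
    · rw [← hker]
      exact h _ (Or.inr (Or.inr ⟨hd, f, hf, rfl⟩))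
  · intro h
    rw [Theory.model_iff]
    rintro φ (hφ | (⟨hd, rfl⟩ | ⟨hd, f, hf, rfl⟩))
    · exact (Theory.model_iff _).1 (E.models_thetaTheory hT) φ hφ
    · exact (E.realize_kerAll _).2 (h.1 hd)
    · exact (hker f).2 (h.2 hd f hf)

theorem models_imageCompleteSentences_iff (C : KernelConfig K) :
    M ⊨ (imageCompleteSentences Ω C : (withTheta L n).Theory) ↔ IsImageComplete C E.Mod := by
  have him : ∀ f : IrrPoly K, (M ⊨ (imEqSentence Ω (f.1 ^ (C.exp f + 1)) (f.1 ^ C.exp f) :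
      (withTheta L n).Sentence)) ↔
      ∀ v : E.Mod, ∃ v' : E.Mod, f.1 ^ (C.exp f + 1) • v' = f.1 ^ C.exp f • v := by
    intro f
    rw [E.realize_imEq]
    constructor
    · exact fun h v => (h _).2 ⟨v, rfl⟩
    · refine fun h x => ⟨?_, ?_⟩
      · rintro ⟨y, rfl⟩
        exact ⟨f.1 • y, by rw [← mul_smul, ← pow_succ]⟩
      · rintro ⟨y, rfl⟩
        exact h y
  rw [Theory.model_iff]
  constructor
  · exact fun h f hf => (him f).1 (h _ ⟨f, hf, rfl⟩)
  · rintro h _ ⟨f, hf, rfl⟩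
    exact (him f).2 (h f hf)

theorem realize_delta {C : KernelConfig K} (S : SeqSystem C) {γ : Type} (v : γ → M)
    (y : S.Par → E.space.Vec) : (S.delta Ω bvar : (withTheta L n).Formula _).Realize
      (Sum.elim v fun p => (y p.1).1 p.2) ↔ S.IsAdmissible fun i => E.of (y i) := by
  rw [SeqSystem.delta, Formula.realize_iInf]
  refine forall_congr' fun k => ?_
  rw [E.realize_eqV (VTerm.All.poly _ (all_bvar v y _)) (t := .zero) trivial, VTerm.val_poly,
    E.space.val_bvar, E.smul_of, LinearEquiv.map_eq_zero_iff]
  rfl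

theorem realize_seqSystem {C : KernelConfig K} (S : SeqSystem C) {γ : Type} (v : γ → M)
    (y : S.Par → E.space.Vec) (x : S.Var → E.space.Vec) :
    (S.formula Ω bvar (fun i => .var fun c => Sum.inl (Sum.inr (i, c))) :
      (withTheta L n).Formula ((γ ⊕ (S.Par × Fin n)) ⊕ (S.Var × Fin n))).Realize
        (Sum.elim (Sum.elim v fun p => (y p.1).1 p.2) fun p => (x p.1).1 p.2) ↔
      S.IsSolution LinearMap.id (fun i => E.of (y i)) fun z => E.of (x z) := by
  rw [SeqSystem.formula, Formula.realize_inf, Formula.realize_iInf, Formula.realize_iInf]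
  refine and_congr (forall_congr' fun k => ?_) (forall_congr' fun k => ?_)
  · have hsum : (VTerm.sum (List.ofFn fun l => VTerm.poly (S.P k l)
        (bvar (SeqSystem.Var.li l) : VTerm K (Fin n → (γ ⊕ (S.Par × Fin n)) ⊕ (S.Var × Fin n))))).All
          fun w => (Sum.elim (Sum.elim v fun p => (y p.1).1 p.2) fun p => (x p.1).1 p.2) ∘ w ∈
            Ω.carrier M := by
      refine VTerm.All.sum fun t ht => ?_
      obtain ⟨l, rfl⟩ := (List.mem_ofFn' _ _).1 ht
      exact VTerm.All.poly _ (all_bvar _ x _)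
    rw [E.realize_eqV (VTerm.All.poly _ (all_bvar _ x _)) (by exact ⟨hsum, (y (.ld k)).2⟩),
      VTerm.val_poly, E.space.val_bvar, E.smul_of]
    simp only [VTerm.val, VTerm.val_sum, List.map_ofFn, List.sum_ofFn, Function.comp_def,
      VTerm.val_poly, E.space.val_bvar, E.smul_of, LinearMap.id_apply, ← map_sum, ← map_add]
    rw [E.of.injective.eq_iff]
    exact Iff.of_eq (congrArg _ (congrArg _ (E.space.env_eq rfl)))
  · rw [E.realize_eqV (VTerm.All.poly _ (all_bvar _ x _)) (by exact (y (.ke k)).2), VTerm.val_poly,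
      E.space.val_bvar, E.smul_of, LinearMap.id_apply, E.of.injective.eq_iff]
    exact Iff.of_eq (congrArg _ (E.space.env_eq rfl))

/-- Since `X ^ i` acts as `θ^i`, replacing placeholders by terms amounts to evaluating `ψ` at the
underlying tuples of the monomials `X ^ i • x`. -/
theorem realize_existsSolution {C : KernelConfig K} (S : SeqSystem C) {p q : ℕ}
    (e : Fin p → S.Var × ℕ) (ψ : L.Formula ((Fin p × Fin n) ⊕ Fin q)) (z : Fin q → M)
    (y : S.Par → E.space.Vec) :
    (exV Ω S.Var (BoundedFormula.subst ((incl L n).onFormula ψ)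
        (Sum.elim (fun j => thetaIter (fun c => Sum.inr ((e j.1).1, c)) (e j.1).2 j.2)
          (fun i => Term.var (Sum.inl (Sum.inl (Sum.inr i))))) ⊓
      S.formula Ω bvar (fun i => .var fun c => Sum.inl (Sum.inr (i, c)))) :
        (withTheta L n).Formula ((Empty ⊕ Fin q) ⊕ (S.Par × Fin n))).Realize
      (Sum.elim (Sum.elim default z) fun p => (y p.1).1 p.2) ↔
    ∃ x : S.Var → E.Mod, S.IsSolution LinearMap.id (fun i => E.of (y i)) x ∧
      ψ.Realize (Sum.elim (fun j => E.tup ((X : K[X]) ^ (e j.1).2 • x (e j.1).1) j.2) z) := by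
  rw [realize_exV, (E.of.surjective.comp_left (α := S.Var)).exists]
  refine exists_congr fun x => ?_
  rw [Formula.realize_inf, and_comm, E.realize_seqSystem S _ y x]
  refine and_congr Iff.rfl ?_
  refine BoundedFormula.realize_subst.trans ?_
  refine ((incl L n).realize_onFormula ψ).trans ?_
  congr! 1
  ext (⟨j, c⟩ | i)
  · simp only [Sum.elim_inl]
    have h1 : E.tup ((X : K[X]) ^ (e j).2 • E.of (x (e j).1)) =
        (thetaMap L)^[(e j).2] (x (e j).1).1 :=
      (E.tup_X_pow_smul (e j).2 (E.of (x (e j).1))).trans (congrArg _ (E.tup_of _))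
    refine Eq.trans ?_ (congrFun h1 c).symm
    exact congrFun (realize_thetaIter (L := L) (fun c => Sum.inr ((e j).1, c)) (e j).2 _) c
  · rfl

theorem realize_companionSentence {C : KernelConfig K} (S : SeqSystem C) {p q : ℕ}
    (e : Fin p → S.Var × ℕ) (ψ : L.Formula ((Fin p × Fin n) ⊕ Fin q)) (σ : L.Formula (Fin q)) :
    M ⊨ S.companionSentence Ω e ψ σ ↔ ∀ (z : Fin q → M) (y : S.Par → E.Mod), σ.Realize z →
      S.IsAdmissible y → ∃ x : S.Var → E.Mod, S.IsSolution LinearMap.id y x ∧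
        ψ.Realize (Sum.elim (fun j => E.tup ((X : K[X]) ^ (e j.1).2 • x (e j.1).1) j.2) z) := by
  refine Formula.realize_iAlls.trans (forall_congr' fun z => ?_)
  rw [realize_allV, (E.of.surjective.comp_left (α := S.Par)).forall]
  refine forall_congr' fun y => ?_
  rw [Formula.realize_imp, Formula.realize_inf, Formula.realize_relabel, LHom.realize_onFormula,
    E.realize_delta S _ y, and_imp]
  exact imp_congr Iff.rfl (imp_congr Iff.rfl (E.realize_existsSolution S e ψ z y))

end EndoSpace

end Semantics

end

/-! ### Embeddings that respect `θ`, and large elementary extensions. -/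

section

theorem theta_comm_of_embedding {L : FirstOrder.Language.{u, v}} {n : ℕ} {M N : Type*}
    [(withTheta L n).Structure M] [(withTheta L n).Structure N] (f : M ↪[withTheta L n] N)
    (x : Fin n → M) : thetaMap L (f ∘ x) = f ∘ thetaMap L x :=
  funext fun _ => (f.map_fun _ x).symm

section Maps

variable {L : FirstOrder.Language.{u, v}} {K : Type k} [Field K] {n : ℕ} {Ω : VecFormulas L K n}
  {M N : Type*} [L.Structure M] [L.Structure N] [(withTheta L n).Structure M]
  [(withTheta L n).Structure N]

namespace EndoSpace

/-- The linear map induced by an `L`-elementary embedding. -/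
def map (E : EndoSpace Ω M) (F : EndoSpace Ω N) (f : M ↪ₑ[L] N) : E.Mod →ₗ[K] F.Mod :=
  F.of.toLinearMap ∘ₗ E.space.map F.space f ∘ₗ E.of.symm.toLinearMap

theorem tup_map (E : EndoSpace Ω M) (F : EndoSpace Ω N) (f : M ↪ₑ[L] N) (x : E.Mod) :
    F.tup (E.map F f x) = f ∘ E.tup x := F.tup_of _

theorem map_injective (E : EndoSpace Ω M) (F : EndoSpace Ω N) (f : M ↪ₑ[L] N) :
    Function.Injective (E.map F f) :=
  F.of.injective.comp ((E.space.map_injective F.space f).comp E.of.symm.injective)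

end EndoSpace

/-- A `K`-linear map that commutes with `X` is `K[X]`-linear. -/
def linearMapOfX {A B : Type*} [AddCommGroup A] [AddCommGroup B] [Module K A] [Module K B]
    [Module K[X] A] [Module K[X] B] [IsScalarTower K K[X] A] [IsScalarTower K K[X] B]
    (g : A →ₗ[K] B) (hg : ∀ a, g ((X : K[X]) • a) = (X : K[X]) • g a) : A →ₗ[K[X]] B where
  toFun := g
  map_add' := g.map_add
  map_smul' p a := by
    have h1 := aeval_conj (φ := Module.toModuleEnd K (S := K[X]) A X) (E := g) hg p a
    have h2 := aeval_conj (φ := Module.toModuleEnd K (S := K[X]) A X)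
      (E := (LinearMap.id : A →ₗ[K] A)) (fun _ => rfl) p a
    rw [LinearMap.id_apply, LinearMap.id_apply] at h2
    rw [RingHom.id_apply, ← h1, h2]

namespace EndoSpace

/-- The `K[X]`-linear map induced by an `L`-elementary embedding that commutes with `θ` on `V`. -/
def mapX (E : EndoSpace Ω M) (F : EndoSpace Ω N) (f : M ↪ₑ[L] N)
    (hf : ∀ x ∈ Ω.carrier M, thetaMap L (f ∘ x) = f ∘ thetaMap L x) : E.Mod →ₗ[K[X]] F.Mod :=
  linearMapOfX (E.map F f) fun x => F.tup_injective (by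
    rw [E.tup_map, E.tup_X_smul, F.tup_X_smul, E.tup_map, hf _ (E.tup_mem x)])

theorem mapX_apply (E : EndoSpace Ω M) (F : EndoSpace Ω N) (f : M ↪ₑ[L] N)
    (hf : ∀ x ∈ Ω.carrier M, thetaMap L (f ∘ x) = f ∘ thetaMap L x) (x : E.Mod) :
    E.mapX F f hf x = E.map F f x := rfl

/-- An `L`-elementary embedding that commutes with `θ` on `V` commutes with `θ`. -/
theorem theta_comm (E : EndoSpace Ω M) (F : EndoSpace Ω N) (f : M ↪ₑ[L] N)
    (hf : ∀ x ∈ Ω.carrier M, thetaMap L (f ∘ x) = f ∘ thetaMap L x) (x : Fin n → M) :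
    thetaMap L (f ∘ x) = f ∘ thetaMap L x := by
  by_cases hx : x ∈ Ω.carrier M
  · exact hf x hx
  -- Outside `V` both sides are the zero of `V`, which an elementary embedding preserves.
  · have hx' : f ∘ x ∉ Ω.carrier N := fun h => hx ((f.map_formula Ω.dom x).1 h)
    rw [E.outside x hx, F.outside _ hx', ← E.space.map_coe F.space f, map_zero]

end EndoSpace

variable [(incl L n).IsExpansionOn M] [(incl L n).IsExpansionOn N]

theorem funMap_inl {k : ℕ} (F : L.Functions k) (x : Fin k → M) :
    Structure.funMap (L := withTheta L n) (Sum.inl F : (withTheta L n).Functions k) x =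
      Structure.funMap F x :=
  LHom.IsExpansionOn.map_onFunction (ϕ := incl L n) F x

theorem relMap_inl {k : ℕ} (R : L.Relations k) (x : Fin k → M) :
    Structure.RelMap (L := withTheta L n) (Sum.inl R : (withTheta L n).Relations k) x ↔
      Structure.RelMap R x :=
  Iff.of_eq (LHom.IsExpansionOn.map_onRelation (ϕ := incl L n) R x)

/-- The `L`-embedding underlying an embedding. -/
def reductEmbedding (f : M ↪[withTheta L n] N) : M ↪[L] N where
  toFun := f
  inj' := f.injective
  map_fun' {k} F x := by
    rw [← funMap_inl (n := n) F x, ← funMap_inl (n := n) F]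
    exact f.map_fun _ x
  map_rel' {k} R x := by
    rw [← relMap_inl (n := n) R x, ← relMap_inl (n := n) R]
    exact f.map_rel (Sum.inl R : (withTheta L n).Relations k) x

/-- The `L`-elementary embedding underlying an elementary embedding. -/
def reductElementary (f : M ↪ₑ[withTheta L n] N) : M ↪ₑ[L] N where
  toFun := f
  map_formula' m φ x := by
    rw [← (incl L n).realize_onFormula φ, ← (incl L n).realize_onFormula φ]
    exact f.map_formula _ x

/-- An `L`-embedding that commutes with `θ` is an embedding. -/
def embeddingOfTheta (f : M ↪[L] N)
    (hf : ∀ x : Fin n → M, thetaMap L (f ∘ x) = f ∘ thetaMap L x) : M ↪[withTheta L n] N where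
  toFun := f
  inj' := f.injective
  map_fun' {k} F x := by
    rcases F with F | F
    · refine (congrArg f (funMap_inl F x)).trans ((f.map_fun F x).trans ?_)
      exact (funMap_inl F (f ∘ x)).symm
    · cases F with
      | mk c => exact (congrFun (hf x) c).symm
  map_rel' {k} R x := by
    rcases R with R | R
    · exact (relMap_inl R (f ∘ x)).trans ((f.map_rel R x).trans (relMap_inl R x).symm)
    · exact R.elim

end Maps

section Large

variable {L : FirstOrder.Language.{u, v}} {K : Type k} {n : ℕ} {Ω : VecFormulas L K n}

/-- An infinite definable set of tuples becomes arbitrarily large in elementary extensions. -/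
theorem exists_elementary_carrier_large {N : Type (max u v w)} [L.Structure N] [Nonempty N]
    (hN : (Ω.carrier N).Infinite) (α : Type (max u v w)) :
    ∃ (N' : Type (max u v w)) (_ : L.Structure N') (_ : N ↪ₑ[L] N'),
      Nonempty (α ↪ Ω.carrier N') := by
  classical
  let D : α → L.Formula (N ⊕ (α × Fin n)) := fun a => Ω.dom.relabel fun c => Sum.inr (a, c)
  let Q : α → α → L.Formula (N ⊕ (α × Fin n)) := fun a b =>
    (Formula.iInf fun c : Fin n =>
      Term.equal (Term.var (Sum.inr (a, c))) (Term.var (Sum.inr (b, c)))).not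
  have hD : ∀ (P : Type (max u v w)) [L.Structure P] (g : N → P) (s : α × Fin n → P) (a : α),
      (D a).Realize (Sum.elim g s) ↔ (fun c => s (a, c)) ∈ Ω.carrier P := by
    intro P _ g s a
    rw [Formula.realize_relabel]
    rfl
  have hQ : ∀ (P : Type (max u v w)) [L.Structure P] (g : N → P) (s : α × Fin n → P) (a b : α),
      (Q a b).Realize (Sum.elim g s) ↔ (fun c => s (a, c)) ≠ fun c => s (b, c) := by
    intro P _ g s a b
    rw [Formula.realize_not, Formula.realize_iInf, Ne, funext_iff]
    simp only [Formula.realize_equal, Term.realize_var, Sum.elim_inr]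
  -- Asks for pairwise distinct elements of `V` indexed by `α`; finitely many of these conditions
  -- can be met in `N` because `V(N)` is infinite.
  let Γ : Set (L.Formula (N ⊕ (α × Fin n))) := {φ | ∃ a b, φ = D a ∨ (a ≠ b ∧ φ = Q a b)}
  obtain ⟨N', _, g, s, hs⟩ := exists_elementary_realize_of_finset.{u, v, w} (M := N) Γ (by
    intro Δ hΔ
    rcases isEmpty_or_nonempty α with _ | _
    · refine ⟨N, inferInstance, ElementaryEmbedding.refl L N, fun p => isEmptyElim p.1,
        fun φ hφ => ?_⟩
      obtain ⟨a, -⟩ := hΔ φ hφ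
      exact isEmptyElim a
    choose! a b hab using hΔ
    let A : Finset α := Δ.image a ∪ Δ.image b
    have := hN.to_subtype
    obtain ⟨x⟩ : Nonempty (A ↪ Ω.carrier N) := by
      let e := Infinite.natEmbedding (Ω.carrier N)
      exact ⟨((A.equivFin.toEmbedding).trans Fin.valEmbedding).trans e⟩
    obtain ⟨x0⟩ : Nonempty (Ω.carrier N) := inferInstance
    let y : α → Ω.carrier N := fun a => if ha : a ∈ A then x ⟨a, ha⟩ else x0
    refine ⟨N, inferInstance, ElementaryEmbedding.refl L N, fun p => (y p.1).1 p.2,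
      fun φ hφ => ?_⟩
    rcases hab φ hφ with h | ⟨hne, h⟩
    · rw [h]
      exact (hD N _ _ _).2 (y (a φ)).2
    · rw [h]
      refine (hQ N _ _ _ _).2 fun h1 => hne ?_
      have ha : a φ ∈ A := Finset.mem_union_left _ (Finset.mem_image_of_mem _ hφ)
      have hb : b φ ∈ A := Finset.mem_union_right _ (Finset.mem_image_of_mem _ hφ)
      have h2 : y (a φ) = y (b φ) := Subtype.ext h1
      simp only [y, dif_pos ha, dif_pos hb] at h2
      exact congrArg Subtype.val (x.injective h2))
  refine ⟨N', inferInstance, g, ⟨⟨fun a => ⟨fun c => s (a, c), ?_⟩, fun a b hab => ?_⟩⟩⟩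
  · exact (hD N' g s a).1 (hs _ ⟨a, a, Or.inl rfl⟩)
  · by_contra hne
    exact (hQ N' g s a b).1 (hs _ ⟨a, b, Or.inr ⟨hne, rfl⟩⟩) (congrArg Subtype.val hab)

variable [Field K]

/-- A vector space that is large compared to a subspace contains a large family that is independent
over the subspace. -/
theorem exists_large_independent {V : Type w} [AddCommGroup V] [Module K V] (V₀ : Submodule K V)
    {J : Type w} [Infinite J] (eK : K ↪ J) (e₀ : V₀ ↪ J) (e : Set J ↪ V) :
    ∃ b : J → V, LinearIndependent K (V₀.mkQ ∘ b) := by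
  let B := Module.Basis.ofVectorSpace K (V ⧸ V₀)
  -- Either a basis of the quotient is long enough to lift a family indexed by `J`, or it embeds
  -- into `J`. In the latter case `K`, `V₀` and `V/V₀` all have at most `|J|` elements, hence so
  -- does `V`, contradicting Cantor's theorem.
  rcases Function.Embedding.total J (Module.Basis.ofVectorSpaceIndex K (V ⧸ V₀)) with ⟨⟨i⟩⟩ | ⟨⟨i⟩⟩
  · choose b hb using fun j => V₀.mkQ_surjective (B (i j))
    refine ⟨b, ?_⟩
    have : V₀.mkQ ∘ b = B ∘ i := funext hb
    rw [this]
    exact B.linearIndependent.comp i i.injective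
  · exfalso
    have h1 : Nonempty ((V ⧸ V₀) ↪ Finset (J × J)) :=
      ⟨(B.repr.toEquiv.toEmbedding.trans ⟨Finsupp.graph, Finsupp.graph_injective _ _⟩).trans
        (Finset.mapEmbedding (i.prodMap eK)).toEmbedding⟩
    have h2 : Nonempty (Finset (J × J) ↪ J) := by
      rw [← Cardinal.le_def, Cardinal.mk_finset_of_infinite, Cardinal.mk_prod, Cardinal.lift_id,
        Cardinal.mul_mk_eq_max, max_self]
    have h3 : Nonempty (J × J ↪ J) := by
      rw [← Cardinal.le_def, Cardinal.mk_prod, Cardinal.lift_id, Cardinal.mul_mk_eq_max, max_self]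
    have h4 : Nonempty (V ↪ V₀ × (V ⧸ V₀)) := by
      refine ⟨⟨fun x => (⟨x - Function.surjInv V₀.mkQ_surjective (V₀.mkQ x), ?_⟩, V₀.mkQ x), ?_⟩⟩
      · exact (Submodule.Quotient.eq V₀).1 (Function.surjInv_eq V₀.mkQ_surjective (V₀.mkQ x)).symm
      · intro x x' h
        rw [Prod.mk.injEq, Subtype.mk.injEq] at h
        rw [h.2] at h
        exact sub_left_injective h.1
    obtain ⟨h1⟩ := h1
    obtain ⟨h2⟩ := h2
    obtain ⟨h3⟩ := h3
    obtain ⟨h4⟩ := h4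
    exact Function.cantor_injective _
      (((e.trans h4).trans (e₀.prodMap (h1.trans h2))).trans h3).injective

/-- The structure on `N` in which `θ` is the given endomorphism. -/
theorem exists_thetaStructure {N : Type*} [L.Structure N] (I : Ω.Space N)
    (φ : Module.End K I.Vec) {C : KernelConfig K} (hφ : IsC C (Module.AEval' φ)) :
    ∃ (_ : (withTheta L n).Structure N) (_ : (incl L n).IsExpansionOn N) (E : EndoSpace Ω N),
      IsC C E.Mod ∧ (∀ x : I.Vec, thetaMap L x.1 = (φ x).1) ∧ E.space = I := by
  classical
  let th : (⟨ThetaFunc n, fun _ => Empty⟩ : FirstOrder.Language).Structure N :=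
    { funMap := fun F x => match F, x with
        | .mk c, x => if h : x ∈ Ω.carrier N then (φ ⟨x, h⟩).1 c else (0 : I.Vec).1 c
      RelMap := fun R _ => R.elim }
  have hin : ∀ x : I.Vec, thetaMap L x.1 = (φ x).1 := fun x => funext fun c => dif_pos x.2
  refine ⟨inferInstance, inferInstance, ⟨I, φ, fun x => (hin x).symm, fun x hx => ?_⟩, hφ, hin, rfl⟩
  exact funext fun c => dif_neg hx

end Large

end

/-! ### Realizing a module in an elementary extension. -/

section

section Extension

variable {L : FirstOrder.Language.{u, v}} {K : Type k} [Field K] {n : ℕ} {Ω : VecFormulas L K n}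

/-- Let `N` be an elementary extension of the reduct of `M`, and let `W` be a `K[X]`-module over
`V(M)`, of which a part `A` is identified with a part of `V(N)`. Then some elementary extension
of `N` carries an endomorphism for which it contains `M` and `W`. -/
theorem exists_extension_of_module {T : L.Theory} {C : KernelConfig K}
    (hΩ : VecFormulas.DefinesInfiniteSpace.{u, v, k, max u v w} Ω T)
    {M N : Type (max u v w)} [L.Structure M] [(withTheta L n).Structure M]
    [(incl L n).IsExpansionOn M] [L.Structure N] [Nonempty N] (hN : N ⊨ T)
    (E : EndoSpace Ω M) (f : M ↪ₑ[L] N) (I : Ω.Space N)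
    {W : Type*} [AddCommGroup W] [Module K W] [Module K[X] W] [IsScalarTower K K[X] W]
    [Small.{max u v w} W] (hW : IsC C W) (ι : E.Mod →ₗ[K[X]] W)
    {A : Type*} [AddCommGroup A] [Module K A] (i : A →ₗ[K] W) (hi : Function.Injective i)
    (j₀ : A →ₗ[K] I.Vec) (hj₀ : Function.Injective j₀) (r : E.Mod → A)
    (hr : ∀ v, i (r v) = ι v) (hr' : ∀ v, (j₀ (r v)).1 = f ∘ E.tup v) :
    ∃ (N' : Type (max u v w)) (_ : L.Structure N') (_ : (withTheta L n).Structure N')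
      (_ : (incl L n).IsExpansionOn N') (g : N ↪ₑ[L] N') (h : M ↪[withTheta L n] N')
      (F : EndoSpace Ω N') (j : W →ₗ[K[X]] F.Mod), IsC C F.Mod ∧ (∀ x, h x = g (f x)) ∧
      ∀ a, F.tup (j (i a)) = g ∘ (j₀ a).1 := by
  have hinf := (hΩ N hN).2
  have : Infinite I.Vec := hinf.to_subtype
  -- Large enough to bound `V(N)`, the module `W` and also `K`, which embeds into `V(N)` through the
  -- multiples of a nonzero vector. The power set of `J` is then embedded into `V(N')`.
  let J : Type (max u v w) := I.Vec ⊕ Shrink.{max u v w} W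
  obtain ⟨N', _, g, ⟨eJ⟩⟩ := exists_elementary_carrier_large.{u, v, k, w} hinf (Set J)
  have : Nonempty N' := ‹Nonempty N›.map g
  have hN' : N' ⊨ T := (g.theory_model_iff T).1 hN
  obtain ⟨I'⟩ := (hΩ N' hN').1
  let V₀ : Submodule K I'.Vec := LinearMap.range (I.map I' g)
  obtain ⟨x₀, hx₀⟩ := exists_ne (0 : I.Vec)
  let eK : K ↪ J := ⟨fun q => Sum.inl (q • x₀), fun q q' h =>
    smul_left_injective K hx₀ (Sum.inl_injective h)⟩
  let e₀ : V₀ ↪ J := (LinearEquiv.ofInjective (I.map I' g)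
    (I.map_injective I' g)).symm.toEquiv.toEmbedding.trans Function.Embedding.inl
  obtain ⟨b, hb⟩ := exists_large_independent V₀ eK e₀ eJ
  let eA := LinearEquiv.ofInjective i hi
  -- On `A` the map is dictated by the identification with a part of `V(N)`; the rest of `W` goes to
  -- fresh independent vectors.
  obtain ⟨j, hj, hjA, hjfin⟩ := exists_extend_injective (LinearMap.range i) V₀
    (I.map I' g ∘ₗ j₀ ∘ₗ eA.symm.toLinearMap)
    ((I.map_injective I' g).comp (hj₀.comp eA.symm.injective))
    (fun a => ⟨_, rfl⟩) b hb
    ⟨(equivShrink.{max u v w} W).toEmbedding.trans Function.Embedding.inr⟩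
  obtain ⟨φ, hφ, hφj⟩ := exists_extend_endomorphism hW j hj hjfin
  obtain ⟨_, _, F, hF, hFφ, rfl⟩ := exists_thetaStructure I' φ hφ
  have hjA' : ∀ a, (j (i a)).1 = g ∘ (j₀ a).1 := by
    intro a
    have h1 := hjA (eA a)
    rw [LinearMap.comp_apply, LinearMap.comp_apply, LinearEquiv.coe_coe,
      LinearEquiv.symm_apply_apply] at h1
    exact congrArg Subtype.val h1
  have hFj : ∀ w, F.of (j ((X : K[X]) • w)) = (X : K[X]) • F.of (j w) := by
    intro w
    apply F.tup_injective
    rw [F.tup_X_smul, F.tup_of, F.tup_of, ← hφj]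
    exact (hFφ (j w)).symm
  -- On `V(M)` the composite factors through `ι` and `j`, both compatible with `X`, so the new
  -- endomorphism extends the old one.
  have htheta : ∀ x : Fin n → M, thetaMap L (g.comp f ∘ x) = g.comp f ∘ thetaMap L x := by
    refine E.theta_comm F (g.comp f) fun x hx => ?_
    obtain ⟨x, rfl⟩ := E.exists_tup hx
    have h1 : ∀ v : E.Mod, (j (ι v)).1 = g.comp f ∘ E.tup v := by
      intro v
      rw [← hr, hjA', hr']
      rfl
    rw [← E.tup_X_smul, ← h1, ← h1, map_smul, hFφ, ← hφj]
  refine ⟨N', inferInstance, inferInstance, inferInstance, g,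
    embeddingOfTheta (g.comp f).toEmbedding htheta, F,
    linearMapOfX (F.of.toLinearMap ∘ₗ j) hFj, hF, fun _ => rfl, fun a => ?_⟩
  exact (F.tup_of _).trans (hjA' a)

end Extension

section Independence

variable {K : Type k} [Field K] {C : KernelConfig K} {S : SeqSystem C} {V W : Type*}
  [AddCommGroup V] [Module K[X] V] [AddCommGroup W] [Module K[X] W]

open Classical in
/-- If no nontrivial reduced combination of `x` lies in the image of `V`, then the elements
`X ^ i • x z` with allowed `(z, i)` are independent over `V`. -/
theorem SeqSystem.eq_zero_of_sum_mem {x : S.Var → W} {i : V →ₗ[K[X]] W}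
    (hx : ∀ p v, S.IsReduced p → S.combo x p = i v → p = 0) {p : ℕ} {e : Fin p → S.Var × ℕ}
    (he : Function.Injective e) (he' : ∀ j, S.Allowed (e j)) (a : Fin p → K) {v : V}
    (h : ∑ j, (Polynomial.C (a j) * X ^ (e j).2) • x (e j).1 = i v) : a = 0 := by
  let P : S.Var → K[X] := ∑ j, Pi.single (e j).1 (monomial (e j).2 (a j))
  -- The sum is collected into one vector of polynomials. As `e` is injective, each `a j` ends up as
  -- a coefficient of its own and can be read off when the vector vanishes.
  have hcoeff : ∀ z d, (P z).coeff d = ∑ j, if e j = (z, d) then a j else 0 := by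
    intro z d
    rw [show P z = ∑ j, (Pi.single (e j).1 (monomial (e j).2 (a j)) : S.Var → K[X]) z from
      Finset.sum_apply _ _ _, finsetSum_coeff]
    refine Finset.sum_congr rfl fun j _ => ?_
    rw [Pi.single_apply]
    by_cases h1 : z = (e j).1
    · subst h1
      rw [if_pos rfl, coeff_monomial]
      congr 1
      rw [Prod.ext_iff]
      simp
    · rw [if_neg h1, coeff_zero, if_neg]
      rintro h2
      exact h1 (by rw [h2])
  have hP : S.combo x P = i v := by
    rw [map_sum, ← h]
    refine Finset.sum_congr rfl fun j _ => ?_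
    rw [S.combo_single, C_mul_X_pow_eq_monomial]
  have hred : S.IsReduced P := by
    intro z d hne
    rw [hcoeff] at hne
    obtain ⟨j, -, hj⟩ := Finset.exists_ne_zero_of_sum_ne_zero hne
    have h1 : e j = (z, d) := by
      by_contra h1
      exact hj (if_neg h1)
    exact h1 ▸ he' j
  have hP0 := hx P v hred hP
  funext j
  have h1 := hcoeff (e j).1 (e j).2
  rw [hP0, Finset.sum_eq_single j, if_pos rfl] at h1
  · exact h1.symm
  · intro j' _ hne
    exact if_neg fun h2 => hne (he h2)
  · exact fun h2 => absurd (Finset.mem_univ j) h2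

end Independence

end

/-! ### Formulas describing diagrams. -/

section

section Diagrams

/-- A formula that, for finitely many formulas that hold in `N`, expresses that they can be realized
simultaneously with prescribed values of some variables. -/
theorem exists_realizability_formula {L : FirstOrder.Language.{u, v}} {N : Type*} [L.Structure N]
    [Nonempty N] {ι : Type*} [Finite ι] (φ : ι → L.Formula N) (hφ : ∀ i, (φ i).Realize id)
    {α : Type*} [Finite α] (a : α → N) :
    ∃ ψ : L.Formula α, ψ.Realize a ∧ ∀ (M : Type w) [L.Structure M] (a' : α → M), ψ.Realize a' →
      ∃ s : N → M, (∀ i, (φ i).Realize s) ∧ ∀ j, s (a j) = a' j := by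
  classical
  have := Fintype.ofFinite ι
  have := Fintype.ofFinite α
  obtain ⟨x₀⟩ := ‹Nonempty N›
  let B : Finset N := insert x₀ (Finset.univ.biUnion (fun i => (φ i).freeVarFinset) ∪
    Finset.univ.image a)
  have hφB : ∀ i, ∀ x ∈ (φ i).freeVarFinset, x ∈ B := fun i x hx => Finset.mem_insert_of_mem
    (Finset.mem_union_left _ (Finset.mem_biUnion.2 ⟨i, Finset.mem_univ i, hx⟩))
  have haB : ∀ j, a j ∈ B := fun j => Finset.mem_insert_of_mem
    (Finset.mem_union_right _ (Finset.mem_image_of_mem _ (Finset.mem_univ j)))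
  -- Finitely many elements of `N` matter and are quantified away; all others may be sent to `x₀`,
  -- since neither the formulas nor the tuple mention them.
  let ρ : N → B := fun x => if hx : x ∈ B then ⟨x, hx⟩ else ⟨x₀, Finset.mem_insert_self _ _⟩
  have hρ : ∀ x (hx : x ∈ B), ρ x = ⟨x, hx⟩ := fun x hx => dif_pos hx
  refine ⟨Formula.iExs B ((Formula.iInf fun i => (φ i).relabel fun x => Sum.inr (ρ x)) ⊓
    Formula.iInf fun j => Term.equal (Term.var (Sum.inr (ρ (a j)))) (Term.var (Sum.inl j))),
    ?_, ?_⟩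
  · refine Formula.realize_iExs.2 ⟨Subtype.val, ?_⟩
    rw [Formula.realize_inf, Formula.realize_iInf, Formula.realize_iInf]
    refine ⟨fun i => Formula.realize_relabel.2 ?_, fun j => ?_⟩
    · refine (realize_congr_freeVar (φ i) fun x hx => ?_).1 (hφ i)
      exact (congrArg Subtype.val (hρ x (hφB i x hx))).symm
    · rw [Formula.realize_equal]
      exact congrArg Subtype.val (hρ _ (haB j))
  · intro M _ a' h
    obtain ⟨t, ht⟩ := Formula.realize_iExs.1 h
    rw [Formula.realize_inf, Formula.realize_iInf, Formula.realize_iInf] at ht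
    refine ⟨t ∘ ρ, fun i => ?_, fun j => ?_⟩
    · have h1 := Formula.realize_relabel.1 (ht.1 i)
      exact h1
    · exact Formula.realize_equal.1 (ht.2 j)

/-- A map that preserves all formulas is an elementary embedding. -/
def elementaryOfFormulas {L : FirstOrder.Language.{u, v}} {N P : Type*} [L.Structure N]
    [L.Structure P] (s : N → P) (hs : ∀ φ : L.Formula N, φ.Realize id → φ.Realize s) :
    N ↪ₑ[L] P where
  toFun := s
  map_formula' m φ x := by
    have h1 : ∀ φ : L.Formula (Fin m), φ.Realize x → φ.Realize (s ∘ x) := by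
      intro φ hφ
      exact Formula.realize_relabel.1 (hs (φ.relabel x) (Formula.realize_relabel.2 hφ))
    refine ⟨fun h => ?_, h1 φ⟩
    by_contra h2
    exact Formula.realize_not.1 (h1 φ.not (Formula.realize_not.2 h2)) h

variable {L : FirstOrder.Language.{u, v}} {n : ℕ} {M N P : Type*}

/-- The formula `y = θ^i(x)`, for tuples of constants from `N`. -/
def iterFormula (M : Type*) (i : ℕ) (x y : Fin n → N) : (withTheta L n).Formula (M ⊕ N) :=
  (Formula.iInf fun c : Fin n => Term.equal (Term.var (Sum.inr c))
    (thetaIter (fun c => Sum.inl c) i c) : (withTheta L n).Formula (Fin n ⊕ Fin n)).relabel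
      (Sum.elim (fun c => Sum.inr (x c)) fun c => Sum.inr (y c))

theorem realize_iterFormula [(withTheta L n).Structure P] (g : M → P) (s : N → P) (i : ℕ)
    (x y : Fin n → N) : (iterFormula (L := L) M i x y).Realize (Sum.elim g s) ↔
      s ∘ y = (thetaMap L)^[i] (s ∘ x) := by
  rw [iterFormula, Formula.realize_relabel, Formula.realize_iInf, funext_iff]
  refine forall_congr' fun c => ?_
  rw [Formula.realize_equal]
  refine Iff.of_eq (congrArg _ ?_)
  exact congrFun (realize_thetaIter (L := L) (fun c => Sum.inl c) i _) c

theorem realize_onFormula_relabel [(withTheta L n).Structure P] [L.Structure P]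
    [(incl L n).IsExpansionOn P] (φ : L.Formula N) (g : M → P) (s : N → P) :
    (((incl L n).onFormula φ).relabel Sum.inr : (withTheta L n).Formula (M ⊕ N)).Realize
      (Sum.elim g s) ↔ φ.Realize s :=
  Formula.realize_relabel.trans ((incl L n).realize_onFormula φ)

theorem realize_constEq [(withTheta L n).Structure P] (g : M → P) (s : N → P) (m : M) (x : N) :
    (Term.equal (Term.var (Sum.inl m)) (Term.var (Sum.inr x)) :
      (withTheta L n).Formula (M ⊕ N)).Realize (Sum.elim g s) ↔ s x = g m := by
  rw [Formula.realize_equal]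
  exact eq_comm

end Diagrams

theorem SeqSystem.allowed_zero {K : Type k} [Field K] {C : KernelConfig K} (S : SeqSystem C)
    (z : S.Var) : S.Allowed (z, 0) := by
  cases z with
  | li l => trivial
  | ld k => exact S.ξ_deg k
  | ke k =>
    change 0 < ((S.f k).1 ^ S.q k).natDegree
    rw [natDegree_pow]
    exact Nat.mul_pos (S.q_pos k) (S.f k).2.1.natDegree_pos

/-- Only allowed monomials occur in a reduced combination, so a `K`-linear statement need only be
checked on these. -/
theorem SeqSystem.combo_mem {K : Type k} [Field K] {C : KernelConfig K} {S : SeqSystem C}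
    {W : Type*} [AddCommGroup W] [Module K W] [Module K[X] W] [IsScalarTower K K[X] W]
    (U : Submodule K W) {x : S.Var → W} (hx : ∀ z i, S.Allowed (z, i) → (X : K[X]) ^ i • x z ∈ U)
    {p : S.Var → K[X]} (hp : S.IsReduced p) : S.combo x p ∈ U := by
  have key : ∀ z, p z • x z ∈ U := by
    intro z
    rw [(p z).as_sum_support_C_mul_X_pow, Finset.sum_smul]
    refine U.sum_mem fun i hi => ?_
    rw [← smul_eq_C_mul, smul_assoc]
    exact U.smul_mem _ (hx z i (hp z i (mem_support_iff.1 hi)))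
  rw [S.combo_apply]
  exact U.add_mem (U.add_mem (U.sum_mem fun _ _ => key _) (U.sum_mem fun _ _ => key _))
    (U.sum_mem fun _ _ => key _)

end

/-! ### Generic image-complete models are existentially closed. -/

section

variable {L : FirstOrder.Language.{u, v}} {K : Type k} [Field K] {n : ℕ} {Ω : VecFormulas L K n}

section

variable {C : KernelConfig K} {M N P : Type*}
  [L.Structure M] [(withTheta L n).Structure M] [L.Structure N] [(withTheta L n).Structure N]

/-- The formula `S(x; y)` for constants `y` from `M` and `x` from `N`. -/
def systemFormula (E : EndoSpace Ω M) (F : EndoSpace Ω N) (S : SeqSystem C) (y : S.Par → E.Mod)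
    (x : S.Var → F.Mod) : (withTheta L n).Formula (M ⊕ N) :=
  (S.formula Ω bvar (fun i => .var fun c => Sum.inl (Sum.inr (i, c))) :
    (withTheta L n).Formula ((Empty ⊕ (S.Par × Fin n)) ⊕ (S.Var × Fin n))).relabel
      (Sum.elim (Sum.elim Empty.elim fun p => Sum.inl (E.tup (y p.1) p.2))
        fun p => Sum.inr (F.tup (x p.1) p.2))

theorem realize_systemFormula [L.Structure P] [(withTheta L n).Structure P]
    [(incl L n).IsExpansionOn P] (E : EndoSpace Ω M) (F : EndoSpace Ω N) (Q : EndoSpace Ω P)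
    (S : SeqSystem C) {y : S.Par → E.Mod} {x : S.Var → F.Mod} {g : M → P} {s : N → P}
    {y' : S.Par → Q.Mod} {x' : S.Var → Q.Mod} (hy : ∀ i, Q.tup (y' i) = g ∘ E.tup (y i))
    (hx : ∀ z, Q.tup (x' z) = s ∘ F.tup (x z)) :
    (systemFormula E F S y x).Realize (Sum.elim g s) ↔ S.IsSolution LinearMap.id y' x' := by
  rw [systemFormula, Formula.realize_relabel]
  have h1 := Q.realize_seqSystem S (γ := Empty) default (fun i => Q.of.symm (y' i))
    fun z => Q.of.symm (x' z)
  simp only [LinearEquiv.apply_symm_apply] at h1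
  rw [← h1]
  congr! 1
  ext ((a | p) | p)
  · exact a.elim
  · exact (congrFun (hy p.1) p.2).symm
  · exact (congrFun (hx p.1) p.2).symm

end

/-- Translates uniqueness of reduced combinations into the `K`-linear independence that genericity
requires. -/
theorem EndoSpace.linIndepOver_of_reduced {M N : Type*} [L.Structure M]
    [(withTheta L n).Structure M] [L.Structure N] [(withTheta L n).Structure N]
    (E : EndoSpace Ω M) (F : EndoSpace Ω N) (f : M ↪ₑ[L] N)
    (hf : ∀ x : Fin n → M, thetaMap L (f ∘ x) = f ∘ thetaMap L x) {C : KernelConfig K}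
    {S : SeqSystem C}
    {x : S.Var → F.Mod}
    (hx : ∀ p v, S.IsReduced p → S.combo x p = E.mapX F f (fun x _ => hf x) v → p = 0)
    {p : ℕ} {e : Fin p → S.Var × ℕ} (he : Function.Injective e) (he' : ∀ j, S.Allowed (e j)) :
    Ω.LinIndepOver f (fun j => ⟨F.tup ((X : K[X]) ^ (e j).2 • x (e j).1), F.tup_mem _⟩) := by
  refine VecFormulas.LinIndepOver.of_linearIndependent E.space F.space
    (x := fun j => F.of.symm ((X : K[X]) ^ (e j).2 • x (e j).1)) ?_
  refine (E.space.linearIndependent_mkQ_iff F.space f _).2 ?_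
  rintro a ⟨v, hv⟩
  refine SeqSystem.eq_zero_of_sum_mem hx he he' a (v := E.of v) ?_
  have h1 := congrArg F.of hv
  rw [map_sum] at h1
  rw [E.mapX_apply]
  refine Eq.trans (Finset.sum_congr rfl fun j _ => ?_) (h1.symm.trans ?_)
  · rw [mul_smul, ← algebraMap_eq, algebraMap_smul, map_smul, LinearEquiv.apply_symm_apply]
  · exact F.tup_injective (by rw [F.tup_of, E.tup_map, E.tup_of]; rfl)

/-- Every sequence system with admissible parameters has a solution of which the powers allowed by
the system realize a given formula, if the formula has a realization in some elementary
extension that is independent over `V`. -/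
def EndoSpace.IsGeneric {M : Type (max u v w)} [L.Structure M] [(withTheta L n).Structure M]
    (E : EndoSpace Ω M) (C : KernelConfig K) : Prop :=
  ∀ (p q : ℕ) (ψ : L.Formula ((Fin p × Fin n) ⊕ Fin q)) (S : SeqSystem C) (e : Fin p → S.Var × ℕ),
    Function.Injective e → (∀ j, S.Allowed (e j)) → ∀ (z : Fin q → M) (y : S.Par → E.Mod),
    S.IsAdmissible y → (∃ (N : Type (max u v w)) (_ : L.Structure N) (f : M ↪ₑ[L] N)
      (x : Fin p → Ω.carrier N), Ω.LinIndepOver f x ∧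
        ψ.Realize (Sum.elim (fun j => (x j.1).1 j.2) (f ∘ z))) →
    ∃ x : S.Var → E.Mod, S.IsSolution LinearMap.id y x ∧
      ψ.Realize (Sum.elim (fun j => E.tup ((X : K[X]) ^ (e j.1).2 • x (e j.1).1) j.2) z)

section

variable {T : L.Theory} {C : KernelConfig K} {M N : Type (max u v w)} [L.Structure M]
  [(withTheta L n).Structure M]
  [(incl L n).IsExpansionOn M] [L.Structure N] [(withTheta L n).Structure N]
  [Nonempty M]

/-- Over a generic `V(M)`, each finite part of `V(N)` can be realized in an elementary extension of
`M` in a way that preserves `L`-formulas and the action of `θ`. -/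
theorem exists_elementary_of_finset
    (hΩ : VecFormulas.DefinesInfiniteSpace.{u, v, k, max u v w} Ω T) (hM : M ⊨ T)
    (E : EndoSpace Ω M) (F : EndoSpace Ω N) (f : M ↪ₑ[L] N)
    (hf : ∀ x : Fin n → M, thetaMap L (f ∘ x) = f ∘ thetaMap L x) (hE : IsImageComplete C E.Mod)
    (hgen : EndoSpace.IsGeneric.{u, v, k, w} E C) (hF : IsC C F.Mod) (B : Finset F.Mod) :
    ∃ (P : Type (max u v w)) (_ : L.Structure P) (_ : (withTheta L n).Structure P)
      (_ : (incl L n).IsExpansionOn P) (g : M ↪ₑ[withTheta L n] P) (h : N ↪ₑ[L] P),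
      (∀ m, h (f m) = g m) ∧ ∀ b ∈ B, thetaMap L (h ∘ F.tup b) = h ∘ thetaMap L (F.tup b) := by
  classical
  have : Nonempty N := ‹Nonempty M›.map f
  obtain ⟨S, y, x, hsol, hadm, hred, hB⟩ := exists_seqSystem hF hE (E.mapX F f fun x _ => hf x)
    (E.map_injective F f) B
  -- Four requirements on an image of `N`: the elementary `L`-diagram, agreement with `M`, the
  -- values of `θ^i(x)` for the allowed monomials only, and the system `S`. The remaining values of
  -- `θ` on the module generated by `x` are forced by these.
  let G : {φ : L.Formula N // φ.Realize id} ⊕ M ⊕ {a // S.Allowed a} ⊕ Unit →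
      (withTheta L n).Formula (M ⊕ N) :=
    Sum.elim (fun φ => ((incl L n).onFormula φ.1).relabel Sum.inr) <|
      Sum.elim (fun m => Term.equal (Term.var (Sum.inl m)) (Term.var (Sum.inr (f m)))) <|
        Sum.elim (fun a => iterFormula M a.1.2 (F.tup (x a.1.1))
          (F.tup ((X : K[X]) ^ a.1.2 • x a.1.1))) fun _ => systemFormula E F S y x
  obtain ⟨P, _, g, s, hs⟩ := exists_elementary_realize_of_finset.{u, v, w} (L := withTheta L n)
      (Set.range G) (by
    intro Δ hΔ
    obtain ⟨D, -, rfl⟩ := Finset.subset_set_image_iff.1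
      (show (Δ : Set _) ⊆ G '' Set.univ by rw [Set.image_univ]; exact hΔ)
    let D₁ := D.toLeft
    let D₂ := D.toRight.toLeft
    -- The monomials of exponent `0` are always included, so that the images of the unknowns
    -- themselves are prescribed.
    let D₃ : Finset (S.Var × ℕ) := D.toRight.toRight.toLeft.map (Function.Embedding.subtype _) ∪
      (Set.toFinite (Set.range fun z : S.Var => (z, 0))).toFinset
    have hD₃ : ∀ a ∈ D₃, S.Allowed a := by
      intro a ha
      rcases Finset.mem_union.1 ha with ha | ha
      · obtain ⟨a, -, rfl⟩ := Finset.mem_map.1 ha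
        exact a.2
      · obtain ⟨z, rfl⟩ := (Set.Finite.mem_toFinset _).1 ha
        exact S.allowed_zero z
    let e : Fin D₃.card → S.Var × ℕ := fun j => (D₃.equivFin.symm j).1
    have he : Function.Injective e := Subtype.val_injective.comp D₃.equivFin.symm.injective
    have hes : ∀ a ∈ D₃, ∃ j, e j = a := fun a ha => ⟨D₃.equivFin ⟨a, ha⟩, by simp [e]⟩
    let z : Fin D₂.card → M := fun i => (D₂.equivFin.symm i).1
    have hzs : ∀ m ∈ D₂, ∃ j, z j = m := fun a ha => ⟨D₂.equivFin ⟨a, ha⟩, by simp [z]⟩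
    obtain ⟨ψ, hψ, hψ'⟩ := exists_realizability_formula.{u, v, max u v w} (fun φ : D₁ => φ.1.1)
      (fun φ => φ.1.2)
      (Sum.elim (fun j : Fin D₃.card × Fin n => F.tup ((X : K[X]) ^ (e j.1).2 • x (e j.1).1) j.2)
        (f ∘ z))
    -- The extension `N` itself, with the monomials of `x`, is the independent realization that
    -- genericity asks for. The outcome is a solution in `M` whose monomials satisfy the chosen
    -- finite fragment.
    obtain ⟨x', hx', hψx'⟩ := hgen _ _ ψ S e he (fun j => hD₃ _ (D₃.equivFin.symm j).2) z y hadm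
      ⟨N, inferInstance, f, _, E.linIndepOver_of_reduced F f hf hred he
        (fun j => hD₃ _ (D₃.equivFin.symm j).2), hψ⟩
    obtain ⟨s, hs₁, hs₂⟩ := hψ' M _ hψx'
    have hsx : ∀ a ∈ D₃, s ∘ F.tup ((X : K[X]) ^ a.2 • x a.1) =
        E.tup ((X : K[X]) ^ a.2 • x' a.1) := by
      intro a ha
      obtain ⟨j, rfl⟩ := hes a ha
      exact funext fun c => hs₂ (Sum.inl (j, c))
    have hsx0 : ∀ z, s ∘ F.tup (x z) = E.tup (x' z) := by
      intro z
      have h1 := hsx (z, 0) (Finset.mem_union_right _ ((Set.Finite.mem_toFinset _).2 ⟨z, rfl⟩))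
      simpa only [pow_zero, one_smul] using h1
    refine ⟨M, inferInstance, ElementaryEmbedding.refl _ M, s, fun φ hφ => ?_⟩
    obtain ⟨a, ha, rfl⟩ := Finset.mem_image.1 hφ
    rcases a with a | a | a | a
    · exact (realize_onFormula_relabel _ _ _).2 (hs₁ ⟨a, Finset.mem_toLeft.2 ha⟩)
    · refine (realize_constEq _ _ _ _).2 ?_
      obtain ⟨j, rfl⟩ := hzs a (Finset.mem_toLeft.2 (Finset.mem_toRight.2 ha))
      exact hs₂ (Sum.inr j)
    · refine (realize_iterFormula _ _ _ _ _).2 ?_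
      rw [hsx0, hsx, E.tup_X_pow_smul]
      refine Finset.mem_union_left _ (Finset.mem_map_of_mem _ ?_)
      exact Finset.mem_toLeft.2 (Finset.mem_toRight.2 (Finset.mem_toRight.2 ha))
    · exact (realize_systemFormula E F E S (fun _ => rfl) fun z => (hsx0 z).symm).2 hx')
  let _ : L.Structure P := (incl L n).reduct P
  have : (incl L n).IsExpansionOn P := LHom.isExpansionOn_reduct _ _
  have hs' : ∀ a, (G a).Realize (Sum.elim g s) := fun a => hs _ ⟨a, rfl⟩
  have : Nonempty P := ‹Nonempty M›.map g
  let g' : M ↪ₑ[L] P := reductElementary g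
  obtain ⟨I⟩ := (hΩ P ((g'.theory_model_iff T).1 hM)).1
  obtain ⟨Q, -⟩ := exists_endoSpace (T := T) I
    ((g.theory_model_iff _).1 (E.models_thetaTheory hM))
  have hg' : ∀ x ∈ Ω.carrier M, thetaMap L (g' ∘ x) = g' ∘ thetaMap L x :=
    fun x _ => theta_comm_of_embedding g.toEmbedding x
  let h : N ↪ₑ[L] P := elementaryOfFormulas s fun φ hφ =>
    (realize_onFormula_relabel φ g s).1 (hs' (Sum.inl ⟨φ, hφ⟩))
  have hfg : ∀ m, h (f m) = g m := fun m =>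
    (realize_constEq g s m (f m)).1 (hs' (Sum.inr (Sum.inl m)))
  have hsolQ : S.IsSolution (E.mapX Q g' hg') y fun z => F.map Q h (x z) :=
    (realize_systemFormula E F Q S (fun i => E.tup_map Q g' (y i)) fun z => F.tup_map Q h _).1
      (hs' (Sum.inr (Sum.inr (Sum.inr ()))))
  -- The generic module maps to `V(N)` by `g₁` and to `V(P)` by `g₂`, both `K[X]`-linearly. The map
  -- induced by `h` is only known to be `K`-linear, but composed with `g₁` it agrees with `g₂` on
  -- `V(M)` and on allowed monomials, hence everywhere. So it commutes with `X` on the range of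
  -- `g₁`, which contains `B`.
  obtain ⟨g₁, hg₁, hg₁'⟩ := S.exists_lift hsol
  obtain ⟨g₂, hg₂, hg₂'⟩ := S.exists_lift hsolQ
  have hall : ∀ z i, S.Allowed (z, i) → F.map Q h ((X : K[X]) ^ i • x z) =
      (X : K[X]) ^ i • F.map Q h (x z) := by
    intro z i hzi
    apply Q.tup_injective
    rw [F.tup_map, Q.tup_X_pow_smul, F.tup_map]
    exact (realize_iterFormula g s i _ _).1 (hs' (Sum.inr (Sum.inr (Sum.inl ⟨(z, i), hzi⟩))))
  have hcomm : ∀ w : S.Generic y, F.map Q h (g₁ w) = g₂ w := by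
    intro w
    obtain ⟨v, p, hp, rfl⟩ := S.exists_reduced y w
    have h1 : S.combo (S.gen y) p ∈ LinearMap.eqLocus
        (F.map Q h ∘ₗ g₁.restrictScalars K) (g₂.restrictScalars K) := by
      refine S.combo_mem _ (fun z i hzi => ?_) hp
      rw [LinearMap.mem_eqLocus, LinearMap.comp_apply, LinearMap.restrictScalars_apply,
        LinearMap.restrictScalars_apply, g₁.map_smul, g₂.map_smul, hg₁', hg₂', hall z i hzi]
    rw [map_add, map_add, map_add, hg₁, hg₂]
    refine congrArg₂ (· + ·) (Q.tup_injective ?_) h1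
    rw [F.tup_map, E.mapX_apply, E.mapX_apply, E.tup_map, E.tup_map]
    exact funext fun c => hfg _
  refine ⟨P, inferInstance, inferInstance, inferInstance, g, h, hfg, fun b hb => ?_⟩
  obtain ⟨w, rfl⟩ : ∃ w, b = g₁ w := by
    obtain ⟨v, p, hvp⟩ := hB b hb
    refine ⟨S.inl y v + S.combo (S.gen y) p, ?_⟩
    rw [hvp, map_add, hg₁, S.combo_apply, S.combo_apply]
    simp only [map_add, map_sum, map_smul, hg₁']
  have h2 := hcomm ((X : K[X]) • w)
  rw [g₁.map_smul, g₂.map_smul, ← hcomm] at h2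
  have h3 := congrArg Q.tup h2
  rw [F.tup_map, Q.tup_X_smul, F.tup_map, F.tup_X_smul] at h3
  exact h3.symm

variable [(incl L n).IsExpansionOn N]

/-- Embeddings of models with generic `V(M)` into models of `T_θ^C` do not change the existential
theory. -/
theorem embedsOverElementary_of_isGeneric
    (hΩ : VecFormulas.DefinesInfiniteSpace.{u, v, k, max u v w} Ω T) (hM : M ⊨ T)
    (E : EndoSpace Ω M) (F : EndoSpace Ω N) (f : M ↪[withTheta L n] N) (fL : M ↪ₑ[L] N)
    (hfL : ∀ x, fL x = f x) (hE : IsImageComplete C E.Mod)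
    (hgen : EndoSpace.IsGeneric.{u, v, k, w} E C) (hF : IsC C F.Mod) :
    EmbedsOverElementary f := by
  classical
  have : Nonempty N := ‹Nonempty M›.map f
  have hf : ∀ x : Fin n → M, thetaMap L (fL ∘ x) = fL ∘ thetaMap L x := by
    intro x
    have h1 : ∀ x : Fin n → M, fL ∘ x = f ∘ x := fun x => funext fun c => hfL _
    rw [h1, h1, theta_comm_of_embedding]
  -- The elementary `L`-diagram of `N`, agreement with `M`, and the graph of `θ` on all of `V(N)`. A
  -- finite subset involves `θ` at finitely many elements only.
  let G : {φ : L.Formula N // φ.Realize id} ⊕ M ⊕ F.Mod → (withTheta L n).Formula (M ⊕ N) :=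
    Sum.elim (fun φ => ((incl L n).onFormula φ.1).relabel Sum.inr) <|
      Sum.elim (fun m => Term.equal (Term.var (Sum.inl m)) (Term.var (Sum.inr (f m))))
        fun b => iterFormula M 1 (F.tup b) (thetaMap L (F.tup b))
  obtain ⟨P, _, g, s, hs⟩ := exists_elementary_realize_of_finset.{u, v, w} (L := withTheta L n)
      (Set.range G) (by
    intro Δ hΔ
    obtain ⟨D, -, rfl⟩ := Finset.subset_set_image_iff.1
      (show (Δ : Set _) ⊆ G '' Set.univ by rw [Set.image_univ]; exact hΔ)
    obtain ⟨P, _, _, _, g, h, hfg, hB⟩ := exists_elementary_of_finset.{u, v, k, w} hΩ hM E F fL hf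
      hE hgen hF D.toRight.toRight
    refine ⟨P, inferInstance, g, h, fun φ hφ => ?_⟩
    obtain ⟨a, ha, rfl⟩ := Finset.mem_image.1 hφ
    rcases a with a | a | a
    · exact (realize_onFormula_relabel _ _ _).2 ((h.map_formula a.1 id).2 a.2)
    · refine (realize_constEq _ _ _ _).2 ?_
      rw [← hfL, hfg]
    · exact (realize_iterFormula _ _ _ _ _).2
        (hB a (Finset.mem_toRight.2 (Finset.mem_toRight.2 ha))).symm)
  let _ : L.Structure P := (incl L n).reduct P
  have : (incl L n).IsExpansionOn P := LHom.isExpansionOn_reduct _ _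
  have hs' : ∀ a, (G a).Realize (Sum.elim g s) := fun a => hs _ ⟨a, rfl⟩
  have : Nonempty P := ‹Nonempty M›.map g
  obtain ⟨I⟩ := (hΩ P (((reductElementary g).theory_model_iff T).1 hM)).1
  obtain ⟨Q, -⟩ := exists_endoSpace (T := T) I
    ((g.theory_model_iff _).1 (E.models_thetaTheory hM))
  let h : N ↪ₑ[L] P := elementaryOfFormulas s fun φ hφ =>
    (realize_onFormula_relabel φ g s).1 (hs' (Sum.inl ⟨φ, hφ⟩))
  have hcomm : ∀ x ∈ Ω.carrier N, thetaMap L (h ∘ x) = h ∘ thetaMap L x := by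
    intro x hx
    obtain ⟨b, rfl⟩ := F.exists_tup hx
    exact ((realize_iterFormula g s 1 _ _).1 (hs' (Sum.inr (Sum.inr b)))).symm
  exact ⟨P, inferInstance, g, embeddingOfTheta h.toEmbedding (F.theta_comm Q h hcomm), fun m =>
    (realize_constEq g s m (f m)).1 (hs' (Sum.inr (Sum.inl m)))⟩

end

end

/-! ### Existentially closed models are generic and image-complete. -/

section

theorem injective_coprod_linearCombination {K V W : Type*} [Field K] [AddCommGroup V] [Module K V]
    [AddCommGroup W] [Module K W] {f : V →ₗ[K] W} (hf : Function.Injective f) {p : ℕ}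
    {x : Fin p → W} (hx : ∀ a : Fin p → K, (∃ v, f v = ∑ j, a j • x j) → a = 0) :
    Function.Injective (f.coprod (Fintype.linearCombination K x)) := by
  rw [injective_iff_map_eq_zero]
  rintro ⟨v, a⟩ h
  rw [LinearMap.coprod_apply, Fintype.linearCombination_apply] at h
  have ha : a = 0 := hx a ⟨-v, by rw [map_neg, neg_eq_iff_add_eq_zero]; exact h⟩
  subst ha
  rw [Prod.mk_eq_zero]
  refine ⟨hf ?_, rfl⟩
  simpa using h

variable {L : FirstOrder.Language.{u, v}} {K : Type k} [Field K] {n : ℕ} {Ω : VecFormulas L K n}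
  {T : L.Theory} {C : KernelConfig K}

theorem exists_reduct_setup (hΩ : VecFormulas.DefinesInfiniteSpace.{u, v, k, w} Ω T)
    {M : Type w} [L.Structure M] [(withTheta L n).Structure M] [(incl L n).IsExpansionOn M]
    [Nonempty M] (h : M ⊨ thetaTheory Ω T) : M ⊨ T ∧ Nonempty (EndoSpace Ω M) := by
  have hM : M ⊨ T := by
    rw [← (incl L n).onTheory_model T]
    exact Theory.Model.mono h (fun φ hφ => Or.inl (Or.inl hφ))
  obtain ⟨I⟩ := (hΩ M hM).1
  obtain ⟨E, -⟩ := exists_endoSpace I h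
  exact ⟨hM, ⟨E⟩⟩

theorem EndoSpace.realize_exists_smul {M : Type*} [L.Structure M]
    [(withTheta L n).Structure M] [(incl L n).IsExpansionOn M] (E : EndoSpace Ω M) (ρ : K[X])
    (x : E.Mod) :
    (exV Ω (Fin 1) (eqV Ω (.poly ρ (bvar 0)) (.var Sum.inl)) :
      (withTheta L n).Formula (Fin n)).Realize (E.tup x) ↔ ∃ y : E.Mod, ρ • y = x := by
  have h1 : ∀ y : Fin 1 → E.space.Vec, (eqV Ω (.poly ρ (bvar 0)) (.var Sum.inl) :
      (withTheta L n).Formula (Fin n ⊕ (Fin 1 × Fin n))).Realize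
        (Sum.elim (E.tup x) fun p => (y p.1).1 p.2) ↔ ρ • E.of (y 0) = x := by
    intro y
    rw [E.realize_eqV (VTerm.All.poly _ (all_bvar _ y 0)) (by exact E.tup_mem x), VTerm.val_poly,
      E.space.val_bvar, E.smul_of]
    have h2 : E.space.env (Sum.elim (E.tup x) fun p : Fin 1 × Fin n => (y p.1).1 p.2) Sum.inl =
      E.of.symm x := E.space.env_eq rfl
    refine (Iff.of_eq (congrArg _ h2)).trans ?_
    rw [LinearEquiv.eq_symm_apply]
  rw [realize_exV, E.of.surjective.exists]
  constructor
  · rintro ⟨y, hy⟩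
    exact ⟨y 0, (h1 y).1 hy⟩
  · rintro ⟨y, hy⟩
    exact ⟨fun _ => y, (h1 fun _ => y).2 hy⟩

section

variable {M : Type (max u v w)} [L.Structure M] [(withTheta L n).Structure M]
  [(incl L n).IsExpansionOn M] [Nonempty M]

/-- A module over `V(M)`, part of which is identified with a part of `V(N)` for an elementary
extension `N` of the reduct, is realized in an elementary extension of an existentially closed
model. -/
theorem exists_elementary_of_module (hT : IsModelComplete.{u, v, max u v w} T)
    (hΩ : VecFormulas.DefinesInfiniteSpace.{u, v, k, max u v w} Ω T) (hM : M ⊨ T)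
    (hec : ∀ (N : Type (max u v w)) [(withTheta L n).Structure N] [Nonempty N],
      N ⊨ configTheory Ω T C → ∀ f : M ↪[withTheta L n] N, EmbedsOverElementary f)
    {N : Type (max u v w)} [L.Structure N]
    (E : EndoSpace Ω M) (f : M ↪ₑ[L] N) (I : Ω.Space N)
    {W : Type*} [AddCommGroup W] [Module K W] [Module K[X] W] [IsScalarTower K K[X] W]
    [Small.{max u v w} W] (hW : IsC C W) (ι : E.Mod →ₗ[K[X]] W)
    {A : Type*} [AddCommGroup A] [Module K A] (i : A →ₗ[K] W) (hi : Function.Injective i)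
    (j₀ : A →ₗ[K] I.Vec) (hj₀ : Function.Injective j₀) (r : E.Mod → A)
    (hr : ∀ v, i (r v) = ι v) (hr' : ∀ v, (j₀ (r v)).1 = f ∘ E.tup v) :
    ∃ (P : Type (max u v w)) (_ : L.Structure P) (_ : (withTheta L n).Structure P)
      (_ : (incl L n).IsExpansionOn P) (gN : N ↪ₑ[L] P) (g : M ↪ₑ[withTheta L n] P)
      (Q : EndoSpace Ω P) (j : W →ₗ[K[X]] Q.Mod), (∀ x, gN (f x) = g x) ∧
      ∀ a, Q.tup (j (i a)) = gN ∘ (j₀ a).1 := by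
  have : Nonempty N := ‹Nonempty M›.map f
  have hN : N ⊨ T := (f.theory_model_iff T).1 hM
  obtain ⟨N', _, _, _, gN, h, F, j, hF, hh, hj⟩ := exists_extension_of_module.{u, v, k, w}
    hΩ hN E f I hW ι i hi j₀ hj₀ r hr hr'
  have : Nonempty N' := ‹Nonempty N›.map gN
  have hN' : N' ⊨ T := (gN.theory_model_iff T).1 hN
  obtain ⟨P, _, g, hP, hPg⟩ := hec N' ((F.models_configTheory_iff C hN').2 hF) h
  let _ : L.Structure P := (incl L n).reduct P
  have : (incl L n).IsExpansionOn P := LHom.isExpansionOn_reduct _ _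
  have : Nonempty P := ‹Nonempty M›.map g
  have hPT : P ⊨ thetaTheory Ω T := (g.theory_model_iff _).1 (E.models_thetaTheory hM)
  obtain ⟨hPT', ⟨Q⟩⟩ := exists_reduct_setup hΩ hPT
  obtain ⟨gP, hgP⟩ := hT N' P hN' hPT' (reductEmbedding hP)
  have hcomm : ∀ x ∈ Ω.carrier N', thetaMap L (gP ∘ x) = gP ∘ thetaMap L x := by
    intro x _
    have h1 : ∀ x : Fin n → N', gP ∘ x = hP ∘ x := fun x => funext fun c => hgP _
    rw [h1, h1, theta_comm_of_embedding]
  refine ⟨P, inferInstance, inferInstance, inferInstance, gP.comp gN, g, Q,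
    F.mapX Q gP hcomm ∘ₗ j, fun x => ?_, fun a => ?_⟩
  · exact (congrArg gP (hh x)).symm.trans ((hgP _).trans (hPg x))
  · rw [LinearMap.comp_apply, F.mapX_apply, F.tup_map, hj]
    rfl

/-- A missing preimage can be adjoined to `V(M)` within the class of `C`-modules. Realized in an
elementary extension of `M`, it shows that a preimage exists in `M`. No new `L`-information is
prescribed, so `N = M` and `A = V(M)`. -/
theorem isImageComplete_of_existentiallyClosed (hT : IsModelComplete.{u, v, max u v w} T)
    (hΩ : VecFormulas.DefinesInfiniteSpace.{u, v, k, max u v w} Ω T) (hM : M ⊨ T)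
    (hec : ∀ (N : Type (max u v w)) [(withTheta L n).Structure N] [Nonempty N],
      N ⊨ configTheory Ω T C → ∀ f : M ↪[withTheta L n] N, EmbedsOverElementary f)
    (E : EndoSpace Ω M) (hE : IsC C E.Mod) : IsImageComplete C E.Mod := by
  intro f hf u
  obtain ⟨W, _, _, ι, hι, hW, w, hw⟩ := exists_image_extension hE hf u
  let _ : Module K W := Module.compHom W (algebraMap K K[X])
  have : IsScalarTower K K[X] W := ⟨fun a p x => by
    rw [Algebra.smul_def, mul_smul]
    rfl⟩
  obtain ⟨P, _, _, _, gN, g, Q, j, hg, hj⟩ := exists_elementary_of_module.{u, v, k, w} hT hΩ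
    hM hec E (ElementaryEmbedding.refl L M) E.space hW ι (ι.restrictScalars K) hι E.of.symm.toLinearMap
    E.of.symm.injective id (fun _ => rfl) (fun _ => rfl)
  rw [← E.realize_exists_smul, ← g.map_formula]
  have h1 : g ∘ E.tup (f.1 ^ C.exp f • u) = Q.tup (j (ι (f.1 ^ C.exp f • u))) := by
    refine Eq.trans ?_ (hj _).symm
    exact funext fun c => (hg _).symm
  rw [h1, Q.realize_exists_smul]
  exact ⟨j w, by rw [← map_smul, hw]⟩

/-- The sum of `V(M)` and `K^p` embeds into the generic module through the allowed monomials, and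
into `V(N)` through the given independent tuple. Amalgamating along it produces a solution of `S`
whose monomials realize `ψ` in an elementary extension of `M`, and therefore one in `M`. -/
theorem isGeneric_of_existentiallyClosed (hT : IsModelComplete.{u, v, max u v w} T)
    (hΩ : VecFormulas.DefinesInfiniteSpace.{u, v, k, max u v w} Ω T) (hM : M ⊨ T)
    (hec : ∀ (N : Type (max u v w)) [(withTheta L n).Structure N] [Nonempty N],
      N ⊨ configTheory Ω T C → ∀ f : M ↪[withTheta L n] N, EmbedsOverElementary f)
    (E : EndoSpace Ω M) (hE : IsC C E.Mod) : EndoSpace.IsGeneric.{u, v, k, w} E C := by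
  rintro p q ψ S e he he' z y hadm ⟨N, _, f, x, hind, hψ⟩
  have : Nonempty N := ‹Nonempty M›.map f
  obtain ⟨I⟩ := (hΩ N ((f.theory_model_iff T).1 hM)).1
  have : Infinite E.space.Vec := (hΩ M hM).2.to_subtype
  -- `K` may live in a larger universe, but it embeds into `V(M)` through the multiples of a nonzero
  -- vector. This makes the generic module small enough to be placed inside a model.
  have : Small.{max u v w} K[X] := by
    obtain ⟨x₀, hx₀⟩ := exists_ne (0 : E.space.Vec)
    have : Small.{max u v w} K := small_of_injective (smul_left_injective K hx₀)
    exact small_of_injective (f := fun p : K[X] => p.coeff) coeff_injective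
  have : Small.{max u v w} (S.Generic y) := small_of_surjective (S.toGeneric_surjective y)
  have hind' := (E.space.linearIndependent_mkQ_iff I f (x := x)).1 (hind.of_space E.space I)
  let i := ((S.inl y).restrictScalars K).coprod
    (Fintype.linearCombination K fun j => (X : K[X]) ^ (e j).2 • S.gen y (e j).1)
  have hi : Function.Injective i := by
    refine injective_coprod_linearCombination (S.inl_injective y) ?_
    rintro a ⟨v, hv⟩
    refine SeqSystem.eq_zero_of_sum_mem (x := S.gen y) (i := S.inl y)
      (fun p v hp h => S.combo_gen_mem_range hp h) he he' a (v := v) ?_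
    refine Eq.trans (Finset.sum_congr rfl fun j _ => ?_) hv.symm
    rw [mul_smul, ← algebraMap_eq, algebraMap_smul]
  let j₀ := (E.space.map I f ∘ₗ E.of.symm.toLinearMap).coprod
    (Fintype.linearCombination K (fun j => (x j : I.Vec)))
  have hj₀ : Function.Injective j₀ := by
    refine injective_coprod_linearCombination
      ((E.space.map_injective I f).comp E.of.symm.injective) ?_
    rintro a ⟨v, hv⟩
    exact hind' a ⟨_, hv⟩
  have hj₀' : ∀ v, (j₀ (v, 0)).1 = f ∘ E.tup v := by
    intro v
    have h1 : j₀ (v, 0) = E.space.map I f (E.of.symm v) := by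
      rw [LinearMap.coprod_apply, map_zero, add_zero]
      rfl
    rw [h1]
    rfl
  have hi' : ∀ v, i (v, 0) = S.inl y v := by
    intro v
    rw [LinearMap.coprod_apply, map_zero, add_zero]
    rfl
  obtain ⟨P, _, _, _, gN, g, Q, j, hg, hj⟩ := exists_elementary_of_module.{u, v, k, w} hT hΩ
    hM hec E f I (S.isC_generic hE hadm) (S.inl y) i hi j₀ hj₀ (fun v => (v, 0)) hi' hj₀'
  have hjv : ∀ v, Q.tup (j (S.inl y v)) = g ∘ E.tup v := by
    intro v
    rw [← hi', hj, hj₀']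
    exact funext fun c => hg _
  have hjx : ∀ l, Q.tup ((X : K[X]) ^ (e l).2 • j (S.gen y (e l).1)) = gN ∘ (x l).1 := by
    classical
    intro l
    have h1 : i (0, Pi.single l 1) = (X : K[X]) ^ (e l).2 • S.gen y (e l).1 := by
      rw [LinearMap.coprod_apply, map_zero, zero_add, Fintype.linearCombination_apply_single,
        one_smul]
    have h2 : j₀ (0, Pi.single l 1) = (x l : I.Vec) := by
      rw [LinearMap.coprod_apply, map_zero, zero_add]
      exact (Fintype.linearCombination_apply_single ..).trans (one_smul _ _)
    rw [← j.map_smul, ← h1, hj, h2]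
  have hsol := S.isSolution_gen y
  have key := (Q.realize_existsSolution S e ψ (g ∘ z) (fun l => Q.of.symm (j (S.inl y (y l))))).2
    ⟨fun l => j (S.gen y l), ?_, ?_⟩
  · have h3 := (E.realize_existsSolution S e ψ z (fun l => E.of.symm (y l))).1 (by
      rw [← g.map_formula]
      convert key using 1
      ext ((a | a) | a)
      · exact a.elim
      · rfl
      · exact (congrFun (hjv _) _).symm)
    simpa only [LinearEquiv.apply_symm_apply] using h3
  · refine ⟨fun l => ?_, fun l => ?_⟩
    · simp only [LinearEquiv.apply_symm_apply, LinearMap.id_apply, ← map_smul, ← map_sum, ← map_add,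
        hsol.1 l]
    · simp only [LinearEquiv.apply_symm_apply, LinearMap.id_apply, ← map_smul, hsol.2 l]
  · rw [← gN.map_formula] at hψ
    convert hψ using 1
    ext (a | a)
    · exact congrFun (hjx a.1) a.2
    · exact (hg _).symm

end

end

/-! ### Chains of models of `T_θ^C` and the characterization of the companion. -/

section

variable {L : FirstOrder.Language.{u, v}} {K : Type k} [Field K] {n : ℕ} {Ω : VecFormulas L K n}
  {T : L.Theory} {C : KernelConfig K}

/-- Each condition in `IsC` concerns one element at a time, so it may be checked in submodules that
cover `V`. -/
theorem IsC.of_lift {V : Type*} [AddCommGroup V] [Module K[X] V]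
    (h : ∀ v : V, ∃ (W : Type w) (_ : AddCommGroup W) (_ : Module K[X] W) (i : W →ₗ[K[X]] V),
      Function.Injective i ∧ IsC C W ∧ v ∈ LinearMap.range i) : IsC C V := by
  refine ⟨fun hd v => ?_, fun hd f hf v hv => ?_⟩
  · obtain ⟨W, _, _, i, -, hW, w, rfl⟩ := h v
    rw [← map_smul, hW.1 hd, map_zero]
  · obtain ⟨W, _, _, i, hi, hW, w, rfl⟩ := h v
    rw [← map_smul, map_eq_zero_iff i hi] at hv
    rw [← map_smul, hW.2 hd f hf w hv, map_zero]

/-- The theory `T_θ^C` is preserved under unions of chains. -/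
theorem configTheory_of_isChainUnion (hT : IsModelComplete.{u, v, w} T)
    (hΩ : VecFormulas.DefinesInfiniteSpace.{u, v, k, w} Ω T)
    {G : ℕ → Type w} [∀ i, (withTheta L n).Structure (G i)] [∀ i, Nonempty (G i)]
    {f : ∀ i, G i ↪[withTheta L n] G (i + 1)} {N : Type w} [(withTheta L n).Structure N]
    [Nonempty N] {h : ∀ i, G i ↪[withTheta L n] N} (H : IsChainUnion (withTheta L n) f h)
    (hG : ∀ i, G i ⊨ configTheory Ω T C) : N ⊨ configTheory Ω T C := by
  let _ : ∀ i, L.Structure (G i) := fun i => (incl L n).reduct (G i)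
  have : ∀ i, (incl L n).IsExpansionOn (G i) := fun i => LHom.isExpansionOn_reduct _ _
  let _ : L.Structure N := (incl L n).reduct N
  have : (incl L n).IsExpansionOn N := LHom.isExpansionOn_reduct _ _
  have hGE : ∀ i, G i ⊨ T ∧ Nonempty (EndoSpace Ω (G i)) := fun i =>
    exists_reduct_setup hΩ (Theory.Model.mono (hG i) Set.subset_union_left)
  have hGT : ∀ i, G i ⊨ T := fun i => (hGE i).1
  have E : ∀ i, EndoSpace Ω (G i) := fun i => (hGE i).2.some
  have H' : IsChainUnion L (fun i => reductEmbedding (f i)) (fun i => reductEmbedding (h i)) :=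
    ⟨H.compat, H.surj⟩
  choose g hg using H'.elementary hT hGT
  have hN : N ⊨ T := ((g 0).theory_model_iff T).1 (hGT 0)
  obtain ⟨I⟩ := (hΩ N hN).1
  have hθ : ∀ i (x : Fin n → G i), thetaMap L (g i ∘ x) = g i ∘ thetaMap L x := by
    intro i x
    have h1 : ∀ x : Fin n → G i, g i ∘ x = h i ∘ x := fun x => funext fun c => hg i _
    rw [h1, h1, theta_comm_of_embedding]
  -- Finitely many tuples come from one member of the chain, which is `L`-elementary in `N`; thus
  -- membership in `V`, linearity of `θ` and the `C`-condition are all inherited from there.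
  have hlift : ∀ {ι : Type} [Finite ι] (x : ι → Fin n → N), ∃ i, ∃ x' : ι → Fin n → G i,
      ∀ l, g i ∘ x' l = x l := by
    intro ι _ x
    obtain ⟨i, -, a, ha⟩ := H.exists_lift (fun p : ι × Fin n => x p.1 p.2) 0
    exact ⟨i, fun l c => a (l, c), fun l => funext fun c => (hg i _).trans (ha (l, c))⟩
  have hliftV : ∀ {ι : Type} [Finite ι] (x : ι → I.Vec), ∃ i, ∃ x' : ι → (E i).space.Vec,
      ∀ l, (E i).space.map I (g i) (x' l) = x l := by
    intro ι _ x
    obtain ⟨i, x', hx'⟩ := hlift fun l => (x l).1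
    refine ⟨i, fun l => ⟨x' l, ((g i).map_formula Ω.dom (x' l)).1 ?_⟩, fun l => Subtype.ext (hx' l)⟩
    rw [hx' l]
    exact (x l).2
  have hθV : ∀ i (x : (E i).space.Vec), thetaMap L ((E i).space.map I (g i) x).1 =
      ((E i).space.map I (g i) ((E i).endo x)).1 := by
    intro i x
    refine (hθ i x.1).trans ?_
    exact congrArg (g i ∘ ·) ((E i).endo_coe x).symm
  have hmem : ∀ x : I.Vec, thetaMap L x.1 ∈ Ω.carrier N := by
    intro x
    obtain ⟨i, x', hx'⟩ := hliftV ![x]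
    have h1 : (E i).space.map I (g i) (x' 0) = x := hx' 0
    rw [← h1, hθV]
    exact Subtype.coe_prop _
  let φ : I.Vec → I.Vec := fun x => ⟨thetaMap L x.1, hmem x⟩
  have hφ : ∀ i (x : (E i).space.Vec), φ ((E i).space.map I (g i) x) =
      (E i).space.map I (g i) ((E i).endo x) := fun i x => Subtype.ext (hθV i x)
  let F : EndoSpace Ω N := ⟨I, ⟨⟨φ, fun x y => by
      obtain ⟨i, x', hx'⟩ := hliftV ![x, y]
      have h1 : (E i).space.map I (g i) (x' 0) = x := hx' 0
      have h2 : (E i).space.map I (g i) (x' 1) = y := hx' 1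
      rw [← h1, ← h2, ← map_add, hφ, hφ, hφ, map_add, map_add]⟩, fun q x => by
      obtain ⟨i, x', hx'⟩ := hliftV ![x]
      have h1 : (E i).space.map I (g i) (x' 0) = x := hx' 0
      change φ (q • x) = q • φ x
      rw [← h1, ← map_smul, hφ, hφ, map_smul, map_smul]⟩, fun _ => rfl, fun x hx => by
      obtain ⟨i, x', hx'⟩ := hlift fun _ : Fin 1 => x
      have h1 : g i ∘ x' 0 = x := hx' 0
      have h2 : x' 0 ∉ Ω.carrier (G i) := fun h3 =>
        hx (h1 ▸ ((g i).map_formula Ω.dom (x' 0)).2 h3)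
      rw [← h1, hθ, (E i).outside _ h2, ← (E i).space.map_coe I, map_zero]⟩
  refine (F.models_configTheory_iff C hN).2 (IsC.of_lift fun v => ?_)
  obtain ⟨i, x', hx'⟩ := hliftV ![F.of.symm v]
  refine ⟨(E i).Mod, inferInstance, inferInstance, (E i).mapX F (g i) fun x _ => hθ i x,
    (E i).map_injective F (g i), ((E i).models_configTheory_iff C (hGT i)).1 (hG i),
    (E i).of (x' 0), ?_⟩
  apply F.tup_injective
  rw [(E i).mapX_apply, (E i).tup_map, (E i).tup_of]
  exact congrArg Subtype.val (hx' 0)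

/-- The choice of the formulas `σ` disappears: by `hσ` they may be replaced by the existence of an
independent realization in an elementary extension. -/
theorem models_companionTheory_iff {M : Type (max u v w)} [L.Structure M]
    [(withTheta L n).Structure M] [(incl L n).IsExpansionOn M] [Nonempty M] (hM : M ⊨ T)
    (E : EndoSpace Ω M) {σ : ∀ {p q : ℕ}, L.Formula ((Fin p × Fin n) ⊕ Fin q) → L.Formula (Fin q)}
    (hσ : ∀ (p q : ℕ) (ψ : L.Formula ((Fin p × Fin n) ⊕ Fin q)),
      VecFormulas.ExpressesIndepRealization.{u, v, k, max u v w} Ω T ψ (σ ψ)) :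
    M ⊨ companionTheory Ω T C σ ↔
      IsC C E.Mod ∧ IsImageComplete C E.Mod ∧ EndoSpace.IsGeneric.{u, v, k, w} E C := by
  rw [← E.models_configTheory_iff C hM, ← E.models_imageCompleteSentences_iff C]
  have key : ∀ {p q : ℕ} (ψ : L.Formula ((Fin p × Fin n) ⊕ Fin q)) (S : SeqSystem C)
      (e : Fin p → S.Var × ℕ), M ⊨ S.companionSentence Ω e ψ (σ ψ) ↔
      ∀ (z : Fin q → M) (y : S.Par → E.Mod), S.IsAdmissible y →
        (∃ (N : Type (max u v w)) (_ : L.Structure N) (f : M ↪ₑ[L] N)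
          (x : Fin p → Ω.carrier N), Ω.LinIndepOver f x ∧
          ψ.Realize (Sum.elim (fun j => (x j.1).1 j.2) (f ∘ z))) →
        ∃ x : S.Var → E.Mod, S.IsSolution LinearMap.id y x ∧
          ψ.Realize (Sum.elim (fun j => E.tup ((X : K[X]) ^ (e j.1).2 • x (e j.1).1) j.2) z) := by
    intro p q ψ S e
    rw [E.realize_companionSentence]
    refine forall_congr' fun z => forall_congr' fun y => ?_
    rw [hσ p q ψ M hM z]
    exact ⟨fun h h1 h2 => h h2 h1, fun h h1 h2 => h h2 h1⟩
  constructor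
  · intro h
    refine ⟨Theory.Model.mono h fun φ hφ => Or.inl (Or.inl hφ),
      Theory.Model.mono h fun φ hφ => Or.inl (Or.inr hφ), fun p q ψ S e he he' => (key ψ S e).1 ?_⟩
    exact (Theory.model_iff _).1 h _ (Or.inr ⟨p, q, ψ, S, e, he, he', rfl⟩)
  · rintro ⟨h1, h2, h3⟩
    rw [Theory.model_iff]
    rintro φ ((hφ | hφ) | ⟨p, q, ψ, S, e, he, he', rfl⟩)
    · exact (Theory.model_iff _).1 h1 φ hφ
    · exact (Theory.model_iff _).1 h2 φ hφ
    · exact (key ψ S e).2 (h3 p q ψ S e he he')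

/-- The models of the companion theory are the existentially closed models of `T_θ^C`. -/
theorem models_companionTheory_iff_isExistentiallyClosedModel
    (hT : IsModelComplete.{u, v, max u v w} T)
    (hΩ : VecFormulas.DefinesInfiniteSpace.{u, v, k, max u v w} Ω T)
    {σ : ∀ {p q : ℕ}, L.Formula ((Fin p × Fin n) ⊕ Fin q) → L.Formula (Fin q)}
    (hσ : ∀ (p q : ℕ) (ψ : L.Formula ((Fin p × Fin n) ⊕ Fin q)),
      VecFormulas.ExpressesIndepRealization.{u, v, k, max u v w} Ω T ψ (σ ψ))
    (M : Type (max u v w)) [(withTheta L n).Structure M] [Nonempty M] :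
    M ⊨ companionTheory Ω T C σ ↔
      IsExistentiallyClosedModel.{u, v, max u v w} (configTheory Ω T C) M := by
  by_cases hMc : M ⊨ configTheory Ω T C
  swap
  · refine iff_of_false (fun h => hMc ?_) fun h => hMc h.1
    exact Theory.Model.mono h fun φ hφ => Or.inl (Or.inl hφ)
  let _ : L.Structure M := (incl L n).reduct M
  have : (incl L n).IsExpansionOn M := LHom.isExpansionOn_reduct _ _
  obtain ⟨hM, ⟨E⟩⟩ := exists_reduct_setup hΩ (Theory.Model.mono hMc Set.subset_union_left)
  have hE : IsC C E.Mod := (E.models_configTheory_iff C hM).1 hMc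
  rw [models_companionTheory_iff.{u, v, k, w} hM E hσ, isExistentiallyClosedModel_iff.{u, v, w}]
  constructor
  · rintro ⟨-, h1, h2⟩
    refine ⟨hMc, fun N _ _ hNc f => ?_⟩
    let _ : L.Structure N := (incl L n).reduct N
    have : (incl L n).IsExpansionOn N := LHom.isExpansionOn_reduct _ _
    obtain ⟨hN, ⟨F⟩⟩ := exists_reduct_setup hΩ (Theory.Model.mono hNc Set.subset_union_left)
    obtain ⟨fL, hfL⟩ := hT M N hM hN (reductEmbedding f)
    exact embedsOverElementary_of_isGeneric.{u, v, k, w} hΩ hM E F f fL hfL h1 h2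
      ((F.models_configTheory_iff C hN).1 hNc)
  · rintro ⟨-, h⟩
    have h' : ∀ (N : Type (max u v w)) [(withTheta L n).Structure N] [Nonempty N],
        N ⊨ configTheory Ω T C → ∀ f : M ↪[withTheta L n] N, EmbedsOverElementary f :=
      fun N _ _ hN f => h N hN f
    exact ⟨hE, isImageComplete_of_existentiallyClosed.{u, v, k, w} hT hΩ hM h' E hE,
      isGeneric_of_existentiallyClosed.{u, v, k, w} hT hΩ hM h' E hE⟩

/-- Every model of the inductive theory `T_θ^C` extends to an existentially closed one, and
embeddings between existentially closed models pass Robinson's test. -/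
theorem isModelCompanion_companionTheory (hT : IsModelComplete.{u, v, max u v w} T)
    (hΩ : VecFormulas.DefinesInfiniteSpace.{u, v, k, max u v w} Ω T)
    {σ : ∀ {p q : ℕ}, L.Formula ((Fin p × Fin n) ⊕ Fin q) → L.Formula (Fin q)}
    (hσ : ∀ (p q : ℕ) (ψ : L.Formula ((Fin p × Fin n) ⊕ Fin q)),
      VecFormulas.ExpressesIndepRealization.{u, v, k, max u v w} Ω T ψ (σ ψ)) :
    IsModelCompanion.{u, v, max u v w} (configTheory Ω T C) (companionTheory Ω T C σ) := by
  have hiff := models_companionTheory_iff_isExistentiallyClosedModel.{u, v, k, w} (C := C) hT hΩ hσ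
  refine ⟨fun M _ _ hM => ?_, fun M _ _ hM => ?_, ?_⟩
  · obtain ⟨N, _, _, hN, hMN⟩ := exists_isExistentiallyClosedModel.{u, v, w} (configTheory Ω T C)
      (fun G _ _ f N _ _ h H hG => configTheory_of_isChainUnion.{u, v, k, max u v w} hT hΩ H hG)
      M hM
    exact ⟨N, inferInstance, (hiff N).2 hN, hMN⟩
  · exact ⟨M, inferInstance, ((hiff M).1 hM).1, ⟨Embedding.refl _ M⟩⟩
  · refine isModelComplete_of_embedsOverElementary _ fun M N _ _ _ _ hM hN f => ?_
    exact ((isExistentiallyClosedModel_iff.{u, v, w} _ M).1 ((hiff M).1 hM)).2 N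
      ((hiff N).1 hN).1 f

end

end VecEndo

end

theorem theorem3p45 {L : FirstOrder.Language.{u, v}} {K : Type k} [Field K] {n : ℕ}
    (T : L.Theory) (Ω : VecFormulas L K n)
    (hT : IsModelComplete.{u, v, max u v w} T)
    (hΩ : VecFormulas.DefinesInfiniteSpace.{u, v, k, max u v w} Ω T)
    (hH4 : VecFormulas.H4.{u, v, k, max u v w} Ω T)
    (C : KernelConfig K) :
    (∃ T' : (withTheta L n).Theory,
      IsModelCompanion.{u, v, max u v w} (configTheory Ω T C) T') ∧
    ∀ σ : ∀ {p q : ℕ}, L.Formula ((Fin p × Fin n) ⊕ Fin q) → L.Formula (Fin q),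
      (∀ (p q : ℕ) (ψ : L.Formula ((Fin p × Fin n) ⊕ Fin q)),
        VecFormulas.ExpressesIndepRealization.{u, v, k, max u v w} Ω T ψ (σ ψ)) →
      IsModelCompanion.{u, v, max u v w} (configTheory Ω T C) (companionTheory Ω T C σ) ∧
      ∀ (M : Type (max u v w)) [(withTheta L n).Structure M] [Nonempty M],
        M ⊨ companionTheory Ω T C σ ↔
          IsExistentiallyClosedModel.{u, v, max u v w} (configTheory Ω T C) M := by
  constructor
  · choose σ hσ using hH4
    exact ⟨_, isModelCompanion_companionTheory.{u, v, k, w} (σ := fun {p q} => σ p q) hT hΩ hσ⟩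
  · intro σ hσ
    exact ⟨isModelCompanion_companionTheory.{u, v, k, w} hT hΩ hσ,
      models_companionTheory_iff_isExistentiallyClosedModel.{u, v, k, w} hT hΩ hσ⟩
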